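/- Let $K$ be a field of characteristic $0$ and let $\mathcal{M}$ be a rigid $K$-linear tensor category, that is, a $K$-linear pseudo-abelian (additive, idempotent complete) symmetric monoidal category with $K$-bilinear tensor product in which every object $M$ has a dual $M^*$; assume that $K\to\operatorname{End}(\mathbf 1)$ is bijective. For $n\ge 0$ let $S^n(M)$ and $\Lambda^n(M)$ be the images of the projectors $\frac1{n!}\sum_{\sigma\in S_n}\sigma$ and $\frac1{n!}\sum_{\sigma\in S_n}\operatorname{sgn}(\sigma)\,\sigma$ of $M^{\otimes n}$, and let $\chi(M)=\operatorname{tr}(1_M)\in\operatorname{End}(\mathbf 1)=K$. An object $M$ is called positive (resp. negative) if $\Lambda^N(M)=0$ (resp. $S^N(M)=0$) for some $N>0$, and an object $L$ is called invertible if $L\otimes T\simeq\mathbf 1$ for some object $T$; then $L^{-1}:=L^*\simeq T$. Let $K_0(\mathcal{M})$ be the Grothendieck ring of $\mathcal M$ with respect to $\oplus$ and $\otimes$, and let $$Z_{\mathcal M}(M,T)=\sum_{n\ge 0}[S^n(M)]\,T^n\in K_0(\mathcal M)[[T]].$$ Let $M\simeq M^+\oplus M^-$ with $M^+$ positive and $M^-$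 negative. Then $\chi(M^+)=\chi^+(M)$ and $-\chi(M^-)=-\chi^-(M)$ are non-negative integers, $\chi(M)$ is an integer, and $\Lambda^{\chi^+(M)}(M^+)$ and $S^{-\chi^-(M)}(M^-)$ are invertible, so that the object $$\det(M)=\Lambda^{\chi^+(M)}(M^+)\otimes S^{-\chi^-(M)}(M^-)^{-1}$$ is defined. Moreover, $Z_{\mathcal M}(M,T)$ and $Z_{\mathcal M}(M^*,T)$ are the expansions of rational functions, namely of (unique) fractions $P/Q$ of Laurent polynomials over $K_0(\mathcal M)$ such that $Q$ is invertible both as a Laurent series in $T$ and as a Laurent series in $T^{-1}$, and these rational functions satisfy the functional equation $$Z_{\mathcal M}(M^*,T^{-1})=(-1)^{\chi^+(M)}\,[\det(M)]\,T^{\chi(M)}\,Z_{\mathcal M}(M,T).$$ -/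

import Mathlib

open CategoryTheory CategoryTheory.Limits MonoidalCategory
open scoped LaurentPolynomial

universe w v u

noncomputable section

namespace KimuraZeta

section TensorPowers

variable {C : Type u} [Category.{v} C] [MonoidalCategory C]

/-- The tensor power `M ⊗ (M ⊗ (⋯ ⊗ 𝟙))` with `n` factors `M`. -/
def tensorPow (M : C) : ℕ → C
  | 0 => 𝟙_ C
  | n + 1 => M ⊗ tensorPow M n

/-- Left whiskering `f ↦ M ◁ f`, as a homomorphism of monoids of endomorphisms. In `End X` the
product `f * g` is the composite `f ∘ g`. -/
def whiskerEnd (M X : C) : End X →* End (M ⊗ X) where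
  toFun f := M ◁ f
  map_one' := by simp [End.one_def]
  map_mul' f g := by simp [End.mul_def]

/-- Left whiskering from endomorphisms of the `n`-th to endomorphisms of the `n + 1`-st tensor
power. -/
def whiskerPow (M : C) (n : ℕ) : End (tensorPow M n) →* End (tensorPow M (n + 1)) :=
  whiskerEnd M (tensorPow M n)

variable [SymmetricCategory C]

/-- The symmetry of `M ⊗ M` acting on the first two factors of `M ⊗ (M ⊗ X)`. -/
def swapHead (M X : C) : End (M ⊗ (M ⊗ X)) :=
  (α_ M M X).inv ≫ (β_ M M).hom ▷ X ≫ (α_ M M X).hom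

/-- The symmetry of `M ⊗ M` acting on the first two factors of a tensor power. -/
def swapPow (M : C) (n : ℕ) : End (tensorPow M (n + 2)) := swapHead M (tensorPow M n)

/-- The symmetry of `M ⊗ M` acting on the factors number `i` and `i + 1` of the `n`-th tensor
power of `M`; factors are numbered from `0`, and the value is the identity if `n ≤ i + 1`. -/
def adjSwap (M : C) : (n i : ℕ) → End (tensorPow M n)
  | 0, _ => 1
  | 1, _ => 1
  | n + 2, 0 => swapPow M n
  | n + 2, i + 1 => whiskerPow M (n + 1) (adjSwap M (n + 1) i)

/-- Auxiliary: the endomorphism of a tensor power which moves the factor number `0` to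
position `p`. -/
def moveHead (M : C) : (n p : ℕ) → End (tensorPow M n)
  | 0, _ => 1
  | 1, _ => 1
  | _ + 2, 0 => 1
  | n + 2, p + 1 => whiskerPow M (n + 1) (moveHead M (n + 1) p) * swapPow M n

lemma swapHead_mul_self (M X : C) : swapHead M X * swapHead M X = 1 := by
  simp [swapHead, End.mul_def, End.one_def, ← comp_whiskerRight_assoc]

lemma whiskerEnd_comm_swapHead (M X : C) (f : End X) :
    whiskerEnd M _ (whiskerEnd M _ f) * swapHead M X
      = swapHead M X * whiskerEnd M _ (whiskerEnd M _ f) := by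
  change swapHead M X ≫ M ◁ M ◁ f = M ◁ M ◁ f ≫ swapHead M X
  simp only [swapHead, Category.assoc]
  rw [← associator_naturality_right, associator_inv_naturality_right_assoc,
    whisker_exchange_assoc]

lemma swapHead_braid (M X : C) :
    swapHead M (M ⊗ X) * whiskerEnd M _ (swapHead M X) * swapHead M (M ⊗ X)
      = whiskerEnd M _ (swapHead M X) * swapHead M (M ⊗ X) * whiskerEnd M _ (swapHead M X) := by
  change swapHead M (M ⊗ X) ≫ M ◁ swapHead M X ≫ swapHead M (M ⊗ X)
    = M ◁ swapHead M X ≫ swapHead M (M ⊗ X) ≫ M ◁ swapHead M X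
  have h : swapHead M (M ⊗ X) ≫ M ◁ swapHead M X ≫ swapHead M (M ⊗ X)
      = 𝟙 _ ⊗≫ ((β_ M M).hom ▷ M ⊗≫ M ◁ (β_ M M).hom ⊗≫ (β_ M M).hom ▷ M) ▷ X ⊗≫ 𝟙 _ := by
    simp only [swapHead]; monoidal
  rw [h, BraidedCategory.yang_baxter']
  simp only [swapHead]; monoidal

lemma whiskerPow_comm_swapPow (M : C) (n : ℕ) (f : End (tensorPow M n)) :
    whiskerPow M (n + 1) (whiskerPow M n f) * swapPow M n
      = swapPow M n * whiskerPow M (n + 1) (whiskerPow M n f) :=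
  whiskerEnd_comm_swapHead M _ f

lemma swapPow_braid (M : C) (n : ℕ) :
    swapPow M (n + 1) * whiskerPow M (n + 2) (swapPow M n) * swapPow M (n + 1)
      = whiskerPow M (n + 2) (swapPow M n) * swapPow M (n + 1)
        * whiskerPow M (n + 2) (swapPow M n) :=
  swapHead_braid M _

lemma adjSwap_zero (M : C) (n : ℕ) : adjSwap M (n + 2) 0 = swapPow M n := rfl

lemma adjSwap_succ (M : C) (n i : ℕ) :
    adjSwap M (n + 1) (i + 1) = whiskerPow M n (adjSwap M n i) := by
  cases n with
  | zero => exact (map_one (whiskerPow M 0)).symm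
  | succ n => rfl

lemma moveHead_zero (M : C) (n : ℕ) : moveHead M n 0 = 1 := by
  match n with
  | 0 => rfl
  | 1 => rfl
  | n + 2 => rfl

lemma moveHead_succ (M : C) (n p : ℕ) : moveHead M (n + 2) (p + 1)
    = whiskerPow M (n + 1) (moveHead M (n + 1) p) * swapPow M n := rfl

lemma adjSwap_mul_self (M : C) (n i : ℕ) : adjSwap M n i * adjSwap M n i = 1 := by
  induction n generalizing i with
  | zero => exact one_mul _
  | succ n ih =>
    cases i with
    | zero =>
      cases n with
      | zero => exact one_mul _
      | succ n => exact swapHead_mul_self M _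
    | succ i => rw [adjSwap_succ, ← map_mul, ih, map_one]

lemma adjSwap_mul_moveHead_self (M : C) (n i : ℕ) (h : i + 1 < n) :
    adjSwap M n i * moveHead M n i = moveHead M n (i + 1) := by
  induction i generalizing n with
  | zero =>
    obtain ⟨n, rfl⟩ : ∃ k, n = k + 2 := ⟨n - 2, by omega⟩
    rw [moveHead_zero, moveHead_succ, moveHead_zero, map_one, mul_one, one_mul, adjSwap_zero]
  | succ i ih =>
    obtain ⟨n, rfl⟩ : ∃ k, n = k + 2 := ⟨n - 2, by omega⟩
    rw [moveHead_succ, moveHead_succ, adjSwap_succ, ← mul_assoc, ← map_mul, ih _ (by omega)]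

lemma adjSwap_mul_moveHead_gt (M : C) (n i p : ℕ) (h : p ≤ i) :
    adjSwap M n (i + 1) * moveHead M n p = moveHead M n p * adjSwap M n (i + 1) := by
  induction p generalizing n i with
  | zero => rw [moveHead_zero, one_mul, mul_one]
  | succ p ih =>
    obtain ⟨i, rfl⟩ : ∃ k, i = k + 1 := ⟨i - 1, by omega⟩
    match n with
    | 0 => rfl
    | 1 => exact (mul_one _).trans (one_mul _).symm
    | n + 2 =>
      rw [moveHead_succ, adjSwap_succ, ← mul_assoc, ← map_mul, ih _ i (by omega), map_mul,
        mul_assoc, mul_assoc, adjSwap_succ, whiskerPow_comm_swapPow]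

lemma adjSwap_mul_moveHead_lt (M : C) (n i p : ℕ) (h : i + 2 ≤ p) (hp : p < n) :
    adjSwap M n i * moveHead M n p = moveHead M n p * adjSwap M n (i + 1) := by
  induction i generalizing n p with
  | zero =>
    obtain ⟨p, rfl⟩ : ∃ k, p = k + 2 := ⟨p - 2, by omega⟩
    obtain ⟨n, rfl⟩ : ∃ k, n = k + 3 := ⟨n - 3, by omega⟩
    have h1 := whiskerPow_comm_swapPow M _ (moveHead M (n + 1) p)
    have h2 := swapPow_braid M n
    rw [moveHead_succ, moveHead_succ, adjSwap_zero, adjSwap_succ, adjSwap_zero, map_mul,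
      mul_assoc, ← mul_assoc, ← mul_assoc, ← h1, mul_assoc, mul_assoc, mul_assoc,
      ← mul_assoc (swapPow M (n + 1)), h2]
  | succ i ih =>
    obtain ⟨p, rfl⟩ : ∃ k, p = k + 1 := ⟨p - 1, by omega⟩
    obtain ⟨n, rfl⟩ : ∃ k, n = k + 3 := ⟨n - 3, by omega⟩
    rw [moveHead_succ, adjSwap_succ, ← mul_assoc, ← map_mul, ih _ p (by omega) (by omega),
      map_mul, mul_assoc, adjSwap_succ M (n + 2) (i + 1), adjSwap_succ M (n + 1) i,
      whiskerPow_comm_swapPow, mul_assoc]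

/-- Auxiliary: a permutation of `Fin (n + 1)` is determined by the image of `0` and a permutation
of `Fin n`. -/
lemma exists_tail (n : ℕ) (σ : Equiv.Perm (Fin (n + 1))) :
    ∃ e : Equiv.Perm (Fin n), ∀ j, σ j.succ = (σ 0).succAbove (e j) := by
  obtain ⟨⟨p, e⟩, h⟩ := Equiv.Perm.decomposeFin.symm.surjective ((σ 0).cycleRange * σ)
  have hp : p = 0 := by
    have := congrArg (fun τ => τ 0) h
    simpa using this
  subst hp
  refine ⟨e, fun j => ?_⟩
  have := congrArg (fun τ => τ j.succ) h
  simp only [Equiv.Perm.decomposeFin_symm_apply_succ, Equiv.swap_self, Equiv.refl_apply,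
    Equiv.Perm.mul_apply] at this
  rw [← Fin.cycleRange_symm_succ, this, Equiv.symm_apply_apply]

lemma swap_val {n : ℕ} (a b x : Fin n) : (Equiv.swap a b x).1
    = if x.1 = a.1 then b.1 else if x.1 = b.1 then a.1 else x.1 := by
  rw [Equiv.swap_apply_def]
  simp only [Fin.ext_iff]
  split_ifs <;> rfl

lemma succAbove_val {n : ℕ} (p : Fin (n + 1)) (x : Fin n) :
    (p.succAbove x).1 = if x.1 < p.1 then x.1 else x.1 + 1 := by
  simp only [Fin.succAbove, Fin.lt_def, Fin.val_castSucc]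
  split_ifs <;> rfl

/-- The symmetric group `S_n` acts on the `n`-th tensor power of `M`, the transposition of `i`
and `i + 1` acting through the symmetry of the factors number `i` and `i + 1`. -/
theorem exists_permAction (M : C) (n : ℕ) :
    ∃ ρ : Equiv.Perm (Fin n) →* End (tensorPow M n), ∀ (i : ℕ) (h : i + 1 < n),
      ρ (Equiv.swap ⟨i, Nat.lt_of_succ_lt h⟩ ⟨i + 1, h⟩) = adjSwap M n i := by
  induction n with
  | zero => exact ⟨1, fun i h => absurd h (Nat.not_lt_zero _)⟩
  | succ n ih =>
    obtain ⟨ρ, hρ⟩ := ih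
    choose tail htail using exists_tail n
    have tail_eq (σ : Equiv.Perm (Fin (n + 1))) (q : Fin (n + 1)) (e : Equiv.Perm (Fin n))
        (hq : σ 0 = q) (he : ∀ j, σ j.succ = q.succAbove (e j)) : tail σ = e := by
      subst hq
      ext1 j
      exact Fin.succAbove_right_injective ((htail σ j).symm.trans (he j))
    let F (σ : Equiv.Perm (Fin (n + 1))) : End (tensorPow M (n + 1)) :=
      moveHead M (n + 1) (σ 0).1 * whiskerPow M n (ρ (tail σ))
    have F_def (σ) (q : Fin (n + 1)) (e : Equiv.Perm (Fin n)) (hq : σ 0 = q)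
        (he : ∀ j, σ j.succ = q.succAbove (e j)) :
        F σ = moveHead M (n + 1) q.1 * whiskerPow M n (ρ e) := by
      simp only [F]
      rw [tail_eq σ q e hq he, hq]
    have F_one : F 1 = 1 := by
      rw [F_def 1 0 1 rfl (fun j => by simp)]
      simp only [Fin.val_zero, map_one, moveHead_zero, mul_one]
    have key (i : ℕ) (h : i + 1 < n + 1) (σ : Equiv.Perm (Fin (n + 1))) :
        F (Equiv.swap ⟨i, Nat.lt_of_succ_lt h⟩ ⟨i + 1, h⟩ * σ) = adjSwap M (n + 1) i * F σ := by
      obtain ⟨p, hp⟩ : ∃ p, σ 0 = p := ⟨_, rfl⟩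
      have hs (j) : σ j.succ = p.succAbove (tail σ j) := hp ▸ htail σ j
      have hF := F_def σ p (tail σ) hp hs
      rw [hF, ← mul_assoc]
      rcases lt_trichotomy p.1 i with hpi | hpi | hpi
      · obtain ⟨k, rfl⟩ : ∃ k, i = k + 1 := ⟨i - 1, by omega⟩
        rw [adjSwap_mul_moveHead_gt M _ _ _ (by omega), mul_assoc, adjSwap_succ, ← map_mul,
          ← hρ k (by omega), ← map_mul]
        refine F_def _ p _ ?_ fun j => ?_
        · rw [Equiv.Perm.mul_apply, hp, Equiv.swap_apply_of_ne_of_ne] <;>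
            simp only [ne_eq, Fin.ext_iff] <;> omega
        · rw [Equiv.Perm.mul_apply, Equiv.Perm.mul_apply, hs]
          apply Fin.ext
          simp only [swap_val, succAbove_val]
          split_ifs <;> omega
      · have hp' : p = ⟨i, Nat.lt_of_succ_lt h⟩ := Fin.ext hpi
        rw [hpi, adjSwap_mul_moveHead_self M _ _ h]
        refine F_def _ ⟨i + 1, h⟩ _ ?_ fun j => ?_
        · rw [Equiv.Perm.mul_apply, hp, hp', Equiv.swap_apply_left]
        · rw [Equiv.Perm.mul_apply, hs]
          apply Fin.ext
          simp only [swap_val, succAbove_val]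
          split_ifs <;> omega
      · rcases (show i + 1 ≤ p.1 from hpi).eq_or_lt with hpi' | hpi'
        · have hp' : p = ⟨i + 1, h⟩ := Fin.ext hpi'.symm
          rw [← hpi', ← adjSwap_mul_moveHead_self M _ _ h, ← mul_assoc, adjSwap_mul_self, one_mul]
          refine F_def _ ⟨i, Nat.lt_of_succ_lt h⟩ _ ?_ fun j => ?_
          · rw [Equiv.Perm.mul_apply, hp, hp', Equiv.swap_apply_right]
          · rw [Equiv.Perm.mul_apply, hs]
            apply Fin.ext
            simp only [swap_val, succAbove_val]
            split_ifs <;> omega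
        · have hpn := p.2
          rw [adjSwap_mul_moveHead_lt M _ _ _ hpi' p.2, mul_assoc, adjSwap_succ, ← map_mul,
            ← hρ i (by omega), ← map_mul]
          refine F_def _ p _ ?_ fun j => ?_
          · rw [Equiv.Perm.mul_apply, hp, Equiv.swap_apply_of_ne_of_ne] <;>
              simp only [ne_eq, Fin.ext_iff] <;> omega
          · rw [Equiv.Perm.mul_apply, Equiv.Perm.mul_apply, hs]
            apply Fin.ext
            simp only [swap_val, succAbove_val]
            split_ifs <;> omega
    have F_mul (g) : ∀ σ, F (g * σ) = F g * F σ := by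
      have hg : g ∈ Submonoid.closure
          (Set.range fun i : Fin n => Equiv.swap i.castSucc i.succ) := by
        rw [Equiv.Perm.mclosure_swap_castSucc_succ]; trivial
      induction hg using Submonoid.closure_induction with
      | mem x hx =>
        obtain ⟨i, rfl⟩ := hx
        intro σ
        have h1 := key i.1 (by omega) 1
        rw [F_one, mul_one, mul_one] at h1
        exact (key i.1 (by omega) σ).trans (congrArg (· * F σ) h1.symm)
      | one => intro σ; rw [F_one, one_mul, one_mul]
      | mul x y _ _ hx hy => intro σ; rw [mul_assoc, hx, hy, hx]; exact (mul_assoc _ _ _).symm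
    refine ⟨⟨⟨F, F_one⟩, fun g σ => F_mul g σ⟩, fun i h => ?_⟩
    have h1 := key i h 1
    rw [F_one, mul_one, mul_one] at h1
    exact h1

/-- The action of the symmetric group `S_n` on the `n`-th tensor power of `M` by permutation of
the factors. It is the only homomorphism for which adjacent transpositions act through the
symmetry of the category, because these transpositions generate `S_n`. -/
def permAction (M : C) (n : ℕ) : Equiv.Perm (Fin n) →* End (tensorPow M n) :=
  (exists_permAction M n).choose

lemma permAction_swap (M : C) (n i : ℕ) (h : i + 1 < n) :
    permAction M n (Equiv.swap ⟨i, Nat.lt_of_succ_lt h⟩ ⟨i + 1, h⟩) = adjSwap M n i :=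
  (exists_permAction M n).choose_spec i h

end TensorPowers

section Powers

variable (K : Type w) [Field K] {C : Type u} [Category.{v} C] [Preadditive C] [Linear K C]
  [MonoidalCategory C] [SymmetricCategory C]

/-- The endomorphism `(1 / n!) ∑ ε(σ) σ` of the `n`-th tensor power of `M`, for a character
`ε : S_n → {1, -1}`. -/
def permProj (M : C) (n : ℕ) (ε : Equiv.Perm (Fin n) →* ℤˣ) : End (tensorPow M n) :=
  (n.factorial : K)⁻¹ • ∑ σ : Equiv.Perm (Fin n), ((ε σ : ℤˣ) : ℤ) • permAction M n σ

lemma permProj_idem [CharZero K] (M : C) (n : ℕ) (ε : Equiv.Perm (Fin n) →* ℤˣ) :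
    permProj K M n ε ≫ permProj K M n ε = permProj K M n ε := by
  change permProj K M n ε * permProj K M n ε = permProj K M n ε
  let f : Equiv.Perm (Fin n) → End (tensorPow M n) := fun σ =>
    ((ε σ : ℤˣ) : ℤ) • permAction M n σ
  have hf (σ τ) : f σ * f τ = f (σ * τ) := by
    simp only [f, map_mul, Units.val_mul, smul_mul_smul_comm]
  have hs (σ) : f σ * ∑ τ, f τ = ∑ τ, f τ := by
    rw [Finset.mul_sum]
    simp only [hf]
    exact Equiv.sum_comp (Equiv.mulLeft σ) f
  have h : (∑ σ, f σ) * ∑ τ, f τ = (n.factorial : K) • ∑ τ, f τ := by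
    rw [Finset.sum_mul]
    simp only [hs]
    rw [Finset.sum_const, Finset.card_univ, Fintype.card_perm, Fintype.card_fin,
      Nat.cast_smul_eq_nsmul]
  have hn : (n.factorial : K) ≠ 0 := Nat.cast_ne_zero.2 n.factorial_ne_zero
  change ((n.factorial : K)⁻¹ • ∑ σ, f σ) * ((n.factorial : K)⁻¹ • ∑ σ, f σ)
    = (n.factorial : K)⁻¹ • ∑ σ, f σ
  rw [smul_mul_smul_comm, h, smul_smul, mul_assoc, inv_mul_cancel₀ hn, mul_one]

variable [CharZero K] [IsIdempotentComplete C]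

/-- The symmetric power `Sⁿ(M)`: the image of the projector `(1 / n!) ∑ σ` of the `n`-th tensor
power of `M`. It is determined up to isomorphism. -/
def symPow (n : ℕ) (M : C) : C :=
  (IsIdempotentComplete.idempotents_split _ _ (permProj_idem K M n 1)).choose

/-- The exterior power `Λⁿ(M)`: the image of the projector `(1 / n!) ∑ sgn(σ) σ` of the `n`-th
tensor power of `M`. It is determined up to isomorphism. -/
def extPow (n : ℕ) (M : C) : C :=
  (IsIdempotentComplete.idempotents_split _ _ (permProj_idem K M n Equiv.Perm.sign)).choose

/-- `M` is positive if some exterior power `Λᴺ(M)` with `N > 0` vanishes. -/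
def IsPositive (M : C) : Prop := ∃ N : ℕ, 0 < N ∧ IsZero (extPow K N M)

/-- `M` is negative if some symmetric power `Sᴺ(M)` with `N > 0` vanishes. -/
def IsNegative (M : C) : Prop := ∃ N : ℕ, 0 < N ∧ IsZero (symPow K N M)

end Powers

section Duality

variable {C : Type u} [Category.{v} C] [MonoidalCategory C]

/-- `L` is invertible if there is an object `T` with `L ⊗ T ≅ 𝟙`. -/
def IsInvertible (L : C) : Prop := ∃ T : C, Nonempty (L ⊗ T ≅ 𝟙_ C)

/-- The Euler characteristic `χ(M) = tr(1_M) ∈ End(𝟙)`, that is, the composite of the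
coevaluation `𝟙 ⟶ M ⊗ M*`, the symmetry `M ⊗ M* ⟶ M* ⊗ M` and the evaluation `M* ⊗ M ⟶ 𝟙`. -/
def eulerChar [SymmetricCategory C] (M : C) [HasRightDual M] : End (𝟙_ C) :=
  η_ M Mᘁ ≫ (β_ M Mᘁ).hom ≫ ε_ M Mᘁ

end Duality

section Determinant

variable (K : Type w) [Field K] [CharZero K] {C : Type u} [Category.{v} C] [Preadditive C]
  [Linear K C] [IsIdempotentComplete C] [MonoidalCategory C] [SymmetricCategory C]
  [RigidCategory C]

/-- The object `Λᵖ(A) ⊗ Sᵐ(B)⁻¹`, where the inverse of the (invertible) object `Sᵐ(B)` is its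
dual. It is the determinant of `M ≅ A ⊕ B` if `A` is positive with `χ(A) = p` and `B` is negative
with `χ(B) = -m`. -/
def detObj (A B : C) (p m : ℕ) : C := extPow K p A ⊗ (symPow K m B)ᘁ

end Determinant

section GrothendieckRing

variable (C : Type u) [Category.{v} C] [Preadditive C] [HasBinaryBiproducts C]
  [MonoidalCategory C] [SymmetricCategory C]

/-- The Grothendieck ring `K₀(C)` of an additive symmetric monoidal category: generated by the
isomorphism classes `[A]` of objects, with product `[A] [B] = [A ⊗ B]` and unit `[𝟙]`, subject to
the relations `[A ⊕ B] = [A] + [B]`. (`Skeleton C` is the commutative monoid of isomorphism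
classes. When `⊗` is biadditive, the additive subgroup spanned by these relations is already an
ideal of the monoid ring.) -/
def K0 : Type u :=
  MonoidAlgebra ℤ (Skeleton C) ⧸ (Ideal.span {x | ∃ A B : C,
    x = MonoidAlgebra.of ℤ (Skeleton C) (toSkeleton (A ⊞ B))
      - (MonoidAlgebra.of ℤ (Skeleton C) (toSkeleton A)
        + MonoidAlgebra.of ℤ (Skeleton C) (toSkeleton B))} :
    Ideal (MonoidAlgebra ℤ (Skeleton C)))

instance : CommRing (K0 C) := inferInstanceAs (CommRing (_ ⧸ _))

variable {C}

/-- The class `[A]` of an object in the Grothendieck ring. -/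
def K0.cls (A : C) : K0 C :=
  Ideal.Quotient.mk _ (MonoidAlgebra.of ℤ (Skeleton C) (toSkeleton A))

/-- The zeta function `Z(M, T) = ∑ [Sⁿ(M)] Tⁿ`, a power series with coefficients in `K₀(C)`. -/
def zeta (K : Type w) [Field K] [CharZero K] [Linear K C] [IsIdempotentComplete C] (M : C) :
    PowerSeries (K0 C) :=
  PowerSeries.mk fun n => K0.cls (symPow K n M)

end GrothendieckRing

section RationalFunctions

variable (R : Type u) [CommRing R]

/-- The expansion in `T` of Laurent polynomials, as a homomorphism to Laurent series. -/
def toLaurentSeries : R[T;T⁻¹] →+* LaurentSeries R :=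
  LaurentPolynomial.eval₂ HahnSeries.C
    ⟨HahnSeries.single 1 1, HahnSeries.single (-1) 1, by simp, by simp⟩

/-- The Laurent polynomials `Q` which may serve as denominators: `Q(T)` and `Q(T⁻¹)` are both
invertible as Laurent series in `T`. For instance, the highest and the lowest coefficient of `Q`
may be units of `R`. -/
def denominators : Submonoid R[T;T⁻¹] :=
  (IsUnit.submonoid (LaurentSeries R)).comap (toLaurentSeries R) ⊓
    (IsUnit.submonoid (LaurentSeries R)).comap
      ((toLaurentSeries R).comp (LaurentPolynomial.invert (R := R)).toRingHom)

/-- Rational functions in `T` over `R`: fractions `P / Q` of Laurent polynomials such that `Q`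
is invertible as a Laurent series both in `T` and in `T⁻¹`. -/
abbrev RationalFunction : Type u := Localization (denominators R)

namespace RationalFunction

lemma denominators_le_comap_invert : denominators R ≤
    (denominators R).comap (LaurentPolynomial.invert (R := R)).toRingHom := by
  rintro Q ⟨h1, h2⟩
  refine ⟨h2, ?_⟩
  have h : (LaurentPolynomial.invert (R := R)) (LaurentPolynomial.invert Q) = Q :=
    LaurentPolynomial.involutive_invert Q
  simpa [h] using h1

variable {R}

/-- The expansion of a rational function as a Laurent series in `T`. -/
def expand : RationalFunction R →+* LaurentSeries R :=
  IsLocalization.lift (M := denominators R) (g := toLaurentSeries R) fun Q => Q.2.1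

/-- The substitution of `T⁻¹` for `T` in rational functions. -/
def invert : RationalFunction R →+* RationalFunction R :=
  IsLocalization.map (M := denominators R) (T := denominators R) _
    (LaurentPolynomial.invert (R := R)).toRingHom (denominators_le_comap_invert R)

/-- The monomial `r Tⁿ`, where `n` is an integer, as a rational function. -/
def monomial (r : R) (n : ℤ) : RationalFunction R :=
  algebraMap R[T;T⁻¹] (RationalFunction R) (LaurentPolynomial.C r * LaurentPolynomial.T n)

end RationalFunction

lemma toLaurentSeries_C_mul_T (r : R) (m : ℤ) :
    toLaurentSeries R (LaurentPolynomial.C r * LaurentPolynomial.T m) = HahnSeries.single m r := by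
  have h (k : ℕ) (a : ℤ) : (HahnSeries.single a (1 : R)) ^ k = HahnSeries.single (k * a) 1 := by
    rw [HahnSeries.single_pow, one_pow, nsmul_eq_mul]
  rw [toLaurentSeries, LaurentPolynomial.eval₂_C_mul_T]
  obtain ⟨k, rfl | rfl⟩ := m.eq_nat_or_neg
  · rw [zpow_natCast, Units.val_pow_eq_pow_val]
    simp [h, HahnSeries.C_apply]
  · rw [zpow_neg, zpow_natCast, ← inv_pow, Units.val_pow_eq_pow_val]
    simp [h, HahnSeries.C_apply]

lemma coeff_toLaurentSeries (f : R[T;T⁻¹]) (n : ℤ) :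
    (toLaurentSeries R f).coeff n = f.coeff n := by
  induction f using LaurentPolynomial.induction_on' with
  | add p q hp hq => rw [map_add, HahnSeries.coeff_add, hp, hq]; simp
  | C_mul_T m r =>
    rw [toLaurentSeries_C_mul_T, HahnSeries.coeff_single,
      ← LaurentPolynomial.single_eq_C_mul_T, AddMonoidAlgebra.coeff_single, Finsupp.single_apply]
    rcases eq_or_ne n m with rfl | h
    · simp
    · rw [if_neg h, if_neg h.symm]

lemma toLaurentSeries_injective : Function.Injective (toLaurentSeries R) := by
  intro f g h
  ext n
  rw [← coeff_toLaurentSeries, h, coeff_toLaurentSeries]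

/-- A rational function is determined by its expansion. -/
theorem RationalFunction.expand_injective :
    Function.Injective (RationalFunction.expand (R := R)) := by
  refine (IsLocalization.lift_injective_iff (M := denominators R)
    (S := RationalFunction R) _).2 fun x y => ⟨fun h => ?_, fun h => ?_⟩
  · exact (IsLocalization.lift_eq _ x).symm.trans
      ((congrArg expand h).trans (IsLocalization.lift_eq _ y))
  · rw [toLaurentSeries_injective R h]

end RationalFunctions

end KimuraZeta

end

open KimuraZeta

/-! Write P_n for Λⁿ or Sⁿ, with sign s = -1 or s = 1, and let D be the dual of A. All powers are
handled as idempotents of tensor powers; equivalent idempotents have the same class in K₀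
(`idemCls_congr`).

Duality. Inserting the coevaluation and contracting give maps `raise` and `lower` between P_i(D) ⊗
P_k(A) and P_{i+1}(D) ⊗ P_{k+1}(A). They satisfy a relation of sl₂ type: going up and down minus
going down and up is the scalar χ(A) + s(i + k) (`raise_lower_succ_succ`). If p + 1 is the first
degree in which P_n(A) vanishes, then nothing can be raised from bidegree (0, p), and the relation
forces χ(A) = -s p (`exists_dimension`). All scalars along a string of bidegrees (i + t, k + t) are
now known, and in characteristic 0 the relevant ones do not vanish. Hence P_{p-i}(A) ≅ P_i(D) ⊗
P_p(A) for i ≤ p (`exists_equiv_proj₂`), and P_i(D) ⊗ P_p(A) = 0 for i > p (`proj₂_eq_zero`). The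
case i = p shows that P_p(A) is invertible. In K₀, the polynomial of the classes of the P_i(D) is
therefore that of A read backwards, up to the unit [P_p(A)].

Rationality. The Koszul complex splits, so the series of (-1)ⁱ[Λⁱ(A)] is inverse to the zeta
function of A (`zeta_mul_altExt`); symmetric powers of a sum decompose as usual
(`cls_symPow_of_bicone`). So Z(M) is the polynomial of the [Sʲ(M⁻)] divided by that of the
(-1)ⁱ[Λⁱ(M⁺)], and likewise for the duals. Reversing numerator and denominator gives the functional
equation (`exists_functional_equation`). -/

noncomputable section

set_option linter.unusedSectionVars false

namespace KimuraZeta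

/-! ### Calculus of crossings. -/

section Pass

variable {C : Type u} [Category.{v} C] [MonoidalCategory C] [SymmetricCategory C]

/-- The symmetry of `U` and `V`, tensored with `Z`. -/
def pass (U V Z : C) : U ⊗ (V ⊗ Z) ⟶ V ⊗ (U ⊗ Z) :=
  (α_ U V Z).inv ≫ (β_ U V).hom ▷ Z ≫ (α_ V U Z).hom

@[simp]
lemma pass_pass (U V Z : C) : pass U V Z ≫ pass V U Z = 𝟙 _ := by
  simp [pass, ← comp_whiskerRight_assoc]

instance (U V Z : C) : IsIso (pass U V Z) := ⟨pass V U Z, by simp, by simp⟩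

lemma pass_naturality_right (U V : C) {Z Z' : C} (f : Z ⟶ Z') :
    pass U V Z ≫ V ◁ U ◁ f = U ◁ V ◁ f ≫ pass U V Z' := by
  simp only [pass, Category.assoc]
  rw [← associator_naturality_right, associator_inv_naturality_right_assoc,
    whisker_exchange_assoc]

lemma pass_naturality_left {U U' : C} (f : U ⟶ U') (V Z : C) :
    pass U V Z ≫ V ◁ f ▷ Z = f ▷ (V ⊗ Z) ≫ pass U' V Z := by
  simp only [pass, Category.assoc]
  rw [← associator_naturality_middle, associator_inv_naturality_left_assoc,
    ← comp_whiskerRight_assoc, ← comp_whiskerRight_assoc, BraidedCategory.braiding_naturality_left]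

lemma pass_naturality_tensorHom {U U' Z Z' : C} (f : U ⟶ U') (V : C) (g : Z ⟶ Z') :
    pass U V Z ≫ V ◁ (f ⊗ₘ g) = (f ⊗ₘ V ◁ g) ≫ pass U' V Z' := by
  rw [MonoidalCategory.tensorHom_def, MonoidalCategory.tensorHom_def, Category.assoc,
    MonoidalCategory.whiskerLeft_comp, reassoc_of% pass_naturality_left,
    pass_naturality_right]

lemma pass_naturality_tensorHom' {U U' Z Z' : C} (f : U ⟶ U') (V : C) (g : Z ⟶ Z') :
    pass V U Z ≫ (f ⊗ₘ V ◁ g) = V ◁ (f ⊗ₘ g) ≫ pass V U' Z' := by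
  rw [← cancel_mono (pass U' V Z'), Category.assoc, ← pass_naturality_tensorHom, Category.assoc,
    pass_pass, reassoc_of% pass_pass, Category.comp_id]

lemma pass_yang_baxter (U V W Z : C) :
    U ◁ pass V W Z ≫ pass U W (V ⊗ Z) ≫ W ◁ pass U V Z
      = pass U V (W ⊗ Z) ≫ V ◁ pass U W Z ≫ pass V W (U ⊗ Z) := by
  have h : pass U V (W ⊗ Z) ≫ V ◁ pass U W Z ≫ pass V W (U ⊗ Z)
      = 𝟙 _ ⊗≫ ((β_ U V).hom ▷ W ⊗≫ V ◁ (β_ U W).hom ⊗≫ (β_ V W).hom ▷ U) ▷ Z ⊗≫ 𝟙 _ := by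
    simp only [pass]; monoidal
  rw [h, BraidedCategory.yang_baxter']
  simp only [pass]; monoidal

lemma pass_tensor (U U' V Z : C) :
    pass (U ⊗ U') V Z = (α_ U U' (V ⊗ Z)).hom ≫ U ◁ pass U' V Z ≫ pass U V (U' ⊗ Z) ≫
      V ◁ (α_ U U' Z).inv := by
  simp only [pass, BraidedCategory.braiding_tensor_left_hom]
  monoidal

lemma pass_tensor' (U U' V Z : C) :
    pass V (U ⊗ U') Z = V ◁ (α_ U U' Z).hom ≫ pass V U (U' ⊗ Z) ≫ U ◁ pass V U' Z ≫
      (α_ U U' (V ⊗ Z)).inv := by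
  simp only [pass, BraidedCategory.braiding_tensor_right_hom]
  monoidal

lemma pass_whiskerRight (M X W : C) :
    pass M M X ▷ W = (α_ M (M ⊗ X) W).hom ≫ M ◁ (α_ M X W).hom ≫ pass M M (X ⊗ W) ≫
      M ◁ (α_ M X W).inv ≫ (α_ M (M ⊗ X) W).inv := by
  simp only [pass]
  monoidal

end Pass

/-! ### Coevaluation, contraction and crossings. -/

section Contraction

variable {C : Type u} [Category.{v} C] [MonoidalCategory C]
variable (A D : C) [ExactPairing A D]

/-- Contraction of the first two factors. -/
def contr (Z : C) : D ⊗ (A ⊗ Z) ⟶ Z := (α_ D A Z).inv ≫ ε_ A D ▷ Z ≫ (λ_ Z).hom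

/-- Insertion of the coevaluation as the first two factors. -/
def coev (Z : C) : Z ⟶ A ⊗ (D ⊗ Z) := (λ_ Z).inv ≫ η_ A D ▷ Z ≫ (α_ A D Z).hom

variable {A D}

lemma contr_naturality {Z Z' : C} (f : Z ⟶ Z') :
    contr A D Z ≫ f = D ◁ A ◁ f ≫ contr A D Z' := by
  simp only [contr, Category.assoc]
  rw [← leftUnitor_naturality, associator_inv_naturality_right_assoc, whisker_exchange_assoc]

lemma coev_naturality {Z Z' : C} (f : Z ⟶ Z') :
    f ≫ coev A D Z' = coev A D Z ≫ A ◁ D ◁ f := by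
  simp only [coev, Category.assoc]
  rw [← associator_naturality_right, leftUnitor_inv_naturality_assoc, whisker_exchange_assoc]

lemma coev_contr (Z : C) : coev A D (A ⊗ Z) ≫ A ◁ contr A D Z = 𝟙 _ := by
  have h : coev A D (A ⊗ Z) ≫ A ◁ contr A D Z
      = 𝟙 _ ⊗≫ (η_ A D ▷ A ⊗≫ A ◁ ε_ A D) ▷ Z ⊗≫ 𝟙 _ := by
    simp only [coev, contr]; monoidal
  rw [h, ExactPairing.evaluation_coevaluation'']
  monoidal

lemma whiskerLeft_coev_contr (Z : C) : D ◁ coev A D Z ≫ contr A D (D ⊗ Z) = 𝟙 _ := by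
  have h : D ◁ coev A D Z ≫ contr A D (D ⊗ Z)
      = 𝟙 _ ⊗≫ (D ◁ η_ A D ⊗≫ ε_ A D ▷ D) ▷ Z ⊗≫ 𝟙 _ := by
    simp only [coev, contr]; monoidal
  rw [h, ExactPairing.coevaluation_evaluation'']
  monoidal

variable [SymmetricCategory C]

variable (A D) in
/-- Insertion of the coevaluation, with the factors exchanged. -/
def coevSwap (Z : C) : Z ⟶ D ⊗ (A ⊗ Z) := coev A D Z ≫ pass A D Z

lemma coevSwap_naturality {Z Z' : C} (f : Z ⟶ Z') :
    f ≫ coevSwap A D Z' = coevSwap A D Z ≫ D ◁ A ◁ f := by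
  simp only [coevSwap, Category.assoc, pass_naturality_right, reassoc_of% coev_naturality]

/-- An object can be moved past a contraction. -/
lemma pass_pass_contr (U Z : C) :
    pass U D (A ⊗ Z) ≫ D ◁ pass U A Z ≫ contr A D (U ⊗ Z) = U ◁ contr A D Z := by
  have h : pass U D (A ⊗ Z) ≫ D ◁ pass U A Z ≫ contr A D (U ⊗ Z)
      = 𝟙 _ ⊗≫ ((β_ U (D ⊗ A)).hom ≫ ε_ A D ▷ U) ▷ Z ⊗≫ 𝟙 _ := by
    simp only [pass, contr, BraidedCategory.braiding_tensor_right_hom]; monoidal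
  rw [h, ← BraidedCategory.braiding_naturality_right, braiding_tensorUnit_right]
  simp only [contr]
  monoidal

lemma coev_pass_pass (U Z : C) :
    coev A D (U ⊗ Z) ≫ A ◁ pass D U Z ≫ pass A U (D ⊗ Z) = U ◁ coev A D Z := by
  have h : coev A D (U ⊗ Z) ≫ A ◁ pass D U Z ≫ pass A U (D ⊗ Z)
      = 𝟙 _ ⊗≫ (η_ A D ▷ U ≫ (β_ (A ⊗ D) U).hom) ▷ Z ⊗≫ 𝟙 _ := by
    simp only [pass, coev, BraidedCategory.braiding_tensor_left_hom]; monoidal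
  rw [h, BraidedCategory.braiding_naturality_left, braiding_tensorUnit_left]
  simp only [coev]
  monoidal

/-- A curl on the strand `A`: moving the strand past the contraction turns the curl into a zigzag,
which straightens. -/
lemma coevSwap_pass_contr (Z : C) :
    coevSwap A D (A ⊗ Z) ≫ D ◁ pass A A Z ≫ contr A D (A ⊗ Z) = 𝟙 _ := by
  rw [coevSwap, Category.assoc, pass_pass_contr, coev_contr]

/-- The curl on the strand `D`. The Yang–Baxter equation moves the crossing of the two copies of `D`
next to the coevaluation, after which the other zigzag identity applies. -/
lemma coevSwap_swap_contr (Z : C) :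
    coevSwap A D (D ⊗ Z) ≫ D ◁ pass A D Z ≫ pass D D (A ⊗ Z) ≫ D ◁ pass D A Z ≫
      contr A D (D ⊗ Z) = 𝟙 _ := by
  rw [coevSwap, Category.assoc, ← reassoc_of% (pass_yang_baxter A D D Z), ← MonoidalCategory.whiskerLeft_comp_assoc,
    pass_pass, whiskerLeft_id, Category.id_comp, reassoc_of% (coev_pass_pass (A := A) (D := D)),
    whiskerLeft_coev_contr]

/-- Contraction of the first factors of `D ⊗ X` and `A ⊗ Y`. -/
def contrPair (A D : C) [ExactPairing A D] (X Y : C) : (D ⊗ X) ⊗ (A ⊗ Y) ⟶ X ⊗ Y :=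
  (α_ D X (A ⊗ Y)).hom ≫ D ◁ pass X A Y ≫ contr A D (X ⊗ Y)

/-- Insertion of the coevaluation in front of `X` and `Y`. -/
def coevPair (A D : C) [ExactPairing A D] (X Y : C) : X ⊗ Y ⟶ (D ⊗ X) ⊗ (A ⊗ Y) :=
  coevSwap A D (X ⊗ Y) ≫ D ◁ pass A X Y ≫ (α_ D X (A ⊗ Y)).inv

lemma contrPair_naturality {X X' Y Y' : C} (f : X ⟶ X') (g : Y ⟶ Y') :
    contrPair A D X Y ≫ (f ⊗ₘ g) = (D ◁ f ⊗ₘ A ◁ g) ≫ contrPair A D X' Y' := by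
  simp only [contrPair, Category.assoc, contr_naturality]
  rw [← MonoidalCategory.whiskerLeft_comp_assoc, pass_naturality_tensorHom,
    MonoidalCategory.whiskerLeft_comp_assoc, ← id_tensorHom D f, ← id_tensorHom D (f ⊗ₘ A ◁ g),
    associator_naturality_assoc]

lemma coevPair_naturality {X X' Y Y' : C} (f : X ⟶ X') (g : Y ⟶ Y') :
    (f ⊗ₘ g) ≫ coevPair A D X' Y' = coevPair A D X Y ≫ (D ◁ f ⊗ₘ A ◁ g) := by
  simp only [coevPair, Category.assoc, reassoc_of% (coevSwap_naturality (A := A) (D := D))]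
  rw [← MonoidalCategory.whiskerLeft_comp_assoc, ← pass_naturality_tensorHom',
    MonoidalCategory.whiskerLeft_comp_assoc, ← id_tensorHom D f, ← id_tensorHom D (f ⊗ₘ A ◁ g),
    associator_inv_naturality]

lemma coevPair_contrPair (X Y : C) : coevPair A D X Y ≫ contrPair A D X Y =
    coevSwap A D (X ⊗ Y) ≫ contr A D (X ⊗ Y) := by
  simp only [contrPair, coevPair, Category.assoc, Iso.inv_hom_id_assoc,
    ← MonoidalCategory.whiskerLeft_comp_assoc, pass_pass, whiskerLeft_id, Category.id_comp]

/-- Crossing the two copies of `D` makes the contraction use the inner one; the outer copy becomes a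
spectator. -/
lemma swap_contrPair_left (X Y : C) :
    pass D D X ▷ (A ⊗ Y) ≫ contrPair A D (D ⊗ X) Y
      = (α_ D (D ⊗ X) (A ⊗ Y)).hom ≫ D ◁ contrPair A D X Y ≫ (α_ D X Y).inv := by
  simp only [contrPair, pass_whiskerRight, pass_tensor, Category.assoc,
    MonoidalCategory.whiskerLeft_comp, Iso.inv_hom_id_assoc]
  rw [← contr_naturality, ← MonoidalCategory.whiskerLeft_comp_assoc D (α_ D X _).inv,
    Iso.inv_hom_id, whiskerLeft_id, Category.id_comp, ← pass_pass_contr, Category.assoc,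
    Category.assoc, ← reassoc_of% pass_naturality_right]

lemma pass_swap_pass (U X Y : C) :
    pass U X (U ⊗ Y) ≫ X ◁ pass U U Y ≫ pass X U (U ⊗ Y)
      = U ◁ pass X U Y ≫ pass U U (X ⊗ Y) ≫ U ◁ pass U X Y :=
  (pass_yang_baxter U X U Y).symm

lemma coevPair_swap_contrPair_right (X Y : C) :
    coevPair A D X (A ⊗ Y) ≫ (D ⊗ X) ◁ pass A A Y ≫ contrPair A D X (A ⊗ Y) = 𝟙 _ := by
  simp only [coevPair, contrPair, Category.assoc]
  rw [associator_naturality_right_assoc, Iso.inv_hom_id_assoc]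
  simp only [← MonoidalCategory.whiskerLeft_comp_assoc, pass_swap_pass]
  simp only [MonoidalCategory.whiskerLeft_comp, Category.assoc, ← contr_naturality]
  rw [← reassoc_of% (coevSwap_naturality (A := A) (D := D)),
    reassoc_of% (coevSwap_pass_contr (A := A) (D := D)), pass_pass]

lemma coevPair_associator (X Y : C) :
    coevPair A D (D ⊗ X) Y ≫ (α_ D (D ⊗ X) (A ⊗ Y)).hom
      = (α_ D X Y).hom ≫ coevSwap A D (D ⊗ (X ⊗ Y)) ≫ D ◁ pass A D (X ⊗ Y) ≫
        D ◁ D ◁ pass A X Y ≫ D ◁ (α_ D X (A ⊗ Y)).inv := by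
  simp only [coevPair, Category.assoc, Iso.inv_hom_id, Category.comp_id, pass_tensor',
    MonoidalCategory.whiskerLeft_comp]
  rw [reassoc_of% (coevSwap_naturality (A := A) (D := D))]

lemma coevPair_swap_contrPair_left (X Y : C) :
    coevPair A D (D ⊗ X) Y ≫ pass D D X ▷ (A ⊗ Y) ≫ contrPair A D (D ⊗ X) Y = 𝟙 _ := by
  rw [swap_contrPair_left, reassoc_of% (coevPair_associator (A := A) (D := D))]
  simp only [contrPair, MonoidalCategory.whiskerLeft_comp, Category.assoc,
    ← MonoidalCategory.whiskerLeft_comp_assoc D (α_ D X _).inv, Iso.inv_hom_id, whiskerLeft_id,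
    Category.id_comp]
  rw [← MonoidalCategory.whiskerLeft_comp_assoc D (D ◁ _), ← MonoidalCategory.whiskerLeft_comp,
    pass_pass, whiskerLeft_id, whiskerLeft_id, Category.id_comp, ← pass_pass_contr,
    Category.assoc, Category.assoc, reassoc_of% (coevSwap_swap_contr (A := A) (D := D)),
    Iso.hom_inv_id]

/-- With a crossing on both sides the contraction meets the old factors `D` and `A`, and the
inserted pair survives. This is the term that produces the commutation relation. -/
lemma coevPair_swap_swap_contrPair (X Y : C) :
    coevPair A D (D ⊗ X) (A ⊗ Y) ≫ (pass D D X ⊗ₘ pass A A Y) ≫ contrPair A D (D ⊗ X) (A ⊗ Y)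
      = contrPair A D X Y ≫ coevPair A D X Y := by
  rw [MonoidalCategory.tensorHom_def', Category.assoc, swap_contrPair_left,
    associator_naturality_right_assoc, reassoc_of% (coevPair_associator (A := A) (D := D))]
  have h : pass A D (X ⊗ (A ⊗ Y)) ≫ D ◁ pass A X (A ⊗ Y) ≫ (α_ D X (A ⊗ A ⊗ Y)).inv ≫
      (D ⊗ X) ◁ pass A A Y ≫ contrPair A D X (A ⊗ Y)
      = A ◁ (D ◁ pass X A Y ≫ contr A D (X ⊗ Y)) ≫ pass A X Y := by
    simp only [contrPair]
    rw [associator_naturality_right_assoc, Iso.inv_hom_id_assoc]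
    simp only [← MonoidalCategory.whiskerLeft_comp_assoc, pass_swap_pass]
    simp only [MonoidalCategory.whiskerLeft_comp, Category.assoc, ← contr_naturality]
    rw [reassoc_of% pass_naturality_right, reassoc_of% (pass_pass_contr (A := A) (D := D))]
  simp only [← MonoidalCategory.whiskerLeft_comp_assoc, h]
  simp only [MonoidalCategory.whiskerLeft_comp, Category.assoc]
  simp only [coevPair, contrPair, Category.assoc]
  simp only [reassoc_of% (coevSwap_naturality (A := A) (D := D))]

end Contraction

/-! ### Moving a factor from one tensor power to another. -/

section Slide

variable {C : Type u} [Category.{v} C] [MonoidalCategory C] [SymmetricCategory C]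

/-- Move the first factor of `A ⊗ X` to the front of `Y`. -/
def slide (A X Y : C) : (A ⊗ X) ⊗ Y ⟶ X ⊗ (A ⊗ Y) := (α_ A X Y).hom ≫ pass A X Y

/-- The inverse of `slide`. -/
def slideInv (A X Y : C) : X ⊗ (A ⊗ Y) ⟶ (A ⊗ X) ⊗ Y := pass X A Y ≫ (α_ A X Y).inv

@[simp]
lemma slide_slideInv (A X Y : C) : slide A X Y ≫ slideInv A X Y = 𝟙 _ := by
  simp only [slide, slideInv, Category.assoc, reassoc_of% pass_pass, Iso.hom_inv_id]

@[simp]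
lemma slideInv_slide (A X Y : C) : slideInv A X Y ≫ slide A X Y = 𝟙 _ := by
  simp only [slide, slideInv, Category.assoc, Iso.inv_hom_id_assoc, pass_pass]

lemma slide_naturality (A : C) {X X' Y Y' : C} (f : X ⟶ X') (g : Y ⟶ Y') :
    (A ◁ f ⊗ₘ g) ≫ slide A X' Y' = slide A X Y ≫ (f ⊗ₘ A ◁ g) := by
  rw [slide, slide, Category.assoc, pass_naturality_tensorHom', ← id_tensorHom A f,
    ← id_tensorHom A (f ⊗ₘ g), associator_naturality_assoc]

lemma slideInv_naturality (A : C) {X X' Y Y' : C} (f : X ⟶ X') (g : Y ⟶ Y') :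
    (f ⊗ₘ A ◁ g) ≫ slideInv A X' Y' = slideInv A X Y ≫ (A ◁ f ⊗ₘ g) := by
  rw [slideInv, slideInv, Category.assoc, ← reassoc_of% pass_naturality_tensorHom,
    ← id_tensorHom A f, ← id_tensorHom A (f ⊗ₘ g), associator_inv_naturality]

/-- By Yang–Baxter, the two ways to exchange a factor of the left power with a factor of the right
power agree. In the Koszul homotopy these two terms cancel. -/
lemma slide_swap_slideInv (A X Y : C) :
    slide A X (A ⊗ Y) ≫ X ◁ pass A A Y ≫ slideInv A X (A ⊗ Y)
      = slideInv A (A ⊗ X) Y ≫ pass A A X ▷ Y ≫ slide A (A ⊗ X) Y := by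
  simp only [slide, slideInv, Category.assoc, reassoc_of% (pass_swap_pass A X Y),
    pass_whiskerRight, pass_tensor, pass_tensor', Iso.inv_hom_id_assoc,
    ← MonoidalCategory.whiskerLeft_comp_assoc, Iso.inv_hom_id,
    whiskerLeft_id, Category.id_comp, reassoc_of% pass_pass]

lemma swap_slide_slide (A X Y : C) :
    pass A A X ▷ Y ≫ slide A (A ⊗ X) Y ≫ slide A X (A ⊗ Y)
      = slide A (A ⊗ X) Y ≫ slide A X (A ⊗ Y) ≫ X ◁ pass A A Y := by
  simp only [slide, Category.assoc, pass_whiskerRight, pass_tensor', Iso.inv_hom_id_assoc,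
    ← MonoidalCategory.whiskerLeft_comp_assoc, Iso.inv_hom_id, whiskerLeft_id, Category.id_comp,
    reassoc_of% pass_pass]
  rw [pass_yang_baxter, reassoc_of% pass_pass, MonoidalCategory.whiskerLeft_comp, Category.assoc]

end Slide

end KimuraZeta

namespace KimuraZeta

/-! ### Permutations of n + 1 letters fixing the first one. -/

section Permutations

/-- The character of the symmetric group which sends transpositions to `s`. -/
def signChar (s : ℤˣ) (n : ℕ) : Equiv.Perm (Fin n) →* ℤˣ := if s = 1 then 1 else Equiv.Perm.sign

lemma signChar_one (n : ℕ) : signChar 1 n = 1 := if_pos rfl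

lemma signChar_neg_one (n : ℕ) : signChar (-1) n = Equiv.Perm.sign := if_neg (by decide)

lemma signChar_swap (s : ℤˣ) {n : ℕ} {i j : Fin n} (h : i ≠ j) :
    signChar s n (Equiv.swap i j) = s := by
  rcases Int.units_eq_one_or s with rfl | rfl
  · simp [signChar_one]
  · simp [signChar_neg_one, h]

/-- A permutation of `Fin n` as a permutation of `Fin (n + 1)` which fixes `0`. -/
def succPerm (n : ℕ) : Equiv.Perm (Fin n) →* Equiv.Perm (Fin (n + 1)) where
  toFun τ := Equiv.Perm.decomposeFin.symm (0, τ)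
  map_one' := by
    rw [Equiv.Perm.decomposeFin_symm_of_one, Equiv.swap_self]
    rfl
  map_mul' σ τ := by
    ext x
    refine Fin.cases ?_ (fun x => ?_) x <;> simp

lemma decomposeFin_symm_eq (n : ℕ) (p : Fin (n + 1)) (τ : Equiv.Perm (Fin n)) :
    Equiv.Perm.decomposeFin.symm (p, τ) = Equiv.swap 0 p * succPerm n τ := by
  ext x
  refine Fin.cases ?_ (fun x => ?_) x <;> simp [succPerm]

lemma succPerm_swap (n : ℕ) (i j : Fin n) :
    succPerm n (Equiv.swap i j) = Equiv.swap i.succ j.succ := by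
  ext x
  refine Fin.cases ?_ (fun x => ?_) x
  · simp [succPerm, Equiv.swap_apply_of_ne_of_ne, (Fin.succ_ne_zero _).symm]
  · simp only [succPerm, MonoidHom.coe_mk, OneHom.coe_mk,
      Equiv.Perm.decomposeFin_symm_apply_succ, Equiv.swap_self, Equiv.refl_apply]
    rw [(Fin.succ_injective n).swap_apply]

lemma signChar_succPerm (s : ℤˣ) (n : ℕ) (τ : Equiv.Perm (Fin n)) :
    signChar s (n + 1) (succPerm n τ) = signChar s n τ := by
  rcases Int.units_eq_one_or s with rfl | rfl
  · simp [signChar_one]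
  · simp [signChar_neg_one, succPerm]

lemma permHom_ext {n : ℕ} {R : Type*} [Monoid R] {f g : Equiv.Perm (Fin n) →* R}
    (h : ∀ (i : ℕ) (hi : i + 1 < n), f (Equiv.swap ⟨i, Nat.lt_of_succ_lt hi⟩ ⟨i + 1, hi⟩)
      = g (Equiv.swap ⟨i, Nat.lt_of_succ_lt hi⟩ ⟨i + 1, hi⟩)) : f = g := by
  cases n with
  | zero => ext σ; rw [Subsingleton.elim σ 1, map_one, map_one]
  | succ n =>
    refine MonoidHom.eq_of_eqOn_denseM (Equiv.Perm.mclosure_swap_castSucc_succ n) ?_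
    rintro _ ⟨i, rfl⟩
    exact h i.1 (by omega)

end Permutations

/-! ### Functoriality of tensor powers and of the permutation action. -/

section Action

variable {C : Type u} [Category.{v} C] [MonoidalCategory C]

/-- The tensor power of a morphism. -/
def tensorPowMap {M N : C} (f : M ⟶ N) : (n : ℕ) → (tensorPow M n ⟶ tensorPow N n)
  | 0 => 𝟙 _
  | n + 1 => f ⊗ₘ tensorPowMap f n

lemma tensorPowMap_comp {L M N : C} (f : L ⟶ M) (g : M ⟶ N) (n : ℕ) :
    tensorPowMap (f ≫ g) n = tensorPowMap f n ≫ tensorPowMap g n := by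
  induction n with
  | zero => exact (Category.comp_id _).symm
  | succ n ih =>
    simp only [tensorPowMap, ih]
    exact (MonoidalCategory.tensorHom_comp_tensorHom _ _ _ _).symm

lemma tensorPowMap_id (M : C) (n : ℕ) : tensorPowMap (𝟙 M) n = 𝟙 _ := by
  induction n with
  | zero => rfl
  | succ n ih => simp only [tensorPowMap, ih]; exact id_tensorHom_id _ _

variable [SymmetricCategory C]

lemma permAction_succPerm (M : C) (n : ℕ) (τ : Equiv.Perm (Fin n)) :
    permAction M (n + 1) (succPerm n τ) = whiskerPow M n (permAction M n τ) := by
  suffices h : (permAction M (n + 1)).comp (succPerm n) = (whiskerPow M n).comp (permAction M n)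
    from DFunLike.congr_fun h τ
  refine permHom_ext fun i hi => ?_
  rw [MonoidHom.comp_apply, MonoidHom.comp_apply, permAction_swap, succPerm_swap]
  exact (permAction_swap M (n + 1) (i + 1) (by omega)).trans (adjSwap_succ M n i)

lemma pass_naturality {U U' V V' Z Z' : C} (f : U ⟶ U') (g : V ⟶ V') (h : Z ⟶ Z') :
    (f ⊗ₘ (g ⊗ₘ h)) ≫ pass U' V' Z' = pass U V Z ≫ (g ⊗ₘ (f ⊗ₘ h)) := by
  simp only [pass, Category.assoc]
  rw [← associator_naturality, associator_inv_naturality_assoc]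
  simp only [← tensorHom_id, MonoidalCategory.tensorHom_comp_tensorHom_assoc,
    BraidedCategory.braiding_naturality, Category.comp_id, Category.id_comp]

lemma tensorPowMap_adjSwap {M N : C} (f : M ⟶ N) (n i : ℕ) :
    tensorPowMap f n ≫ adjSwap N n i = adjSwap M n i ≫ tensorPowMap f n := by
  induction n generalizing i with
  | zero => rfl
  | succ n ih =>
    cases i with
    | zero =>
      cases n with
      | zero => exact (Category.comp_id _).trans (Category.id_comp _).symm
      | succ n => exact pass_naturality f f (tensorPowMap f n)
    | succ i =>
      rw [adjSwap_succ, adjSwap_succ]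
      change (f ⊗ₘ tensorPowMap f n) ≫ N ◁ adjSwap N n i = M ◁ adjSwap M n i ≫ (f ⊗ₘ tensorPowMap f n)
      rw [MonoidalCategory.tensorHom_def, Category.assoc, ← MonoidalCategory.whiskerLeft_comp, ih,
        MonoidalCategory.whiskerLeft_comp, ← whisker_exchange_assoc]

lemma tensorPowMap_permAction {M N : C} (f : M ⟶ N) (n : ℕ) (σ : Equiv.Perm (Fin n)) :
    tensorPowMap f n ≫ permAction N n σ = permAction M n σ ≫ tensorPowMap f n := by
  have h : σ ∈ Submonoid.closure (Set.range fun i : {i : ℕ // i + 1 < n} =>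
      Equiv.swap (⟨i.1, Nat.lt_of_succ_lt i.2⟩ : Fin n) ⟨i.1 + 1, i.2⟩) := by
    cases n with
    | zero => rw [Subsingleton.elim σ 1]; exact one_mem _
    | succ n =>
      have h1 : σ ∈ (⊤ : Submonoid (Equiv.Perm (Fin (n + 1)))) := trivial
      rw [← Equiv.Perm.mclosure_swap_castSucc_succ] at h1
      refine Submonoid.closure_mono ?_ h1
      rintro _ ⟨i, rfl⟩
      exact ⟨⟨i.1, by omega⟩, rfl⟩
  induction h using Submonoid.closure_induction with
  | mem x hx =>
    obtain ⟨i, rfl⟩ := hx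
    simp only [permAction_swap, tensorPowMap_adjSwap]
  | one =>
    rw [map_one, map_one]
    exact (Category.comp_id _).trans (Category.id_comp _).symm
  | mul x y _ _ hx hy =>
    rw [map_mul, map_mul, End.mul_def, End.mul_def, ← Category.assoc, hy, Category.assoc, hx,
      Category.assoc]

end Action

/-! ### Recursion for the symmetrizing and antisymmetrizing projectors. -/

section Projectors

variable (K : Type w) [Field K] {C : Type u} [Category.{v} C] [Preadditive C] [Linear K C]
  [MonoidalCategory C] [SymmetricCategory C]

/-- The projector onto the symmetric (`s = 1`) or exterior (`s = -1`) power. -/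
def proj (s : ℤˣ) (M : C) (n : ℕ) : tensorPow M n ⟶ tensorPow M n :=
  permProj K M n (signChar s n)

lemma proj_comp_self [CharZero K] (s : ℤˣ) (M : C) (n : ℕ) : proj K s M n ≫ proj K s M n = proj K s M n :=
  permProj_idem K M n _

lemma tensorPowMap_proj (s : ℤˣ) {M N : C} (f : M ⟶ N) (n : ℕ) :
    tensorPowMap f n ≫ proj K s N n = proj K s M n ≫ tensorPowMap f n := by
  simp only [proj, permProj]
  erw [Linear.comp_smul, Linear.smul_comp, Preadditive.comp_sum, Preadditive.sum_comp]
  congr 1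
  refine Finset.sum_congr rfl fun σ _ => ?_
  erw [Preadditive.comp_zsmul, Preadditive.zsmul_comp, tensorPowMap_permAction]

lemma permAction_mul_signSum (M : C) (n : ℕ) (ε : Equiv.Perm (Fin n) →* ℤˣ)
    (σ : Equiv.Perm (Fin n)) :
    permAction M n σ * ∑ τ, ((ε τ : ℤˣ) : ℤ) • permAction M n τ
      = ((ε σ : ℤˣ) : ℤ) • ∑ τ, ((ε τ : ℤˣ) : ℤ) • permAction M n τ := by
  rw [Finset.mul_sum, Finset.smul_sum, ← Equiv.sum_comp (Equiv.mulLeft σ)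
    (fun τ => ((ε σ : ℤˣ) : ℤ) • ((ε τ : ℤˣ) : ℤ) • permAction M n τ)]
  refine Finset.sum_congr rfl fun τ _ => ?_
  rw [mul_smul_comm, Equiv.coe_mulLeft, map_mul, map_mul, smul_smul, ← Units.val_mul,
    ← mul_assoc, Int.units_mul_self, one_mul]

lemma signSum_mul_permAction (M : C) (n : ℕ) (ε : Equiv.Perm (Fin n) →* ℤˣ)
    (σ : Equiv.Perm (Fin n)) :
    (∑ τ, ((ε τ : ℤˣ) : ℤ) • permAction M n τ) * permAction M n σ
      = ((ε σ : ℤˣ) : ℤ) • ∑ τ, ((ε τ : ℤˣ) : ℤ) • permAction M n τ := by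
  rw [Finset.sum_mul, Finset.smul_sum, ← Equiv.sum_comp (Equiv.mulRight σ)
    (fun τ => ((ε σ : ℤˣ) : ℤ) • ((ε τ : ℤˣ) : ℤ) • permAction M n τ)]
  refine Finset.sum_congr rfl fun τ _ => ?_
  rw [smul_mul_assoc, Equiv.coe_mulRight, map_mul, map_mul, smul_smul, ← Units.val_mul,
    mul_comm (ε τ), ← mul_assoc, Int.units_mul_self, one_mul]

lemma permAction_mul_permProj (M : C) (n : ℕ) (ε : Equiv.Perm (Fin n) →* ℤˣ)
    (σ : Equiv.Perm (Fin n)) :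
    permAction M n σ * permProj K M n ε = ((ε σ : ℤˣ) : ℤ) • permProj K M n ε := by
  rw [permProj, mul_smul_comm, permAction_mul_signSum, smul_comm]

lemma permProj_mul_permAction (M : C) (n : ℕ) (ε : Equiv.Perm (Fin n) →* ℤˣ)
    (σ : Equiv.Perm (Fin n)) :
    permProj K M n ε * permAction M n σ = ((ε σ : ℤˣ) : ℤ) • permProj K M n ε := by
  rw [permProj, smul_mul_assoc, signSum_mul_permAction, smul_comm]

variable [CharZero K]

lemma factorial_smul_permProj (M : C) (n : ℕ) (ε : Equiv.Perm (Fin n) →* ℤˣ) :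
    (n.factorial : K) • permProj K M n ε = ∑ τ, ((ε τ : ℤˣ) : ℤ) • permAction M n τ := by
  rw [permProj, smul_smul, mul_inv_cancel₀ (Nat.cast_ne_zero.2 n.factorial_ne_zero), one_smul]

variable [MonoidalPreadditive C] [MonoidalLinear K C]

lemma whiskerPow_smul (M : C) (n : ℕ) (r : K) (f : End (tensorPow M n)) :
    whiskerPow M n (r • f) = r • whiskerPow M n f :=
  MonoidalLinear.whiskerLeft_smul M r f

lemma whiskerPow_zsmul (M : C) (n : ℕ) (r : ℤ) (f : End (tensorPow M n)) :
    whiskerPow M n (r • f) = r • whiskerPow M n f :=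
  ((tensorLeft M).map_zsmul (f := f) (r := r))

lemma whiskerPow_sum {ι : Type*} (M : C) (n : ℕ) (t : Finset ι) (f : ι → End (tensorPow M n)) :
    whiskerPow M n (∑ i ∈ t, f i) = ∑ i ∈ t, whiskerPow M n (f i) :=
  whiskerLeft_sum M t f

lemma factorial_smul_whiskerPow_permProj (M : C) (n : ℕ) (s : ℤˣ) :
    (n.factorial : K) • whiskerPow M n (permProj K M n (signChar s n))
      = ∑ τ, ((signChar s n τ : ℤˣ) : ℤ) • permAction M (n + 1) (succPerm n τ) := by
  rw [← whiskerPow_smul, factorial_smul_permProj, whiskerPow_sum]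
  simp only [whiskerPow_zsmul, permAction_succPerm]

/-- Permutations fixing the first letter act on the larger projector through the character, so all
n! terms of the smaller projector contribute equally. -/
lemma whiskerPow_permProj_mul (M : C) (n : ℕ) (s : ℤˣ) :
    whiskerPow M n (permProj K M n (signChar s n)) * permProj K M (n + 1) (signChar s (n + 1))
      = permProj K M (n + 1) (signChar s (n + 1)) := by
  have hn : (n.factorial : K) ≠ 0 := Nat.cast_ne_zero.2 n.factorial_ne_zero
  refine smul_right_injective _ hn ?_
  beta_reduce
  rw [← smul_mul_assoc, factorial_smul_whiskerPow_permProj, Finset.sum_mul]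
  simp only [smul_mul_assoc, permAction_mul_permProj, signChar_succPerm, smul_smul,
    Int.units_coe_mul_self, one_smul]
  rw [Finset.sum_const, Finset.card_univ, Fintype.card_perm, Fintype.card_fin,
    Nat.cast_smul_eq_nsmul]

lemma permProj_mul_whiskerPow (M : C) (n : ℕ) (s : ℤˣ) :
    permProj K M (n + 1) (signChar s (n + 1)) * whiskerPow M n (permProj K M n (signChar s n))
      = permProj K M (n + 1) (signChar s (n + 1)) := by
  have hn : (n.factorial : K) ≠ 0 := Nat.cast_ne_zero.2 n.factorial_ne_zero
  refine smul_right_injective _ hn ?_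
  beta_reduce
  rw [← mul_smul_comm, factorial_smul_whiskerPow_permProj, Finset.mul_sum]
  simp only [mul_smul_comm, permProj_mul_permAction, signChar_succPerm, smul_smul,
    Int.units_coe_mul_self, one_smul]
  rw [Finset.sum_const, Finset.card_univ, Fintype.card_perm, Fintype.card_fin,
    Nat.cast_smul_eq_nsmul]

/-- The transpositions `(0 p)`, together with the identity for `p = 0`, represent the cosets of the
stabilizer of `0`. -/
lemma succ_smul_permProj (M : C) (n : ℕ) (s : ℤˣ) :
    ((n + 1 : ℕ) : K) • permProj K M (n + 1) (signChar s (n + 1))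
      = (∑ p : Fin (n + 1), ((signChar s (n + 1) (Equiv.swap 0 p) : ℤˣ) : ℤ) •
          permAction M (n + 1) (Equiv.swap 0 p))
        * whiskerPow M n (permProj K M n (signChar s n)) := by
  have hn : (n.factorial : K) ≠ 0 := Nat.cast_ne_zero.2 n.factorial_ne_zero
  refine smul_right_injective _ hn ?_
  beta_reduce
  rw [smul_smul, ← Nat.cast_mul, mul_comm, ← Nat.factorial_succ, factorial_smul_permProj,
    ← mul_smul_comm, factorial_smul_whiskerPow_permProj, Finset.sum_mul_sum,
    ← Equiv.sum_comp Equiv.Perm.decomposeFin.symm, Fintype.sum_prod_type]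
  refine Finset.sum_congr rfl fun p _ => Finset.sum_congr rfl fun τ _ => ?_
  rw [decomposeFin_symm_eq, map_mul, map_mul, smul_mul_smul_comm, Units.val_mul,
    signChar_succPerm]

lemma swap_zero_succ_succ (n : ℕ) (q : Fin (n + 1)) :
    Equiv.swap (0 : Fin (n + 2)) q.succ
      = succPerm (n + 1) (Equiv.swap 0 q) * Equiv.swap 0 1 * succPerm (n + 1) (Equiv.swap 0 q) := by
  rw [succPerm_swap, Equiv.swap_comm, ← Equiv.swap_mul_swap_mul_swap (y := Fin.succ 0)
    (Fin.succ_ne_zero 0).symm (Fin.succ_ne_zero q).symm]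
  rfl

/-- Between two copies of the projector on the last n + 1 factors, the coset representatives other
than the identity all contribute the same as `(0 1)`. This recursion drives every later computation
with powers. -/
lemma permProj_succ_succ (M : C) (n : ℕ) (s : ℤˣ) :
    ((n + 2 : ℕ) : K) • permProj K M (n + 2) (signChar s (n + 2))
      = whiskerPow M (n + 1) (permProj K M (n + 1) (signChar s (n + 1)))
        + (((s : ℤ) : K) * (n + 1 : ℕ)) •
          (whiskerPow M (n + 1) (permProj K M (n + 1) (signChar s (n + 1))) * swapPow M n
            * whiskerPow M (n + 1) (permProj K M (n + 1) (signChar s (n + 1)))) := by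
  rw [← whiskerPow_permProj_mul, ← mul_smul_comm, succ_smul_permProj, ← mul_assoc,
    Finset.mul_sum, Fin.sum_univ_succ, add_mul]
  set W := whiskerPow M (n + 1) (permProj K M (n + 1) (signChar s (n + 1))) with hW
  have hWW : W * W = W := by
    rw [hW, ← map_mul]
    exact congrArg _ (permProj_idem K M (n + 1) _)
  have hleft (τ) : W * permAction M (n + 2) (succPerm (n + 1) τ)
      = ((signChar s (n + 1) τ : ℤˣ) : ℤ) • W := by
    rw [permAction_succPerm, ← map_mul, permProj_mul_permAction, whiskerPow_zsmul]
  have hright (τ) : permAction M (n + 2) (succPerm (n + 1) τ) * W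
      = ((signChar s (n + 1) τ : ℤˣ) : ℤ) • W := by
    rw [permAction_succPerm, ← map_mul, permAction_mul_permProj, whiskerPow_zsmul]
  have h1 : permAction M (n + 2) (Equiv.swap 0 1) = swapPow M n :=
    permAction_swap M (n + 2) 0 (by omega)
  -- `(0 q+1)` is conjugate to `(0 1)` under the stabilizer of `0`; the conjugating elements are
  -- absorbed by `W` on both sides, and their signs cancel.
  have hq (q : Fin (n + 1)) : W * (((signChar s (n + 2) (Equiv.swap 0 q.succ) : ℤˣ) : ℤ) •
      permAction M (n + 2) (Equiv.swap 0 q.succ)) * W = ((s : ℤ) : K) • (W * swapPow M n * W) := by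
    rw [signChar_swap s (Fin.succ_ne_zero q).symm, swap_zero_succ_succ, map_mul, map_mul, h1,
      mul_smul_comm, smul_mul_assoc, mul_assoc, mul_assoc, mul_assoc, hright, ← mul_assoc, hleft]
    simp only [mul_smul_comm, smul_mul_assoc, smul_smul, mul_assoc, Int.units_coe_mul_self, mul_one]
    rw [Int.cast_smul_eq_zsmul]
  rw [Finset.sum_mul, Finset.sum_congr rfl (fun q _ => hq q), Finset.sum_const, Finset.card_univ,
    Fintype.card_fin, Equiv.swap_self, ← Nat.cast_smul_eq_nsmul K, smul_smul, mul_comm]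
  congr 1
  rw [show Equiv.refl (Fin (n + 2)) = 1 from rfl, map_one, map_one, Units.val_one, one_smul, mul_one,
    hWW]

lemma proj_zero (s : ℤˣ) (M : C) : proj K s M 0 = 𝟙 _ := by
  have h := factorial_smul_permProj K M 0 (signChar s 0)
  rw [Fintype.sum_unique] at h
  simp only [Nat.factorial, Nat.cast_one, one_smul] at h
  rw [proj, h, Subsingleton.elim default 1, map_one, map_one]
  exact one_smul ℤ _

lemma proj_one (s : ℤˣ) (M : C) : proj K s M 1 = 𝟙 _ := by
  have h := factorial_smul_permProj K M 1 (signChar s 1)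
  rw [Fintype.sum_unique] at h
  simp only [Nat.factorial, Nat.succ_eq_add_one, zero_add, mul_one, Nat.cast_one, one_smul] at h
  rw [proj, h, Subsingleton.elim default 1, map_one, map_one]
  exact one_smul ℤ _

lemma proj_succ_succ (s : ℤˣ) (M : C) (n : ℕ) :
    ((n + 2 : ℕ) : K) • proj K s M (n + 2) = M ◁ proj K s M (n + 1) +
      (((s : ℤ) : K) * (n + 1 : ℕ)) • (M ◁ proj K s M (n + 1) ≫ pass M M (tensorPow M n) ≫
        M ◁ proj K s M (n + 1)) :=
  permProj_succ_succ K M n s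

lemma whiskerLeft_proj_comp (s : ℤˣ) (M : C) (n : ℕ) :
    M ◁ proj K s M n ≫ proj K s M (n + 1) = proj K s M (n + 1) :=
  permProj_mul_whiskerPow K M n s

lemma proj_comp_whiskerLeft (s : ℤˣ) (M : C) (n : ℕ) :
    proj K s M (n + 1) ≫ M ◁ proj K s M n = proj K s M (n + 1) :=
  whiskerPow_permProj_mul K M n s

lemma pass_comp_proj (s : ℤˣ) (M : C) (n : ℕ) :
    pass M M (tensorPow M n) ≫ proj K s M (n + 2) = ((s : ℤ) : K) • proj K s M (n + 2) := by
  have h := permProj_mul_permAction K M (n + 2) (signChar s (n + 2)) (Equiv.swap 0 1)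
  rw [signChar_swap s (by simp), show permAction M (n + 2) (Equiv.swap 0 1) = swapPow M n from
    permAction_swap M (n + 2) 0 (by omega), ← Int.cast_smul_eq_zsmul K] at h
  exact h

lemma proj_comp_pass (s : ℤˣ) (M : C) (n : ℕ) :
    proj K s M (n + 2) ≫ pass M M (tensorPow M n) = ((s : ℤ) : K) • proj K s M (n + 2) := by
  have h := permAction_mul_permProj K M (n + 2) (signChar s (n + 2)) (Equiv.swap 0 1)
  rw [signChar_swap s (by simp), show permAction M (n + 2) (Equiv.swap 0 1) = swapPow M n from
    permAction_swap M (n + 2) 0 (by omega), ← Int.cast_smul_eq_zsmul K] at h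
  exact h

end Projectors

end KimuraZeta

namespace KimuraZeta

/-! ### Raising and lowering along a string, abstractly. -/

section Chain

variable {K : Type w} [Field K] {C : Type u} [Category.{v} C] [Preadditive C] [Linear K C]
  {X : ℕ → C} (E : ∀ t, X t ⟶ X t) (U : ∀ t, X t ⟶ X (t + 1)) (V : ∀ t, X (t + 1) ⟶ X t)
  (c : ℕ → K)

/-- The composite of the maps `E 0, U 0, …, U (n - 1)`. -/
def climb : ∀ t, X 0 ⟶ X t
  | 0 => E 0
  | t + 1 => climb t ≫ U t

variable {E U V c}
variable (hUE : ∀ t, U t ≫ E (t + 1) = U t) (hVE : ∀ t, V t ≫ E t = V t) (hE0 : E 0 ≫ E 0 = E 0)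
  (h0 : U 0 ≫ V 0 = c 0 • E 0)
  (h : ∀ t, U (t + 1) ≫ V (t + 1) = V t ≫ U t + c (t + 1) • E (t + 1))

include hUE hE0 in
lemma climb_comp_self (t : ℕ) : climb E U t ≫ E t = climb E U t := by
  cases t with
  | zero => exact hE0
  | succ t => rw [climb, Category.assoc, hUE]

-- Each commutation of a descent past an ascent adds one weight, so descending from the image of `X
-- 0` is multiplication by a partial sum of weights.
include hUE hE0 h0 h in
lemma climb_comp_down (t : ℕ) :
    climb E U (t + 1) ≫ V t = (∑ j ∈ Finset.range (t + 1), c j) • climb E U t := by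
  induction t with
  | zero => simp [climb, h0, hE0]
  | succ t ih =>
    rw [climb, Category.assoc, h, Preadditive.comp_add, ← Category.assoc, ih, Linear.comp_smul,
      climb_comp_self hUE hE0, Linear.smul_comp, Finset.sum_range_succ _ (t + 1), add_smul, climb]

include hUE hE0 h0 h in
/-- If the partial sums of the weights do not vanish, then climbing is a split monomorphism. -/
lemma exists_climb_comp_eq (n : ℕ) (hc : ∀ t < n, ∑ j ∈ Finset.range (t + 1), c j ≠ 0) :
    ∃ v : X n ⟶ X 0, climb E U n ≫ v = E 0 := by
  induction n with
  | zero => exact ⟨E 0, hE0⟩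
  | succ n ih =>
    obtain ⟨v, hv⟩ := ih fun t ht => hc t (by omega)
    refine ⟨(∑ j ∈ Finset.range (n + 1), c j)⁻¹ • (V n ≫ v), ?_⟩
    rw [Linear.comp_smul, ← Category.assoc, climb_comp_down hUE hE0 h0 h, Linear.smul_comp, hv,
      smul_smul, inv_mul_cancel₀ (hc n (by omega)), one_smul]

include hVE h in
/-- A morphism to `X n` on which going up and down again acts as a suitable scalar lifts to
`X 0`. -/
lemma exists_comp_climb_eq {Y : C} (n : ℕ) (g : Y ⟶ X n) (hg : g ≫ E n = g) (r : K)
    (hr : g ≫ U n ≫ V n = r • g) (hc : ∀ t < n, r - ∑ j ∈ Finset.Ioc t n, c j ≠ 0) :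
    ∃ v : Y ⟶ X 0, v ≫ climb E U n = g := by
  induction n generalizing r with
  | zero => exact ⟨g, hg⟩
  | succ n ih =>
    have hsum (t) (ht : t ≤ n) : ∑ j ∈ Finset.Ioc t (n + 1), c j
        = ∑ j ∈ Finset.Ioc t n, c j + c (n + 1) := Finset.sum_Ioc_succ_top ht c
    -- One step down, `g ≫ V n` is again an eigenvector for going up and down, with the eigenvalue
    -- lowered by `c (n + 1)`; `g` is recovered from it when the new eigenvalue is not 0.
    have h1 : (g ≫ V n) ≫ U n = (r - c (n + 1)) • g := by
      rw [h, Preadditive.comp_add, Linear.comp_smul, hg] at hr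
      rw [Category.assoc, sub_smul, ← hr, add_sub_cancel_right]
    have hr' : r - c (n + 1) ≠ 0 := by
      have := hc n (by omega)
      rwa [hsum n le_rfl, Finset.Ioc_self, Finset.sum_empty, zero_add] at this
    obtain ⟨v, hv⟩ := ih (g ≫ V n) (by rw [Category.assoc, hVE]) (r - c (n + 1))
      (by rw [← Category.assoc, h1, Linear.smul_comp]) fun t ht => by
        have := hc t (by omega)
        rwa [hsum t ht.le, add_comm, ← sub_sub] at this
    refine ⟨(r - c (n + 1))⁻¹ • v, ?_⟩
    rw [climb, Linear.smul_comp, ← Category.assoc, hv, h1, smul_smul, inv_mul_cancel₀ hr', one_smul]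

-- The eigenvalue reached at the bottom must be `c 0` unless the eigenvector is 0; `hc0` excludes
-- this, and `hc` allows the vanishing to be carried back up.
include hVE h0 h in
lemma eq_zero_of_chain {Y : C} (n : ℕ) (g : Y ⟶ X n) (hg : g ≫ E n = g) (r : K)
    (hr : g ≫ U n ≫ V n = r • g) (hc : ∀ t < n, r - ∑ j ∈ Finset.Ioc t n, c j ≠ 0)
    (hc0 : r - ∑ j ∈ Finset.range (n + 1), c j ≠ 0) : g = 0 := by
  induction n generalizing r with
  | zero =>
    rw [h0, Linear.comp_smul, hg] at hr
    have h1 : (r - c 0) • g = 0 := by rw [sub_smul, hr, sub_self]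
    rw [Finset.sum_range_one] at hc0
    exact (smul_eq_zero.1 h1).resolve_left hc0
  | succ n ih =>
    have hsum (t) (ht : t ≤ n) : ∑ j ∈ Finset.Ioc t (n + 1), c j
        = ∑ j ∈ Finset.Ioc t n, c j + c (n + 1) := Finset.sum_Ioc_succ_top ht c
    have h1 : (g ≫ V n) ≫ U n = (r - c (n + 1)) • g := by
      rw [h, Preadditive.comp_add, Linear.comp_smul, hg] at hr
      rw [Category.assoc, sub_smul, ← hr, add_sub_cancel_right]
    have hr' : r - c (n + 1) ≠ 0 := by
      have := hc n (by omega)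
      rwa [hsum n le_rfl, Finset.Ioc_self, Finset.sum_empty, zero_add] at this
    have h2 := ih (g ≫ V n) (by rw [Category.assoc, hVE]) (r - c (n + 1))
      (by rw [← Category.assoc, h1, Linear.smul_comp]) (fun t ht => by
        have := hc t (by omega)
        rwa [hsum t ht.le, add_comm, ← sub_sub] at this)
      (by rwa [Finset.sum_range_succ, add_comm, ← sub_sub] at hc0)
    rw [h2, zero_comp] at h1
    exact (smul_eq_zero.1 h1.symm).resolve_left hr'

end Chain

/-! ### The commutation relation for powers of an object and of its dual. -/

section Lefschetz

variable (K : Type w) [Field K] [CharZero K] {C : Type u} [Category.{v} C] [Preadditive C]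
  [Linear K C] [MonoidalCategory C] [SymmetricCategory C]

/-- The tensor product of the projectors onto the powers of `D` and `A`. -/
def proj₂ (s t : ℤˣ) (D A : C) (i k : ℕ) :
    tensorPow D i ⊗ tensorPow A k ⟶ tensorPow D i ⊗ tensorPow A k := proj K s D i ⊗ₘ proj K t A k

lemma proj₂_comp_self (s t : ℤˣ) (D A : C) (i k : ℕ) :
    proj₂ K s t D A i k ≫ proj₂ K s t D A i k = proj₂ K s t D A i k := by
  rw [proj₂, MonoidalCategory.tensorHom_comp_tensorHom, proj_comp_self, proj_comp_self]

variable [MonoidalPreadditive C] [MonoidalLinear K C]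

lemma smul_tensorHom_smul {X X' Y Y' : C} (a b : K) (f : X ⟶ X') (g : Y ⟶ Y') :
    (a • f) ⊗ₘ (b • g) = (a * b) • (f ⊗ₘ g) := by
  simp only [MonoidalCategory.tensorHom_def, MonoidalLinear.whiskerLeft_smul,
    MonoidalLinear.smul_whiskerRight, Linear.smul_comp, Linear.comp_smul, smul_smul, mul_comm]

variable (s : ℤˣ) (A D : C) [ExactPairing A D]

/-- Insertion of the coevaluation, as a map between tensor powers. -/
def coevPow (i k : ℕ) : tensorPow D i ⊗ tensorPow A k ⟶
    tensorPow D (i + 1) ⊗ tensorPow A (k + 1) := coevPair A D (tensorPow D i) (tensorPow A k)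

/-- Contraction, as a map between tensor powers. -/
def contrPow (i k : ℕ) : tensorPow D (i + 1) ⊗ tensorPow A (k + 1) ⟶
    tensorPow D i ⊗ tensorPow A k := contrPair A D (tensorPow D i) (tensorPow A k)

/-- Multiplication by the coevaluation, as a map between powers. -/
def raise (i k : ℕ) : tensorPow D i ⊗ tensorPow A k ⟶
    tensorPow D (i + 1) ⊗ tensorPow A (k + 1) :=
  proj₂ K s s D A i k ≫ coevPow A D i k ≫ proj₂ K s s D A (i + 1) (k + 1)

/-- Contraction, as a map between powers. -/
def lower (i k : ℕ) : tensorPow D (i + 1) ⊗ tensorPow A (k + 1) ⟶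
    tensorPow D i ⊗ tensorPow A k :=
  (((i + 1 : ℕ) : K) * ((k + 1 : ℕ) : K)) •
    (proj₂ K s s D A (i + 1) (k + 1) ≫ contrPow A D i k ≫ proj₂ K s s D A i k)

-- By naturality the projectors on the old factors slide out through the coevaluation and the
-- contraction, where they meet another copy of themselves.
variable {A D} in
lemma sandwich {X Y : C} {f : X ⟶ X} {e : Y ⟶ Y} (hf : f ≫ f = f) (he : e ≫ e = e)
    (T : (D ⊗ X) ⊗ (A ⊗ Y) ⟶ (D ⊗ X) ⊗ (A ⊗ Y)) :
    (f ⊗ₘ e) ≫ coevPair A D X Y ≫ (D ◁ f ⊗ₘ A ◁ e) ≫ T ≫ (D ◁ f ⊗ₘ A ◁ e) ≫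
      contrPair A D X Y ≫ (f ⊗ₘ e) = (f ⊗ₘ e) ≫ coevPair A D X Y ≫ T ≫ contrPair A D X Y ≫
      (f ⊗ₘ e) := by
  have h : (f ⊗ₘ e) ≫ (f ⊗ₘ e) = (f ⊗ₘ e) := by
    rw [MonoidalCategory.tensorHom_comp_tensorHom, hf, he]
  rw [← reassoc_of% (contrPair_naturality (A := A) (D := D)), h, ← reassoc_of% (coevPair_naturality (A := A) (D := D)), reassoc_of% h]

/-- The composite is a closed loop next to `Z`, that is, the Euler characteristic. -/
lemma coevSwap_contr {x : K} (hx : η_ A D ≫ (β_ A D).hom ≫ ε_ A D = x • 𝟙 (𝟙_ C)) (Z : C) :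
    coevSwap A D Z ≫ contr A D Z = x • 𝟙 Z := by
  have h : coevSwap A D Z ≫ contr A D Z
      = (λ_ Z).inv ≫ (η_ A D ≫ (β_ A D).hom ≫ ε_ A D) ▷ Z ≫ (λ_ Z).hom := by
    simp only [coevSwap, coev, pass, contr]; monoidal
  rw [h, hx]
  simp

/-- Expanding both larger projectors by the recursion gives four terms: no crossing (a loop, `x`), a
crossing on one side only (a curl, `a` or `b`), and crossings on both sides (`R`). The hypotheses on
the crossings are multiplied by their coefficients so that degree 0, where no crossing exists, fits
in with coefficient 0. -/
lemma coev_proj_contr {x : K} (hx : η_ A D ≫ (β_ A D).hom ≫ ε_ A D = x • 𝟙 (𝟙_ C)) {X Y : C}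
    {f : X ⟶ X} {e : Y ⟶ Y} (hf : f ≫ f = f) (he : e ≫ e = e) {n m a b : K}
    {f' P : D ⊗ X ⟶ D ⊗ X} {e' Q : A ⊗ Y ⟶ A ⊗ Y} {R : X ⊗ Y ⟶ X ⊗ Y}
    (hf' : n • f' = D ◁ f + a • (D ◁ f ≫ P ≫ D ◁ f))
    (he' : m • e' = A ◁ e + b • (A ◁ e ≫ Q ≫ A ◁ e))
    (hP : a • (coevPair A D X Y ≫ P ▷ (A ⊗ Y) ≫ contrPair A D X Y) = a • 𝟙 _)
    (hQ : b • (coevPair A D X Y ≫ (D ⊗ X) ◁ Q ≫ contrPair A D X Y) = b • 𝟙 _)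
    (hR : (a * b) • (coevPair A D X Y ≫ (P ⊗ₘ Q) ≫ contrPair A D X Y) = (a * b) • R) :
    (n * m) • ((f ⊗ₘ e) ≫ coevPair A D X Y ≫ (f' ⊗ₘ e') ≫ contrPair A D X Y ≫ (f ⊗ₘ e))
      = (a * b) • ((f ⊗ₘ e) ≫ R ≫ (f ⊗ₘ e)) + (x + (a + b)) • (f ⊗ₘ e) := by
  have hfe : (f ⊗ₘ e) ≫ (f ⊗ₘ e) = (f ⊗ₘ e) := by
    rw [MonoidalCategory.tensorHom_comp_tensorHom, hf, he]
  have hF : D ◁ f ≫ D ◁ f = D ◁ f := by rw [← MonoidalCategory.whiskerLeft_comp, hf]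
  have hG : A ◁ e ≫ A ◁ e = A ◁ e := by rw [← MonoidalCategory.whiskerLeft_comp, he]
  have hP1 : D ◁ f ≫ P ≫ D ◁ f ⊗ₘ A ◁ e
      = (D ◁ f ⊗ₘ A ◁ e) ≫ P ▷ (A ⊗ Y) ≫ (D ◁ f ⊗ₘ A ◁ e) := by
    rw [← tensorHom_id, MonoidalCategory.tensorHom_comp_tensorHom,
      MonoidalCategory.tensorHom_comp_tensorHom, Category.id_comp, hG]
  have hQ1 : D ◁ f ⊗ₘ A ◁ e ≫ Q ≫ A ◁ e
      = (D ◁ f ⊗ₘ A ◁ e) ≫ (D ⊗ X) ◁ Q ≫ (D ◁ f ⊗ₘ A ◁ e) := by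
    rw [← id_tensorHom (D ⊗ X) Q, MonoidalCategory.tensorHom_comp_tensorHom,
      MonoidalCategory.tensorHom_comp_tensorHom, Category.id_comp, hF]
  have hR1 : D ◁ f ≫ P ≫ D ◁ f ⊗ₘ A ◁ e ≫ Q ≫ A ◁ e
      = (D ◁ f ⊗ₘ A ◁ e) ≫ (P ⊗ₘ Q) ≫ (D ◁ f ⊗ₘ A ◁ e) := by
    rw [MonoidalCategory.tensorHom_comp_tensorHom, MonoidalCategory.tensorHom_comp_tensorHom]
  have h1 : D ◁ f ⊗ₘ A ◁ e = (D ◁ f ⊗ₘ A ◁ e) ≫ 𝟙 _ ≫ (D ◁ f ⊗ₘ A ◁ e) := by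
    rw [Category.id_comp, MonoidalCategory.tensorHom_comp_tensorHom, hF, hG]
  have hexp : (n * m) • (f' ⊗ₘ e') = (D ◁ f ⊗ₘ A ◁ e) ≫
      (𝟙 _ + a • P ▷ (A ⊗ Y) + b • (D ⊗ X) ◁ Q + (a * b) • (P ⊗ₘ Q)) ≫ (D ◁ f ⊗ₘ A ◁ e) := by
    rw [← smul_tensorHom_smul, hf', he']
    simp only [MonoidalPreadditive.add_tensor, MonoidalPreadditive.tensor_add]
    rw [← one_smul K (D ◁ f), ← one_smul K (A ◁ e)]
    simp only [smul_tensorHom_smul]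
    simp only [one_smul, one_mul, mul_one, hP1, hQ1, hR1]
    simp only [Preadditive.comp_add, Preadditive.add_comp, Linear.smul_comp, Linear.comp_smul, ← h1]
    abel
  rw [← Linear.comp_smul, ← Linear.comp_smul, ← Linear.smul_comp, hexp, Category.assoc,
    Category.assoc, sandwich hf he]
  have hmid : coevPair A D X Y ≫
      (𝟙 _ + a • P ▷ (A ⊗ Y) + b • (D ⊗ X) ◁ Q + (a * b) • (P ⊗ₘ Q)) ≫ contrPair A D X Y
      = (a * b) • R + (x + (a + b)) • 𝟙 _ := by
    simp only [Preadditive.comp_add, Preadditive.add_comp, Linear.smul_comp, Linear.comp_smul,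
      hP, hQ, hR, Category.id_comp, coevPair_contrPair, coevSwap_contr K A D hx, add_smul]
    abel
  rw [← Category.assoc (coevPair A D X Y), ← Category.assoc (_ ≫ _), Category.assoc _ _ (contrPair A D X Y),
    hmid]
  simp only [Preadditive.comp_add, Preadditive.add_comp, Linear.smul_comp, Linear.comp_smul,
    Category.id_comp, hfe]

lemma raise_lower_eq (i k : ℕ) : raise K s A D i k ≫ lower K s A D i k =
    (((i + 1 : ℕ) : K) * ((k + 1 : ℕ) : K)) • (proj₂ K s s D A i k ≫ coevPow A D i k ≫
      proj₂ K s s D A (i + 1) (k + 1) ≫ contrPow A D i k ≫ proj₂ K s s D A i k) := by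
  simp only [raise, lower, Linear.comp_smul, Category.assoc]
  rw [reassoc_of% (proj₂_comp_self K s s D A (i + 1) (k + 1))]

/-- The recursion in degree 1, padded with a zero term so that it has the shape required by
`coev_proj_contr`. -/
lemma proj_one_eq (M : C) : ((0 + 1 : ℕ) : K) • proj K s M (0 + 1) = M ◁ proj K s M 0 +
    (0 : K) • (M ◁ proj K s M 0 ≫ 0 ≫ M ◁ proj K s M 0) := by
  have h : ((0 + 1 : ℕ) : K) = 1 := by simp
  rw [zero_smul, add_zero, h, one_smul, proj_zero, proj_one]
  exact (whiskerLeft_id _ _).symm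

lemma raise_lower_zero_zero {x : K} (hx : η_ A D ≫ (β_ A D).hom ≫ ε_ A D = x • 𝟙 (𝟙_ C)) :
    raise K s A D 0 0 ≫ lower K s A D 0 0 = x • proj₂ K s s D A 0 0 := by
  rw [raise_lower_eq]
  refine (coev_proj_contr K A D hx (proj_comp_self K s D 0) (proj_comp_self K s A 0)
    (proj_one_eq K s D) (proj_one_eq K s A) (R := 0) ?_ ?_ ?_).trans ?_ <;> simp
  rfl

lemma raise_lower_zero_succ {x : K} (hx : η_ A D ≫ (β_ A D).hom ≫ ε_ A D = x • 𝟙 (𝟙_ C))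
    (k : ℕ) : raise K s A D 0 (k + 1) ≫ lower K s A D 0 (k + 1)
      = (x + ((s : ℤ) : K) * (k + 1 : ℕ)) • proj₂ K s s D A 0 (k + 1) := by
  rw [raise_lower_eq]
  refine (coev_proj_contr K A D hx (proj_comp_self K s D 0) (proj_comp_self K s A (k + 1))
    (proj_one_eq K s D) (proj_succ_succ K s A k) (R := 0) ?_ ?_ ?_).trans ?_
  · simp
  · exact congrArg _ (coevPair_swap_contrPair_right _ _)
  · simp
  · simp only [zero_mul, zero_smul, zero_add]
    rfl

lemma raise_lower_succ_zero {x : K} (hx : η_ A D ≫ (β_ A D).hom ≫ ε_ A D = x • 𝟙 (𝟙_ C))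
    (i : ℕ) : raise K s A D (i + 1) 0 ≫ lower K s A D (i + 1) 0
      = (x + ((s : ℤ) : K) * (i + 1 : ℕ)) • proj₂ K s s D A (i + 1) 0 := by
  rw [raise_lower_eq]
  refine (coev_proj_contr K A D hx (proj_comp_self K s D (i + 1)) (proj_comp_self K s A 0)
    (proj_succ_succ K s D i) (proj_one_eq K s A) (R := 0) ?_ ?_ ?_).trans ?_
  · exact congrArg _ (coevPair_swap_contrPair_left _ _)
  · simp
  · simp
  · simp only [mul_zero, zero_smul, zero_add, add_zero]
    rfl

/-- The middle projectors can be dropped: they commute with the contraction and are absorbed by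
those of higher degree. -/
lemma lower_raise_eq (i k : ℕ) : lower K s A D i k ≫ raise K s A D i k =
    (((i + 1 : ℕ) : K) * ((k + 1 : ℕ) : K)) • (proj₂ K s s D A (i + 1) (k + 1) ≫
      (contrPow A D i k ≫ coevPow A D i k) ≫ proj₂ K s s D A (i + 1) (k + 1)) := by
  have h1 : proj₂ K s s D A (i + 1) (k + 1) ≫ contrPow A D i k ≫ proj₂ K s s D A i k
      = proj₂ K s s D A (i + 1) (k + 1) ≫ contrPow A D i k := by
    refine (congrArg (proj₂ K s s D A (i + 1) (k + 1) ≫ ·)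
      (contrPair_naturality (proj K s D i) (proj K s A k))).trans
      ((Category.assoc _ _ _).symm.trans (congrArg (· ≫ contrPow A D i k) ?_))
    refine (MonoidalCategory.tensorHom_comp_tensorHom _ _ _ _).trans ?_
    rw [proj_comp_whiskerLeft, proj_comp_whiskerLeft]
    rfl
  simp only [raise, lower, Linear.smul_comp, Category.assoc]
  rw [reassoc_of% (proj₂_comp_self K s s D A i k), reassoc_of% h1]

/-- The normalization (i + 1)(k + 1) in `lower` is what turns the double-crossing term into exactly
`lower` followed by `raise`, since s² = 1. -/
lemma raise_lower_succ_succ {x : K} (hx : η_ A D ≫ (β_ A D).hom ≫ ε_ A D = x • 𝟙 (𝟙_ C))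
    (i k : ℕ) : raise K s A D (i + 1) (k + 1) ≫ lower K s A D (i + 1) (k + 1)
      = lower K s A D i k ≫ raise K s A D i k +
        (x + ((s : ℤ) : K) * ((i + 1 : ℕ) + (k + 1 : ℕ))) • proj₂ K s s D A (i + 1) (k + 1) := by
  rw [raise_lower_eq]
  refine (coev_proj_contr K A D hx (proj_comp_self K s D (i + 1)) (proj_comp_self K s A (k + 1))
    (proj_succ_succ K s D i) (proj_succ_succ K s A k)
    (R := contrPair A D (tensorPow D i) (tensorPow A k) ≫ coevPair A D _ _) ?_ ?_ ?_).trans ?_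
  · exact congrArg _ (coevPair_swap_contrPair_left _ _)
  · exact congrArg _ (coevPair_swap_contrPair_right _ _)
  · exact congrArg _ (coevPair_swap_swap_contrPair _ _)
  · rw [lower_raise_eq, mul_add]
    congr 2
    rw [mul_mul_mul_comm, ← Int.cast_mul, Int.units_coe_mul_self, Int.cast_one, one_mul]

end Lefschetz

end KimuraZeta

namespace KimuraZeta

/-! ### Equivalence of the ends of a string. -/

section ChainEquiv

variable {K : Type w} [Field K] {C : Type u} [Category.{v} C] [Preadditive C] [Linear K C]
  {X : ℕ → C} {E : ∀ t, X t ⟶ X t} {U : ∀ t, X t ⟶ X (t + 1)} {V : ∀ t, X (t + 1) ⟶ X t}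
  {c : ℕ → K}

lemma comp_climb (hE0 : E 0 ≫ E 0 = E 0) (n : ℕ) : E 0 ≫ climb E U n = climb E U n := by
  induction n with
  | zero => exact hE0
  | succ n ih => rw [climb, ← Category.assoc, ih]

/-- Idempotents at the ends of a chain with nonvanishing partial sums of weights are equivalent. -/
lemma exists_equiv_of_chain (hUE : ∀ t, U t ≫ E (t + 1) = U t) (hVE : ∀ t, V t ≫ E t = V t)
    (hE : ∀ t, E t ≫ E t = E t) (h0 : U 0 ≫ V 0 = c 0 • E 0)
    (h : ∀ t, U (t + 1) ≫ V (t + 1) = V t ≫ U t + c (t + 1) • E (t + 1))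
    (n : ℕ) (hn : U n = 0) (hc : ∀ t < n, ∑ j ∈ Finset.range (t + 1), c j ≠ 0)
    (hc' : ∀ t < n, ∑ j ∈ Finset.Ioc t n, c j ≠ 0) :
    ∃ (u : X 0 ⟶ X n) (v : X n ⟶ X 0), u ≫ v = E 0 ∧ v ≫ u = E n := by
  obtain ⟨v, hv⟩ := exists_climb_comp_eq hUE (hE 0) h0 h n hc
  -- Since `U n = 0`, the identity at the top has eigenvalue 0, so it lifts to `X 0`: climbing is
  -- split on this side too.
  obtain ⟨v', hv'⟩ := exists_comp_climb_eq hVE h n (E n) (hE n) 0 (by rw [hn]; simp)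
    fun t ht => by rw [zero_sub]; exact neg_ne_zero.2 (hc' t ht)
  refine ⟨climb E U n, v' ≫ E 0, ?_, ?_⟩
  · rw [← hv, ← Category.assoc v', hv', ← Category.assoc, climb_comp_self hUE (hE 0)]
  · rw [Category.assoc, comp_climb (hE 0), hv']

/-- The weights form an arithmetic progression; the factored partial sums make their nonvanishing
visible. -/
lemma sum_range_arith (s d : K) (t : ℕ) :
    ∑ j ∈ Finset.range (t + 1), s * (2 * (j : K) + d) = s * ((t + 1) * (t + d)) := by
  induction t with
  | zero => simp
  | succ t ih => rw [Finset.sum_range_succ, ih]; push_cast; ring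

lemma sum_Ioc_arith (s d : K) {t n : ℕ} (h : t ≤ n) :
    ∑ j ∈ Finset.Ioc t n, s * (2 * (j : K) + d) = s * ((n - t) * (n + t + 1 + d)) := by
  induction n, h using Nat.le_induction with
  | base => simp
  | succ n h ih => rw [Finset.sum_Ioc_succ_top h, ih]; push_cast; ring

end ChainEquiv

/-! ### Powers of the dual in terms of powers of the object. -/

section Lefschetz

variable (K : Type w) [Field K] [CharZero K] {C : Type u} [Category.{v} C] [Preadditive C]
  [Linear K C] [MonoidalCategory C] [SymmetricCategory C] [MonoidalPreadditive C]
  [MonoidalLinear K C] (s : ℤˣ) (A D : C) [ExactPairing A D]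

lemma raise_comp_proj₂ (i k : ℕ) :
    raise K s A D i k ≫ proj₂ K s s D A (i + 1) (k + 1) = raise K s A D i k := by
  rw [raise, Category.assoc, Category.assoc, proj₂_comp_self]

lemma lower_comp_proj₂ (i k : ℕ) :
    lower K s A D i k ≫ proj₂ K s s D A i k = lower K s A D i k := by
  rw [lower, Linear.smul_comp, Category.assoc, Category.assoc, proj₂_comp_self]

lemma raise_lower_zero_left {x : K} (hx : η_ A D ≫ (β_ A D).hom ≫ ε_ A D = x • 𝟙 (𝟙_ C))
    (k : ℕ) : raise K s A D 0 k ≫ lower K s A D 0 k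
      = (x + ((s : ℤ) : K) * k) • proj₂ K s s D A 0 k := by
  cases k with
  | zero => rw [raise_lower_zero_zero K s A D hx, Nat.cast_zero, mul_zero, add_zero]
  | succ k => exact raise_lower_zero_succ K s A D hx k

lemma raise_lower_zero_right {x : K} (hx : η_ A D ≫ (β_ A D).hom ≫ ε_ A D = x • 𝟙 (𝟙_ C))
    (i : ℕ) : raise K s A D i 0 ≫ lower K s A D i 0
      = (x + ((s : ℤ) : K) * i) • proj₂ K s s D A i 0 := by
  cases i with
  | zero => rw [raise_lower_zero_zero K s A D hx, Nat.cast_zero, mul_zero, add_zero]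
  | succ i => exact raise_lower_succ_zero K s A D hx i

variable {s A}

lemma raise_eq_zero {k : ℕ} (h : proj K s A (k + 1) = 0) (i : ℕ) : raise K s A D i k = 0 := by
  rw [raise, proj₂, proj₂, h, MonoidalPreadditive.tensor_zero, comp_zero, comp_zero]

/-- Nothing can be raised from bidegree (0, k), while going up and down there is the scalar `x + s
k`. -/
lemma smul_proj_eq_zero {x : K} (hx : η_ A D ≫ (β_ A D).hom ≫ ε_ A D = x • 𝟙 (𝟙_ C)) {k : ℕ}
    (h : proj K s A (k + 1) = 0) : (x + ((s : ℤ) : K) * k) • proj K s A k = 0 := by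
  have h1 := raise_lower_zero_left K s A D hx k
  rw [raise_eq_zero K D h, zero_comp, proj₂, proj_zero, id_tensorHom,
    ← MonoidalLinear.whiskerLeft_smul] at h1
  have h2 : 𝟙_ C ◁ ((x + ((s : ℤ) : K) * k) • proj K s A k) = 0 := h1.symm
  rw [← cancel_epi (λ_ _).hom, ← leftUnitor_naturality, h2, zero_comp, comp_zero]

lemma unit_cast_ne_zero : ((s : ℤ) : K) ≠ 0 := by
  rcases Int.units_eq_one_or s with rfl | rfl <;> simp

/-- If the `p + 1`-st power vanishes and `A` has Euler characteristic `-s p`, then the top power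
pairs the powers of `D` and of `A`. -/
lemma exists_equiv_proj₂ (i k : ℕ)
    (hx : η_ A D ≫ (β_ A D).hom ≫ ε_ A D = (-((s : ℤ) : K) * (k + i : ℕ)) • 𝟙 (𝟙_ C))
    (h : proj K s A (k + i + 1) = 0) :
    ∃ (u : tensorPow D 0 ⊗ tensorPow A k ⟶ tensorPow D i ⊗ tensorPow A (k + i))
      (v : tensorPow D i ⊗ tensorPow A (k + i) ⟶ tensorPow D 0 ⊗ tensorPow A k),
      u ≫ v = proj₂ K s s D A 0 k ∧ v ≫ u = proj₂ K s s D A i (k + i) := by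
  -- The string runs through the bidegrees (t, k + t). With χ(A) = -s(k + i), the weight χ(A) + s(k
  -- + 2t) is s(2t - i).
  refine exists_equiv_of_chain (K := K) (X := fun t => tensorPow D t ⊗ tensorPow A (k + t))
    (E := fun t => proj₂ K s s D A t (k + t)) (U := fun t => raise K s A D t (k + t))
    (V := fun t => lower K s A D t (k + t))
    (c := fun t => ((s : ℤ) : K) * (2 * (t : K) + (-(i : K))))
    (fun t => raise_comp_proj₂ K s A D _ _) (fun t => lower_comp_proj₂ K s A D _ _)
    (fun t => proj₂_comp_self K s s D A _ _) ?_ (fun t => ?_) i (raise_eq_zero K D h i)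
    (fun t ht => ?_) (fun t ht => ?_)
  · refine (raise_lower_zero_left K s A D hx k).trans ?_
    congr 1
    push_cast
    ring
  · refine (raise_lower_succ_succ K s A D hx t (k + t)).trans ?_
    congr 2
    push_cast
    ring
  · rw [sum_range_arith]
    refine mul_ne_zero (unit_cast_ne_zero K) (mul_ne_zero (Nat.cast_add_one_ne_zero t) ?_)
    rw [← sub_eq_add_neg]
    exact sub_ne_zero.2 (Nat.cast_injective.ne ht.ne)
  · rw [sum_Ioc_arith _ _ ht.le]
    refine mul_ne_zero (unit_cast_ne_zero K)
      (mul_ne_zero (sub_ne_zero.2 (Nat.cast_injective.ne ht.ne')) ?_)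
    rw [show (i : K) + t + 1 + -(i : K) = t + 1 by ring]
    exact Nat.cast_add_one_ne_zero t

/-- The string now starts at (a + 1, 0) and ends at (a + 1 + p, p), where raising vanishes. The sum
of all weights is s(p + 1)(a + 1), which is nonzero, so the identity at the end of the string is 0.
-/
lemma proj₂_eq_zero (a p : ℕ)
    (hx : η_ A D ≫ (β_ A D).hom ≫ ε_ A D = (-((s : ℤ) : K) * p) • 𝟙 (𝟙_ C))
    (h : proj K s A (p + 1) = 0) : proj₂ K s s D A (a + 1 + p) p = 0 := by
  refine eq_zero_of_chain (K := K) (X := fun t => tensorPow D (a + 1 + t) ⊗ tensorPow A t)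
    (E := fun t => proj₂ K s s D A (a + 1 + t) t) (U := fun t => raise K s A D (a + 1 + t) t)
    (V := fun t => lower K s A D (a + 1 + t) t)
    (c := fun t => ((s : ℤ) : K) * (2 * (t : K) + ((a : K) + 1 - p)))
    (fun t => lower_comp_proj₂ K s A D _ _)
    ?_ (fun t => ?_) p (proj₂ K s s D A (a + 1 + p) p) (proj₂_comp_self K s s D A _ _) 0 ?_
    (fun t ht => ?_) ?_
  · refine (raise_lower_zero_right K s A D hx (a + 1)).trans ?_
    congr 1
    push_cast
    ring
  · refine (raise_lower_succ_succ K s A D hx (a + 1 + t) t).trans ?_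
    congr 2
    push_cast
    ring
  · rw [raise_eq_zero K D h]; simp
  · rw [sum_Ioc_arith _ _ ht.le, zero_sub]
    refine neg_ne_zero.2 (mul_ne_zero (unit_cast_ne_zero K)
      (mul_ne_zero (sub_ne_zero.2 (Nat.cast_injective.ne ht.ne')) ?_))
    rw [show (p : K) + t + 1 + ((a : K) + 1 - p) = ((t + a + 1 : ℕ) : K) + 1 by push_cast; ring]
    exact Nat.cast_add_one_ne_zero _
  · rw [sum_range_arith, zero_sub]
    refine neg_ne_zero.2 (mul_ne_zero (unit_cast_ne_zero K)
      (mul_ne_zero (Nat.cast_add_one_ne_zero p) ?_))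
    rw [show (p : K) + ((a : K) + 1 - p) = (a : K) + 1 by ring]
    exact Nat.cast_add_one_ne_zero a

end Lefschetz

end KimuraZeta

namespace KimuraZeta

/-! ### Classes of images of idempotents in the Grothendieck ring. -/

section IdempotentClasses

variable {C : Type u} [Category.{v} C] [Preadditive C] [HasBinaryBiproducts C]
  [MonoidalCategory C] [SymmetricCategory C]

/-- The projection from the monoid ring of isomorphism classes to the Grothendieck ring. -/
def K0.mk (C : Type u) [Category.{v} C] [Preadditive C] [HasBinaryBiproducts C]
    [MonoidalCategory C] [SymmetricCategory C] : MonoidAlgebra ℤ (Skeleton C) →+* K0 C :=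
  Ideal.Quotient.mk _

lemma K0.cls_eq_mk (A : C) :
    K0.cls A = K0.mk C (MonoidAlgebra.of ℤ (Skeleton C) (toSkeleton A)) := rfl

lemma K0.cls_congr {A B : C} (e : A ≅ B) : K0.cls A = K0.cls B := by
  rw [K0.cls, K0.cls, congr_toSkeleton_of_iso e]

lemma K0.cls_biprod (A B : C) : K0.cls (A ⊞ B) = K0.cls A + K0.cls B := by
  rw [K0.cls_eq_mk, K0.cls_eq_mk, K0.cls_eq_mk, ← map_add]
  exact Ideal.Quotient.eq.2 (Ideal.subset_span ⟨A, B, rfl⟩)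

lemma K0.cls_tensor (A B : C) : K0.cls (A ⊗ B) = K0.cls A * K0.cls B := by
  rw [K0.cls_eq_mk, K0.cls_eq_mk, K0.cls_eq_mk, ← map_mul, ← map_mul,
    Skeleton.toSkeleton_tensorObj]

lemma K0.cls_unit : K0.cls (𝟙_ C) = 1 := by
  rw [K0.cls_eq_mk, ← Skeleton.one_eq, map_one, map_one]

lemma K0.cls_eq_zero {A : C} (h : IsZero A) : K0.cls A = 0 := by
  have e : A ⊞ A ≅ A :=
    { hom := 0
      inv := 0
      hom_inv_id := (biprod.hom_ext' _ _ (h.eq_of_src _ _) (h.eq_of_src _ _))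
      inv_hom_id := h.eq_of_src _ _ }
  have h1 := K0.cls_congr e
  rwa [K0.cls_biprod, add_eq_left] at h1

variable [IsIdempotentComplete C]

open Classical in
/-- The class in the Grothendieck ring of the image of an idempotent. -/
def idemCls {X : C} (f : X ⟶ X) : K0 C :=
  if h : f ≫ f = f then K0.cls (IsIdempotentComplete.idempotents_split X f h).choose else 0

lemma idemCls_eq_cls {X Y : C} {f : X ⟶ X} {i : Y ⟶ X} {p : X ⟶ Y} (hi : i ≫ p = 𝟙 Y)
    (hp : p ≫ i = f) : idemCls f = K0.cls Y := by
  have h : f ≫ f = f := by rw [← hp, Category.assoc, reassoc_of% hi]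
  rw [idemCls, dif_pos h]
  obtain ⟨i', p', hi', hp'⟩ := (IsIdempotentComplete.idempotents_split X f h).choose_spec
  exact K0.cls_congr
    { hom := i' ≫ p
      inv := i ≫ p'
      hom_inv_id := by
        rw [Category.assoc, reassoc_of% hp, ← reassoc_of% hp', reassoc_of% hi', hi']
      inv_hom_id := by
        rw [Category.assoc, reassoc_of% hp', ← reassoc_of% hp, reassoc_of% hi, hi] }

lemma exists_splitting {X : C} {f : X ⟶ X} (h : f ≫ f = f) :
    ∃ (Y : C) (i : Y ⟶ X) (p : X ⟶ Y), i ≫ p = 𝟙 Y ∧ p ≫ i = f :=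
  IsIdempotentComplete.idempotents_split X f h

lemma iso_of_splittings {X X' Y Y' : C} {f : X ⟶ X} {g : X' ⟶ X'} {i : Y ⟶ X} {p : X ⟶ Y}
    (hi : i ≫ p = 𝟙 Y) (hp : p ≫ i = f) {i' : Y' ⟶ X'} {p' : X' ⟶ Y'} (hi' : i' ≫ p' = 𝟙 Y')
    (hp' : p' ≫ i' = g) {u : X ⟶ X'} {w : X' ⟶ X} (huw : u ≫ w = f) (hwu : w ≫ u = g) :
    Nonempty (Y ≅ Y') := by
  have hif : i ≫ f = i := by rw [← hp, reassoc_of% hi]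
  have hig : i' ≫ g = i' := by rw [← hp', reassoc_of% hi']
  exact ⟨{
    hom := i ≫ u ≫ p'
    inv := i' ≫ w ≫ p
    hom_inv_id := by
      simp only [Category.assoc]
      rw [reassoc_of% hp', ← hwu, Category.assoc, reassoc_of% huw, reassoc_of% huw,
        reassoc_of% hif, reassoc_of% hif, hi]
    inv_hom_id := by
      simp only [Category.assoc]
      rw [reassoc_of% hp, ← huw, Category.assoc, reassoc_of% hwu, reassoc_of% hwu,
        reassoc_of% hig, reassoc_of% hig, hi'] }⟩

lemma idemCls_congr {X X' : C} {f : X ⟶ X} {g : X' ⟶ X'} (hf : f ≫ f = f) (hg : g ≫ g = g)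
    {u : X ⟶ X'} {v : X' ⟶ X} (huv : u ≫ v = f) (hvu : v ≫ u = g) : idemCls f = idemCls g := by
  obtain ⟨Y, i, p, hi, hp⟩ := exists_splitting hf
  obtain ⟨Y', i', p', hi', hp'⟩ := exists_splitting hg
  rw [idemCls_eq_cls hi hp, idemCls_eq_cls hi' hp']
  obtain ⟨e⟩ := iso_of_splittings hi hp hi' hp' huv hvu
  exact K0.cls_congr e

lemma idemCls_id (X : C) : idemCls (𝟙 X) = K0.cls X :=
  idemCls_eq_cls (Category.id_comp (𝟙 X)) (Category.id_comp (𝟙 X))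

lemma idemCls_zero (X : C) : idemCls (0 : X ⟶ X) = 0 := by
  obtain ⟨Y, i, p, hi, hp⟩ := exists_splitting (f := (0 : X ⟶ X)) zero_comp
  rw [idemCls_eq_cls hi hp]
  refine K0.cls_eq_zero ((IsZero.iff_id_eq_zero Y).2 ?_)
  have h : 𝟙 Y = i ≫ (p ≫ i) ≫ p := by rw [Category.assoc, reassoc_of% hi, hi]
  rw [h, hp, zero_comp, comp_zero]

/-- Orthogonality makes the biproduct of the two images a splitting of the sum. -/
lemma idemCls_add {X : C} {f g : X ⟶ X} (hf : f ≫ f = f) (hg : g ≫ g = g) (hfg : f ≫ g = 0)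
    (hgf : g ≫ f = 0) : idemCls (f + g) = idemCls f + idemCls g := by
  obtain ⟨Y, i, p, hi, hp⟩ := exists_splitting hf
  obtain ⟨Y', i', p', hi', hp'⟩ := exists_splitting hg
  rw [idemCls_eq_cls hi hp, idemCls_eq_cls hi' hp', ← K0.cls_biprod]
  have h1 : i ≫ p' = 0 := by
    have : i ≫ p' = i ≫ (p ≫ i) ≫ (p' ≫ i') ≫ p' := by
      simp only [Category.assoc, hi', reassoc_of% hi, Category.comp_id]
    rw [this, hp, hp', reassoc_of% hfg, zero_comp, comp_zero]
  have h2 : i' ≫ p = 0 := by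
    have : i' ≫ p = i' ≫ (p' ≫ i') ≫ (p ≫ i) ≫ p := by
      simp only [Category.assoc, hi, reassoc_of% hi', Category.comp_id]
    rw [this, hp, hp', reassoc_of% hgf, zero_comp, comp_zero]
  refine idemCls_eq_cls (i := biprod.desc i i') (p := biprod.lift p p') ?_ ?_
  · ext <;> simp [hi, hi', h1, h2]
  · rw [biprod.lift_desc, hp, hp']

lemma idemCls_sum {X : C} {ι : Type*} (t : Finset ι) (f : ι → (X ⟶ X))
    (hf : ∀ a ∈ t, f a ≫ f a = f a) (hfg : ∀ a ∈ t, ∀ b ∈ t, a ≠ b → f a ≫ f b = 0) :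
    idemCls (∑ a ∈ t, f a) = ∑ a ∈ t, idemCls (f a) ∧
      (∑ a ∈ t, f a) ≫ (∑ a ∈ t, f a) = ∑ a ∈ t, f a := by
  classical
  induction t using Finset.induction_on with
  | empty => simp [idemCls_zero]
  | insert a t ha ih =>
    obtain ⟨ih1, ih2⟩ := ih (fun b hb => hf b (Finset.mem_insert_of_mem hb)) fun b hb c hc =>
      hfg b (Finset.mem_insert_of_mem hb) c (Finset.mem_insert_of_mem hc)
    have hl : f a ≫ ∑ b ∈ t, f b = 0 := by
      rw [Preadditive.comp_sum]
      exact Finset.sum_eq_zero fun b hb => hfg a (Finset.mem_insert_self a t) b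
        (Finset.mem_insert_of_mem hb) (ne_of_mem_of_not_mem hb ha).symm
    have hr : (∑ b ∈ t, f b) ≫ f a = 0 := by
      rw [Preadditive.sum_comp]
      exact Finset.sum_eq_zero fun b hb => hfg b (Finset.mem_insert_of_mem hb) a
        (Finset.mem_insert_self a t) (ne_of_mem_of_not_mem hb ha)
    have ha' := hf a (Finset.mem_insert_self a t)
    rw [Finset.sum_insert ha, Finset.sum_insert ha]
    refine ⟨by rw [idemCls_add ha' ih2 hl hr, ih1], ?_⟩
    rw [Preadditive.comp_add, Preadditive.add_comp, Preadditive.add_comp, ha', ih2, hl, hr,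
      add_zero, zero_add]

lemma idemCls_tensor {X Y : C} {f : X ⟶ X} {g : Y ⟶ Y} (hf : f ≫ f = f) (hg : g ≫ g = g) :
    idemCls (f ⊗ₘ g) = idemCls f * idemCls g := by
  obtain ⟨Z, i, p, hi, hp⟩ := exists_splitting hf
  obtain ⟨Z', i', p', hi', hp'⟩ := exists_splitting hg
  rw [idemCls_eq_cls hi hp, idemCls_eq_cls hi' hp', ← K0.cls_tensor]
  refine idemCls_eq_cls (i := i ⊗ₘ i') (p := p ⊗ₘ p') ?_ ?_
  · rw [MonoidalCategory.tensorHom_comp_tensorHom, hi, hi', id_tensorHom_id]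
  · rw [MonoidalCategory.tensorHom_comp_tensorHom, hp, hp']

variable (K : Type w) [Field K] [CharZero K] [Linear K C]

lemma idemCls_proj_one (M : C) (n : ℕ) : idemCls (proj K 1 M n) = K0.cls (symPow K n M) := by
  obtain ⟨i, p, hi, hp⟩ :=
    (IsIdempotentComplete.idempotents_split _ _ (permProj_idem K M n 1)).choose_spec
  rw [proj, signChar_one]
  exact idemCls_eq_cls hi hp

lemma idemCls_proj_neg_one (M : C) (n : ℕ) :
    idemCls (proj K (-1) M n) = K0.cls (extPow K n M) := by
  obtain ⟨i, p, hi, hp⟩ :=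
    (IsIdempotentComplete.idempotents_split _ _ (permProj_idem K M n Equiv.Perm.sign)).choose_spec
  rw [proj, signChar_neg_one]
  exact idemCls_eq_cls hi hp

end IdempotentClasses

end KimuraZeta

namespace KimuraZeta

/-! ### The Koszul complex and its homotopy. -/

section Koszul

variable (K : Type w) [Field K] [CharZero K] {C : Type u} [Category.{v} C] [Preadditive C]
  [Linear K C] [MonoidalCategory C] [SymmetricCategory C] [MonoidalPreadditive C]
  [MonoidalLinear K C]

lemma smul_tensorHom {X X' Y Y' : C} (a : K) (f : X ⟶ X') (g : Y ⟶ Y') :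
    (a • f) ⊗ₘ g = a • (f ⊗ₘ g) := by
  rw [← one_smul K g, smul_tensorHom_smul, mul_one, one_smul]

lemma tensorHom_smul {X X' Y Y' : C} (a : K) (f : X ⟶ X') (g : Y ⟶ Y') :
    f ⊗ₘ (a • g) = a • (f ⊗ₘ g) := by
  rw [← one_smul K f, smul_tensorHom_smul, one_mul, one_smul]

-- Expanding the projector `e'` by its recursion, the first term slides a factor over and back
-- again; the second leaves one crossing on the right-hand power.
variable {K} in
lemma slide_proj_slideInv {A X Y : C} {f : X ⟶ X} {f' : A ⊗ X ⟶ A ⊗ X} {e : Y ⟶ Y}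
    {e' Q : A ⊗ Y ⟶ A ⊗ Y} (hf : f ≫ f = f) (hf' : f' ≫ f' = f') (he : e ≫ e = e)
    (h1 : f' ≫ A ◁ f = f') (h2 : A ◁ f ≫ f' = f') {m b : K}
    (he' : m • e' = A ◁ e + b • (A ◁ e ≫ Q ≫ A ◁ e)) :
    m • ((f' ⊗ₘ e) ≫ slide A X Y ≫ (f ⊗ₘ e') ≫ slideInv A X Y ≫ (f' ⊗ₘ e))
      = (f' ⊗ₘ e) + b • ((f' ⊗ₘ e) ≫ slide A X Y ≫ X ◁ Q ≫ slideInv A X Y ≫ (f' ⊗ₘ e)) := by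
  have hl : (f' ⊗ₘ e) ≫ slide A X Y ≫ (f ⊗ₘ A ◁ e) = (f' ⊗ₘ e) ≫ slide A X Y := by
    rw [← slide_naturality, ← Category.assoc, MonoidalCategory.tensorHom_comp_tensorHom, h1, he]
  have hr : (f ⊗ₘ A ◁ e) ≫ slideInv A X Y ≫ (f' ⊗ₘ e) = slideInv A X Y ≫ (f' ⊗ₘ e) := by
    rw [reassoc_of% slideInv_naturality, MonoidalCategory.tensorHom_comp_tensorHom, h2, he]
  have hx : (f' ⊗ₘ e) ≫ (f' ⊗ₘ e) = f' ⊗ₘ e := by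
    rw [MonoidalCategory.tensorHom_comp_tensorHom, hf', he]
  have hQ : f ⊗ₘ A ◁ e ≫ Q ≫ A ◁ e = (f ⊗ₘ A ◁ e) ≫ X ◁ Q ≫ (f ⊗ₘ A ◁ e) := by
    rw [← id_tensorHom X Q, MonoidalCategory.tensorHom_comp_tensorHom,
      MonoidalCategory.tensorHom_comp_tensorHom, Category.id_comp, hf]
  have hfe : m • (f ⊗ₘ e') = (f ⊗ₘ A ◁ e) + b • ((f ⊗ₘ A ◁ e) ≫ X ◁ Q ≫ (f ⊗ₘ A ◁ e)) := by
    rw [← hQ]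
    rw [← tensorHom_smul, ← tensorHom_smul, he', MonoidalPreadditive.tensor_add]
  rw [← Linear.comp_smul, ← Linear.comp_smul, ← Linear.smul_comp, hfe]
  simp only [Preadditive.comp_add, Preadditive.add_comp, Linear.smul_comp, Linear.comp_smul,
    Category.assoc, hr]
  rw [reassoc_of% hl, reassoc_of% slide_slideInv, hx]

variable {K} in
lemma slideInv_proj_slide {A X Y : C} {f : X ⟶ X} {f' P : A ⊗ X ⟶ A ⊗ X} {e : Y ⟶ Y}
    {e' : A ⊗ Y ⟶ A ⊗ Y} (hf : f ≫ f = f) (he : e ≫ e = e) (he'' : e' ≫ e' = e')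
    (h1 : e' ≫ A ◁ e = e') (h2 : A ◁ e ≫ e' = e') {n a : K}
    (hf' : n • f' = A ◁ f + a • (A ◁ f ≫ P ≫ A ◁ f)) :
    n • ((f ⊗ₘ e') ≫ slideInv A X Y ≫ (f' ⊗ₘ e) ≫ slide A X Y ≫ (f ⊗ₘ e'))
      = (f ⊗ₘ e') + a • ((f ⊗ₘ e') ≫ slideInv A X Y ≫ P ▷ Y ≫ slide A X Y ≫ (f ⊗ₘ e')) := by
  have hl : (f ⊗ₘ e') ≫ slideInv A X Y ≫ (A ◁ f ⊗ₘ e) = (f ⊗ₘ e') ≫ slideInv A X Y := by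
    rw [← slideInv_naturality, ← Category.assoc, MonoidalCategory.tensorHom_comp_tensorHom, h1, hf]
  have hr : (A ◁ f ⊗ₘ e) ≫ slide A X Y ≫ (f ⊗ₘ e') = slide A X Y ≫ (f ⊗ₘ e') := by
    rw [reassoc_of% slide_naturality, MonoidalCategory.tensorHom_comp_tensorHom, h2, hf]
  have hx : (f ⊗ₘ e') ≫ (f ⊗ₘ e') = f ⊗ₘ e' := by
    rw [MonoidalCategory.tensorHom_comp_tensorHom, hf, he'']
  have hP : A ◁ f ≫ P ≫ A ◁ f ⊗ₘ e = (A ◁ f ⊗ₘ e) ≫ P ▷ Y ≫ (A ◁ f ⊗ₘ e) := by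
    rw [← tensorHom_id P Y, MonoidalCategory.tensorHom_comp_tensorHom,
      MonoidalCategory.tensorHom_comp_tensorHom, Category.id_comp, he]
  have hfe : n • (f' ⊗ₘ e) = (A ◁ f ⊗ₘ e) + a • ((A ◁ f ⊗ₘ e) ≫ P ▷ Y ≫ (A ◁ f ⊗ₘ e)) := by
    rw [← hP, ← smul_tensorHom, ← smul_tensorHom, hf', MonoidalPreadditive.add_tensor]
  rw [← Linear.comp_smul, ← Linear.comp_smul, ← Linear.smul_comp, hfe]
  simp only [Preadditive.comp_add, Preadditive.add_comp, Linear.smul_comp, Linear.comp_smul,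
    Category.assoc, hr]
  rw [reassoc_of% hl, reassoc_of% slideInv_slide, hx]

variable (A : C)

/-- `slide`, as a map between tensor powers. -/
def slidePow (i j : ℕ) : tensorPow A (i + 1) ⊗ tensorPow A j ⟶ tensorPow A i ⊗ tensorPow A (j + 1) :=
  slide A (tensorPow A i) (tensorPow A j)

/-- `slideInv`, as a map between tensor powers. -/
def slidePowInv (i j : ℕ) :
    tensorPow A i ⊗ tensorPow A (j + 1) ⟶ tensorPow A (i + 1) ⊗ tensorPow A j :=
  slideInv A (tensorPow A i) (tensorPow A j)

/-- The Koszul differential `Λⁱ⁺¹ ⊗ Sʲ ⟶ Λⁱ ⊗ Sʲ⁺¹`. -/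
def koszul (i j : ℕ) : tensorPow A (i + 1) ⊗ tensorPow A j ⟶ tensorPow A i ⊗ tensorPow A (j + 1) :=
  proj₂ K (-1) 1 A A (i + 1) j ≫ slidePow A i j ≫ proj₂ K (-1) 1 A A i (j + 1)

/-- The Koszul differential `Λⁱ ⊗ Sʲ⁺¹ ⟶ Λⁱ⁺¹ ⊗ Sʲ`. -/
def koszulInv (i j : ℕ) :
    tensorPow A i ⊗ tensorPow A (j + 1) ⟶ tensorPow A (i + 1) ⊗ tensorPow A j :=
  proj₂ K (-1) 1 A A i (j + 1) ≫ slidePowInv A i j ≫ proj₂ K (-1) 1 A A (i + 1) j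

lemma koszul_koszulInv_eq (i j : ℕ) : koszul K A i j ≫ koszulInv K A i j
    = proj₂ K (-1) 1 A A (i + 1) j ≫ slidePow A i j ≫ proj₂ K (-1) 1 A A i (j + 1) ≫
      slidePowInv A i j ≫ proj₂ K (-1) 1 A A (i + 1) j := by
  simp only [koszul, koszulInv, Category.assoc]
  rw [reassoc_of% (proj₂_comp_self K (-1) 1 A A i (j + 1))]

lemma koszulInv_koszul_eq (i j : ℕ) : koszulInv K A i j ≫ koszul K A i j
    = proj₂ K (-1) 1 A A i (j + 1) ≫ slidePowInv A i j ≫ proj₂ K (-1) 1 A A (i + 1) j ≫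
      slidePow A i j ≫ proj₂ K (-1) 1 A A i (j + 1) := by
  simp only [koszul, koszulInv, Category.assoc]
  rw [reassoc_of% (proj₂_comp_self K (-1) 1 A A (i + 1) j)]

lemma koszul_koszulInv_zero (i : ℕ) :
    koszul K A i 0 ≫ koszulInv K A i 0 = proj₂ K (-1) 1 A A (i + 1) 0 := by
  rw [koszul_koszulInv_eq]
  have h := slide_proj_slideInv (proj_comp_self K (-1) A i) (proj_comp_self K (-1) A (i + 1))
    (proj_comp_self K 1 A 0) (proj_comp_whiskerLeft K (-1) A i) (whiskerLeft_proj_comp K (-1) A i)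
    (proj_one_eq K 1 A)
  have h1 : ((0 + 1 : ℕ) : K) = 1 := by simp
  rw [zero_smul, add_zero, h1, one_smul] at h
  exact h

lemma koszulInv_koszul_zero (j : ℕ) :
    koszulInv K A 0 j ≫ koszul K A 0 j = proj₂ K (-1) 1 A A 0 (j + 1) := by
  rw [koszulInv_koszul_eq]
  have h := slideInv_proj_slide (proj_comp_self K (-1) A 0) (proj_comp_self K 1 A j)
    (proj_comp_self K 1 A (j + 1)) (proj_comp_whiskerLeft K 1 A j) (whiskerLeft_proj_comp K 1 A j)
    (proj_one_eq K (-1) A)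
  have h1 : ((0 + 1 : ℕ) : K) = 1 := by simp
  rw [zero_smul, add_zero, h1, one_smul] at h
  exact h

/-- The Koszul complex splits. -/
lemma koszul_homotopy (i j : ℕ) :
    (((j + 2 : ℕ) : K) * ((i + 1 : ℕ) : K)) • (koszul K A i (j + 1) ≫ koszulInv K A i (j + 1))
      + (((j + 1 : ℕ) : K) * ((i + 2 : ℕ) : K)) • (koszulInv K A (i + 1) j ≫ koszul K A (i + 1) j)
      = ((i + j + 2 : ℕ) : K) • proj₂ K (-1) 1 A A (i + 1) (j + 1) := by
  rw [koszul_koszulInv_eq, koszulInv_koszul_eq]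
  have h1 := slide_proj_slideInv (proj_comp_self K (-1) A i) (proj_comp_self K (-1) A (i + 1))
    (proj_comp_self K 1 A (j + 1)) (proj_comp_whiskerLeft K (-1) A i)
    (whiskerLeft_proj_comp K (-1) A i) (proj_succ_succ K 1 A j)
  have h2 := slideInv_proj_slide (proj_comp_self K (-1) A (i + 1)) (proj_comp_self K 1 A j)
    (proj_comp_self K 1 A (j + 1)) (proj_comp_whiskerLeft K 1 A j) (whiskerLeft_proj_comp K 1 A j)
    (proj_succ_succ K (-1) A i)
  have h3 : slidePow A i (j + 1) ≫ tensorPow A i ◁ swapPow A j ≫ slidePowInv A i (j + 1)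
      = slidePowInv A (i + 1) j ≫ swapPow A i ▷ tensorPow A j ≫ slidePow A (i + 1) j :=
    slide_swap_slideInv A (tensorPow A i) (tensorPow A j)
  have h1' : ((j + 2 : ℕ) : K) • (proj₂ K (-1) 1 A A (i + 1) (j + 1) ≫ slidePow A i (j + 1) ≫
      proj₂ K (-1) 1 A A i (j + 2) ≫ slidePowInv A i (j + 1) ≫
      proj₂ K (-1) 1 A A (i + 1) (j + 1))
      = proj₂ K (-1) 1 A A (i + 1) (j + 1) + ((((1 : ℤˣ) : ℤ) : K) * (j + 1 : ℕ)) •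
        (proj₂ K (-1) 1 A A (i + 1) (j + 1) ≫ slidePow A i (j + 1) ≫
          tensorPow A i ◁ swapPow A j ≫ slidePowInv A i (j + 1) ≫
          proj₂ K (-1) 1 A A (i + 1) (j + 1)) := h1
  have h2' : ((i + 2 : ℕ) : K) • (proj₂ K (-1) 1 A A (i + 1) (j + 1) ≫ slidePowInv A (i + 1) j ≫
      proj₂ K (-1) 1 A A (i + 2) j ≫ slidePow A (i + 1) j ≫
      proj₂ K (-1) 1 A A (i + 1) (j + 1))
      = proj₂ K (-1) 1 A A (i + 1) (j + 1) + ((((-1 : ℤˣ) : ℤ) : K) * (i + 1 : ℕ)) •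
        (proj₂ K (-1) 1 A A (i + 1) (j + 1) ≫ slidePowInv A (i + 1) j ≫
          swapPow A i ▷ tensorPow A j ≫ slidePow A (i + 1) j ≫
          proj₂ K (-1) 1 A A (i + 1) (j + 1)) := h2
  -- Now both expansions contain the same crossing term, with coefficients (i + 1)(j + 1) and -(i +
  -- 1)(j + 1). The identity terms add up to (i + 1) + (j + 1).
  rw [← reassoc_of% h3] at h2'
  rw [mul_comm ((j + 2 : ℕ) : K), mul_smul ((i + 1 : ℕ) : K), h1',
    mul_smul ((j + 1 : ℕ) : K) ((i + 2 : ℕ) : K), h2']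
  push_cast
  module

/-- The two factors moved over come from an antisymmetric power and land in a symmetric one. -/
lemma koszul_comp_koszul (i j : ℕ) : koszul K A (i + 1) j ≫ koszul K A i (j + 1) = 0 := by
  have hl : proj₂ K (-1) 1 A A (i + 2) j ≫ slidePow A (i + 1) j ≫
      proj₂ K (-1) 1 A A (i + 1) (j + 1) = proj₂ K (-1) 1 A A (i + 2) j ≫ slidePow A (i + 1) j ≫
      (𝟙 _ ⊗ₘ proj K 1 A (j + 1)) := by
    obtain ⟨w, hw, hw'⟩ : ∃ w : tensorPow A (i + 2) ⟶ tensorPow A (i + 2),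
        proj K (-1) A (i + 2) ≫ w = proj K (-1) A (i + 2) ∧
        slidePow A (i + 1) j ≫ (proj K (-1) A (i + 1) ⊗ₘ 𝟙 _) =
          (w ⊗ₘ 𝟙 _) ≫ slidePow A (i + 1) j := by
      refine ⟨A ◁ proj K (-1) A (i + 1), proj_comp_whiskerLeft K (-1) A (i + 1), ?_⟩
      refine Eq.trans ?_ (slide_naturality A (proj K (-1) A (i + 1)) (𝟙 (tensorPow A j))).symm
      rw [whiskerLeft_id]
      rfl
    rw [proj₂, proj₂, ← Category.comp_id (proj K (-1) A (i + 1)), ← Category.id_comp (proj K 1 A (j + 1)),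
      ← MonoidalCategory.tensorHom_comp_tensorHom, reassoc_of% hw', ← Category.assoc,
      MonoidalCategory.tensorHom_comp_tensorHom, hw, Category.comp_id, Category.id_comp]
  have hr : (𝟙 (tensorPow A (i + 1)) ⊗ₘ proj K 1 A (j + 1)) ≫ slidePow A i (j + 1) ≫
      proj₂ K (-1) 1 A A i (j + 2) = slidePow A i (j + 1) ≫ proj₂ K (-1) 1 A A i (j + 2) := by
    obtain ⟨w, hw, hw'⟩ : ∃ w : tensorPow A (j + 2) ⟶ tensorPow A (j + 2),
        w ≫ proj K 1 A (j + 2) = proj K 1 A (j + 2) ∧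
        (𝟙 _ ⊗ₘ proj K 1 A (j + 1)) ≫ slidePow A i (j + 1) =
          slidePow A i (j + 1) ≫ (𝟙 _ ⊗ₘ w) := by
      refine ⟨A ◁ proj K 1 A (j + 1), whiskerLeft_proj_comp K 1 A (j + 1), ?_⟩
      refine Eq.trans ?_ (slide_naturality A (𝟙 (tensorPow A i)) (proj K 1 A (j + 1)))
      rw [whiskerLeft_id]
      rfl
    rw [reassoc_of% hw', proj₂, MonoidalCategory.tensorHom_comp_tensorHom, hw, Category.id_comp]
  have h1 : swapPow A i ▷ tensorPow A j ≫ slidePow A (i + 1) j ≫ slidePow A i (j + 1)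
      = slidePow A (i + 1) j ≫ slidePow A i (j + 1) ≫ tensorPow A i ◁ swapPow A j :=
    swap_slide_slide A (tensorPow A i) (tensorPow A j)
  have h2 : proj₂ K (-1) 1 A A (i + 2) j ≫ swapPow A i ▷ tensorPow A j
      = (-1 : K) • proj₂ K (-1) 1 A A (i + 2) j := by
    have h : proj K (-1) A (i + 2) ≫ swapPow A i = (((-1 : ℤˣ) : ℤ) : K) • proj K (-1) A (i + 2) :=
      proj_comp_pass K (-1) A i
    rw [proj₂, ← tensorHom_id, MonoidalCategory.tensorHom_comp_tensorHom, h, smul_tensorHom,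
      Category.comp_id]
    push_cast
    rfl
  have h3 : tensorPow A i ◁ swapPow A j ≫ proj₂ K (-1) 1 A A i (j + 2)
      = proj₂ K (-1) 1 A A i (j + 2) := by
    have h : swapPow A j ≫ proj K 1 A (j + 2) = (((1 : ℤˣ) : ℤ) : K) • proj K 1 A (j + 2) :=
      pass_comp_proj K 1 A j
    rw [Units.val_one, Int.cast_one, one_smul] at h
    rw [proj₂, ← id_tensorHom, MonoidalCategory.tensorHom_comp_tensorHom, h, Category.id_comp]
  have h4 : proj₂ K (-1) 1 A A (i + 2) j ≫ slidePow A (i + 1) j ≫ slidePow A i (j + 1) ≫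
      proj₂ K (-1) 1 A A i (j + 2) = 0 := by
    -- Exchanging the two moving factors changes the sign at the source and nothing at the target.
    have h5 : (-1 : K) • (proj₂ K (-1) 1 A A (i + 2) j ≫ slidePow A (i + 1) j ≫
        slidePow A i (j + 1) ≫ proj₂ K (-1) 1 A A i (j + 2))
        = proj₂ K (-1) 1 A A (i + 2) j ≫ slidePow A (i + 1) j ≫ slidePow A i (j + 1) ≫
          proj₂ K (-1) 1 A A i (j + 2) := by
      rw [← Linear.smul_comp, ← h2, Category.assoc, reassoc_of% h1, h3]
    have h6 := sub_eq_zero.2 h5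
    rw [← one_smul K (_ ≫ _), smul_smul, ← sub_smul] at h6
    refine (smul_eq_zero.1 h6).resolve_left ?_
    norm_num
  simp only [koszul, Category.assoc]
  rw [reassoc_of% (proj₂_comp_self K (-1) 1 A A (i + 1) (j + 1)), reassoc_of% hl, hr, h4]

end Koszul

end KimuraZeta

namespace KimuraZeta

/-! ### The alternating sum of the Koszul complex in the Grothendieck ring. -/

section KoszulClasses

variable (K : Type w) [Field K] [CharZero K] {C : Type u} [Category.{v} C] [Preadditive C]
  [Linear K C] [MonoidalCategory C] [SymmetricCategory C] [MonoidalPreadditive C]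
  [MonoidalLinear K C] (A : C)

lemma idempotents_of_sum {X : C} {x p q : X ⟶ X} (h : p + q = x) (hp : x ≫ p = p)
    (hq : q ≫ x = q) (hq' : x ≫ q = q) (hqp : q ≫ p = 0) :
    p ≫ p = p ∧ q ≫ q = q ∧ p ≫ q = 0 := by
  subst h
  rw [Preadditive.add_comp, hqp, add_zero] at hp
  rw [Preadditive.comp_add, hqp, zero_add] at hq
  rw [Preadditive.add_comp, hq, add_eq_right] at hq'
  exact ⟨hp, hq, hq'⟩

/-- The idempotent of `Λⁱ⁺¹ ⊗ Sʲ` which projects onto a complement of the Koszul cycles. -/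
def koszulIdem (i j : ℕ) : tensorPow A (i + 1) ⊗ tensorPow A j ⟶ tensorPow A (i + 1) ⊗ tensorPow A j :=
  (((j + 1 : ℕ) : K) * ((i + 1 : ℕ) : K) / ((i + j + 1 : ℕ) : K)) •
    (koszul K A i j ≫ koszulInv K A i j)

/-- The idempotent of `Λⁱ ⊗ Sʲ⁺¹` which projects onto the Koszul boundaries. -/
def koszulIdem' (i j : ℕ) : tensorPow A i ⊗ tensorPow A (j + 1) ⟶ tensorPow A i ⊗ tensorPow A (j + 1) :=
  (((j + 1 : ℕ) : K) * ((i + 1 : ℕ) : K) / ((i + j + 1 : ℕ) : K)) •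
    (koszulInv K A i j ≫ koszul K A i j)

lemma koszulIdem_zero (i : ℕ) : koszulIdem K A i 0 = proj₂ K (-1) 1 A A (i + 1) 0 := by
  have h : ((i + 1 : ℕ) : K) ≠ 0 := Nat.cast_ne_zero.2 (by omega)
  rw [koszulIdem, koszul_koszulInv_zero, add_zero, zero_add, Nat.cast_one, one_mul, div_self h,
    one_smul]

lemma koszulIdem'_zero (j : ℕ) : koszulIdem' K A 0 j = proj₂ K (-1) 1 A A 0 (j + 1) := by
  have h : ((j + 1 : ℕ) : K) ≠ 0 := Nat.cast_ne_zero.2 (by omega)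
  rw [koszulIdem', koszulInv_koszul_zero, zero_add, zero_add, Nat.cast_one, mul_one, div_self h,
    one_smul]

lemma koszulIdem_add (i j : ℕ) : koszulIdem K A i (j + 1) + koszulIdem' K A (i + 1) j
    = proj₂ K (-1) 1 A A (i + 1) (j + 1) := by
  have h : ((i + j + 2 : ℕ) : K) ≠ 0 := Nat.cast_ne_zero.2 (by omega)
  refine smul_right_injective _ h ?_
  beta_reduce
  rw [← koszul_homotopy, smul_add, koszulIdem, koszulIdem', smul_smul, smul_smul]
  congr 2
  · rw [show i + (j + 1) + 1 = i + j + 2 by ring, mul_div_cancel₀ _ h]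
  · rw [show i + 1 + j + 1 = i + j + 2 by ring, mul_div_cancel₀ _ h]

lemma proj₂_koszul (i j : ℕ) :
    proj₂ K (-1) 1 A A (i + 1) j ≫ koszul K A i j = koszul K A i j := by
  rw [koszul, reassoc_of% (proj₂_comp_self K (-1) 1 A A (i + 1) j)]

lemma koszul_proj₂ (i j : ℕ) :
    koszul K A i j ≫ proj₂ K (-1) 1 A A i (j + 1) = koszul K A i j := by
  rw [koszul, Category.assoc, Category.assoc, proj₂_comp_self K (-1) 1 A A i (j + 1)]

lemma proj₂_koszulInv (i j : ℕ) :
    proj₂ K (-1) 1 A A i (j + 1) ≫ koszulInv K A i j = koszulInv K A i j := by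
  rw [koszulInv, reassoc_of% (proj₂_comp_self K (-1) 1 A A i (j + 1))]

/-- The two endomorphisms add up to the identity of Λⁱ⁺¹ ⊗ Sʲ⁺¹, and their product in one order
vanishes because the differential has square 0; by `idempotents_of_sum` this makes them orthogonal
idempotents. -/
lemma koszulIdem_spec (i j : ℕ) :
    koszulIdem K A i (j + 1) ≫ koszulIdem K A i (j + 1) = koszulIdem K A i (j + 1) ∧
    koszulIdem' K A (i + 1) j ≫ koszulIdem' K A (i + 1) j = koszulIdem' K A (i + 1) j ∧
    koszulIdem K A i (j + 1) ≫ koszulIdem' K A (i + 1) j = 0 ∧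
    koszulIdem' K A (i + 1) j ≫ koszulIdem K A i (j + 1) = 0 := by
  have h0 : koszulIdem' K A (i + 1) j ≫ koszulIdem K A i (j + 1) = 0 := by
    rw [koszulIdem, koszulIdem', Linear.smul_comp, Linear.comp_smul, Category.assoc,
      reassoc_of% (koszul_comp_koszul K A i j), zero_comp, comp_zero, smul_zero, smul_zero]
  obtain ⟨h1, h2, h3⟩ := idempotents_of_sum (koszulIdem_add K A i j)
    (by rw [koszulIdem, Linear.comp_smul, reassoc_of% (proj₂_koszul K A i (j + 1))])
    (by rw [koszulIdem', Linear.smul_comp, Category.assoc, koszul_proj₂ K A (i + 1) j])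
    (by rw [koszulIdem', Linear.comp_smul, reassoc_of% (proj₂_koszulInv K A (i + 1) j)]) h0
  exact ⟨h1, h2, h3, h0⟩

lemma koszulIdem_comp_self (i j : ℕ) :
    koszulIdem K A i j ≫ koszulIdem K A i j = koszulIdem K A i j := by
  cases j with
  | zero => rw [koszulIdem_zero, proj₂_comp_self]
  | succ j => exact (koszulIdem_spec K A i j).1

lemma koszulIdem'_comp_self (i j : ℕ) :
    koszulIdem' K A i j ≫ koszulIdem' K A i j = koszulIdem' K A i j := by
  cases i with
  | zero => rw [koszulIdem'_zero, proj₂_comp_self]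
  | succ i => exact (koszulIdem_spec K A i j).2.1

variable [HasBinaryBiproducts C] [IsIdempotentComplete C]

lemma idemCls_koszulIdem' (i j : ℕ) :
    idemCls (koszulIdem' K A i j) = idemCls (koszulIdem K A i j) := by
  refine idemCls_congr (koszulIdem'_comp_self K A i j) (koszulIdem_comp_self K A i j)
    (u := koszulInv K A i j) (v := (((j + 1 : ℕ) : K) * ((i + 1 : ℕ) : K) /
      ((i + j + 1 : ℕ) : K)) • koszul K A i j) ?_ ?_
  · rw [Linear.comp_smul, koszulIdem']
  · rw [Linear.smul_comp, koszulIdem]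

lemma idemCls_proj₂ (s t : ℤˣ) (D : C) (i j : ℕ) :
    idemCls (proj₂ K s t D A i j) = idemCls (proj K s D i) * idemCls (proj K t A j) :=
  idemCls_tensor (proj_comp_self K s D i) (proj_comp_self K t A j)

/-- Each [Λⁱ ⊗ Sʲ] is a sum of two classes, each of which recurs in the neighbouring term of the
complex, so the alternating sum telescopes. -/
lemma sum_koszul (n : ℕ) : ∑ ij ∈ Finset.HasAntidiagonal.antidiagonal (n + 1),
    (-1) ^ ij.1 * (idemCls (proj K (-1) A ij.1) * idemCls (proj K 1 A ij.2)) = 0 := by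
  simp only [← idemCls_proj₂]
  -- `t (i, j)` is the common class of the parts of Λⁱ⁺¹ ⊗ Sʲ and Λⁱ ⊗ Sʲ⁺¹ matched by the
  -- differential; `a` and `b` are `t` seen from the source and from the target.
  let t : ℕ × ℕ → K0 C := fun ij => idemCls (koszulIdem K A ij.1 ij.2)
  let a : ℕ × ℕ → K0 C := fun ij => match ij with
    | (0, _) => 0
    | (i + 1, j) => t (i, j)
  let b : ℕ × ℕ → K0 C := fun ij => match ij with
    | (_, 0) => 0
    | (i, j + 1) => t (i, j)
  have h : ∀ ij ∈ Finset.HasAntidiagonal.antidiagonal (n + 1),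
      (-1) ^ ij.1 * idemCls (proj₂ K (-1) 1 A A ij.1 ij.2)
        = (-1) ^ ij.1 * a ij + (-1) ^ ij.1 * b ij := by
    rintro ⟨i, j⟩ hij
    rw [← mul_add]
    congr 1
    match i, j with
    | 0, 0 => simp at hij
    | i + 1, 0 => simp only [a, b, t, add_zero, koszulIdem_zero]
    | 0, j + 1 => simp only [a, b, t, zero_add, ← idemCls_koszulIdem', koszulIdem'_zero]
    | i + 1, j + 1 =>
      obtain ⟨h1, h2, h3, h4⟩ := koszulIdem_spec K A i j
      simp only [a, b, t]
      rw [← koszulIdem_add, idemCls_add h1 h2 h3 h4, idemCls_koszulIdem']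
  rw [Finset.sum_congr rfl h, Finset.sum_add_distrib, Finset.Nat.sum_antidiagonal_succ,
    Finset.Nat.sum_antidiagonal_succ']
  simp only [a, b, mul_zero, zero_add, pow_succ]
  rw [← Finset.sum_add_distrib]
  refine Finset.sum_eq_zero fun ij _ => ?_
  ring

/-- The generating series of the classes of exterior powers, with alternating signs, is the
inverse of the zeta function. -/
lemma sum_koszul_cls (n : ℕ) : ∑ ij ∈ Finset.HasAntidiagonal.antidiagonal (n + 1),
    (-1) ^ ij.1 * (K0.cls (extPow K ij.1 A) * K0.cls (symPow K ij.2 A)) = 0 := by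
  simpa only [idemCls_proj_one, idemCls_proj_neg_one] using sum_koszul K A n

end KoszulClasses

end KimuraZeta

namespace KimuraZeta

/-! ### The Leibniz rule for symmetrization. -/

section SymmetricPowersOfSums

variable (K : Type w) [Field K] [CharZero K] {C : Type u} [Category.{v} C] [Preadditive C]
  [Linear K C] [MonoidalCategory C] [SymmetricCategory C] [MonoidalPreadditive C]
  [MonoidalLinear K C]

-- A Leibniz rule: after symmetrization, `p` meets either the first factor, where it cancels `i`, or
-- one of the factors covered by `j`.
variable {K} in
lemma restrict_comp_projection {A M W T : C} {i : A ⟶ M} {p : M ⟶ A} (hip : i ≫ p = 𝟙 A)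
    (j : W ⟶ M ⊗ T) {e : M ⊗ T ⟶ M ⊗ T} {e₂ : M ⊗ (M ⊗ T) ⟶ M ⊗ (M ⊗ T)} {m b : K}
    (h : m • e₂ = M ◁ e + b • (M ◁ e ≫ pass M M T ≫ M ◁ e)) :
    m • ((i ⊗ₘ j) ≫ e₂ ≫ p ▷ (M ⊗ T)) = A ◁ (j ≫ e)
      + A ◁ (b • (j ≫ e ≫ p ▷ T)) ≫ pass A A T ≫ A ◁ (i ▷ T ≫ e) := by
  rw [← Linear.comp_smul, ← Linear.smul_comp, h, Preadditive.add_comp, Preadditive.comp_add]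
  congr 1
  · rw [← id_tensorHom, ← tensorHom_id, MonoidalCategory.tensorHom_comp_tensorHom,
      MonoidalCategory.tensorHom_comp_tensorHom]
    simp [hip]
  · have h1 : pass M M T ≫ M ◁ e ≫ p ▷ (M ⊗ T) = M ◁ p ▷ T ≫ pass M A T ≫ A ◁ e := by
      rw [whisker_exchange, ← Category.assoc, ← Category.assoc]
      congr 1
      rw [← cancel_mono (pass A M T), Category.assoc, Category.assoc, pass_pass, Category.comp_id,
        ← pass_naturality_left, reassoc_of% pass_pass]
    simp only [Linear.smul_comp, Linear.comp_smul, MonoidalLinear.whiskerLeft_smul,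
      Category.assoc, h1]
    congr 1
    have h2 : pass A A T ≫ A ◁ (i ▷ T ≫ e) = i ▷ (A ⊗ T) ≫ pass M A T ≫ A ◁ e := by
      rw [MonoidalCategory.whiskerLeft_comp, reassoc_of% pass_naturality_left]
    rw [h2, MonoidalCategory.tensorHom_def']
    simp only [MonoidalCategory.whiskerLeft_comp, Category.assoc]
    rw [whisker_exchange_assoc, whisker_exchange_assoc, whisker_exchange_assoc,
      whisker_exchange_assoc]

-- The induction step of `inclPow_derivation`: the second Leibniz term is rewritten by `ih`, and the
-- two terms recombine into the recursion for the symmetrizer of the powers of `A`.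
variable {K} in
lemma derivation_step {A M X Y T : C} {i : A ⟶ M} {p : M ⟶ A} (hip : i ≫ p = 𝟙 A)
    (a : X ⊗ Y ⟶ T) (j : (A ⊗ X) ⊗ Y ⟶ M ⊗ T) (hj : j = (α_ A X Y).hom ≫ (i ⊗ₘ a))
    {e' : T ⟶ T} {e : M ⊗ T ⟶ M ⊗ T} {e₂ : M ⊗ (M ⊗ T) ⟶ M ⊗ (M ⊗ T)}
    {f : A ⊗ X ⟶ A ⊗ X} {f₂ : A ⊗ (A ⊗ X) ⟶ A ⊗ (A ⊗ X)} {m b m' b' : K}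
    (h : m • e₂ = M ◁ e + b • (M ◁ e ≫ pass M M T ≫ M ◁ e))
    (h' : m' • f₂ = A ◁ f + b' • (A ◁ f ≫ pass A A X ≫ A ◁ f))
    (he : M ◁ e' ≫ e = e) (hf : f ▷ Y ≫ j ≫ e = j ≫ e)
    (ih : b • (j ≫ e ≫ p ▷ T) = b' • (f ▷ Y ≫ (α_ A X Y).hom ≫ A ◁ (a ≫ e'))) :
    m • ((α_ A (A ⊗ X) Y).hom ≫ (i ⊗ₘ j) ≫ e₂ ≫ p ▷ (M ⊗ T))
      = m' • (f₂ ▷ Y ≫ (α_ A (A ⊗ X) Y).hom ≫ A ◁ (j ≫ e)) := by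
  have key : A ◁ A ◁ (a ≫ e') ≫ pass A A T ≫ A ◁ (i ▷ T ≫ e)
      = pass A A (X ⊗ Y) ≫ A ◁ (α_ A X Y).inv ≫ A ◁ (j ≫ e) := by
    rw [← reassoc_of% pass_naturality_right, ← MonoidalCategory.whiskerLeft_comp,
      ← MonoidalCategory.whiskerLeft_comp, hj]
    congr 2
    rw [Category.assoc, Iso.inv_hom_id_assoc, MonoidalCategory.tensorHom_def',
      MonoidalCategory.whiskerLeft_comp, Category.assoc, Category.assoc, whisker_exchange_assoc, he]
  have hassoc : A ◁ (α_ A X Y).hom ≫ pass A A (X ⊗ Y) ≫ A ◁ (α_ A X Y).inv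
      = (α_ A (A ⊗ X) Y).inv ≫ pass A A X ▷ Y ≫ (α_ A (A ⊗ X) Y).hom := by
    rw [pass_whiskerRight]; simp
  rw [← Linear.comp_smul, restrict_comp_projection hip j h, ih]
  rw [← Linear.smul_comp _ _ _ m', ← MonoidalLinear.smul_whiskerRight, h', MonoidalPreadditive.add_whiskerRight, Preadditive.add_comp, Preadditive.comp_add]
  have hf' : (A ◁ f) ▷ Y ≫ (α_ A (A ⊗ X) Y).hom ≫ A ◁ (j ≫ e)
      = (α_ A (A ⊗ X) Y).hom ≫ A ◁ (j ≫ e) := by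
    rw [associator_naturality_middle_assoc, ← MonoidalCategory.whiskerLeft_comp, hf]
  congr 1
  · exact hf'.symm
  · simp only [MonoidalLinear.whiskerLeft_smul, MonoidalLinear.smul_whiskerRight, Linear.smul_comp,
      Linear.comp_smul]
    congr 1
    simp only [MonoidalCategory.whiskerLeft_comp, comp_whiskerRight, Category.assoc] at hf' key ⊢
    rw [hf', key, reassoc_of% hassoc]
    rw [← associator_naturality_middle_assoc, Iso.hom_inv_id_assoc]

end SymmetricPowersOfSums

end KimuraZeta

namespace KimuraZeta

/-! ### Restriction of the symmetrizer to the summands of a tensor power. -/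

section SymmetricPowersOfSums

variable (K : Type w) [Field K] [CharZero K] {C : Type u} [Category.{v} C] [Preadditive C]
  [Linear K C] [MonoidalCategory C] [SymmetricCategory C] [MonoidalPreadditive C]
  [MonoidalLinear K C]

-- Both terms in the recursion for `f₂` are absorbed by the symmetrizer `e₂`, and their coefficients
-- 1 and `b` add up to `m`.
variable {K} in
lemma absorb_step {A M X Y T : C} {i : A ⟶ M} {a : X ⊗ Y ⟶ T} {j : (A ⊗ X) ⊗ Y ⟶ M ⊗ T}
    (hj : j = (α_ A X Y).hom ≫ (i ⊗ₘ a)) {e : M ⊗ T ⟶ M ⊗ T}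
    {e₂ : M ⊗ (M ⊗ T) ⟶ M ⊗ (M ⊗ T)} {f : A ⊗ X ⟶ A ⊗ X} {f₂ : A ⊗ (A ⊗ X) ⟶ A ⊗ (A ⊗ X)}
    {m b : K} (hm : m ≠ 0) (hmb : m = 1 + b)
    (h : m • f₂ = A ◁ f + b • (A ◁ f ≫ pass A A X ≫ A ◁ f))
    (he : M ◁ e ≫ e₂ = e₂) (hp : pass M M T ≫ e₂ = e₂) (hf : f ▷ Y ≫ j ≫ e = j ≫ e) :
    f₂ ▷ Y ≫ ((α_ A (A ⊗ X) Y).hom ≫ (i ⊗ₘ j)) ≫ e₂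
      = ((α_ A (A ⊗ X) Y).hom ≫ (i ⊗ₘ j)) ≫ e₂ := by
  have hie : (i ⊗ₘ j) ≫ e₂ = A ◁ (j ≫ e) ≫ i ▷ _ ≫ e₂ := by
    rw [MonoidalCategory.whiskerLeft_comp, Category.assoc, whisker_exchange_assoc, he,
      MonoidalCategory.tensorHom_def', Category.assoc]
  have h1 : (A ◁ f) ▷ Y ≫ ((α_ A (A ⊗ X) Y).hom ≫ (i ⊗ₘ j)) ≫ e₂
      = ((α_ A (A ⊗ X) Y).hom ≫ (i ⊗ₘ j)) ≫ e₂ := by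
    rw [Category.assoc, hie, associator_naturality_middle_assoc,
      ← MonoidalCategory.whiskerLeft_comp_assoc, hf]
  have h2 : pass A A X ▷ Y ≫ ((α_ A (A ⊗ X) Y).hom ≫ (i ⊗ₘ j)) ≫ e₂
      = ((α_ A (A ⊗ X) Y).hom ≫ (i ⊗ₘ j)) ≫ e₂ := by
    have h3 : (i ⊗ₘ j) = A ◁ (α_ A X Y).hom ≫ (i ⊗ₘ (i ⊗ₘ a)) := by
      rw [hj, ← id_tensorHom, MonoidalCategory.tensorHom_comp_tensorHom, Category.id_comp]
    rw [pass_whiskerRight, h3]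
    simp only [Category.assoc, Iso.inv_hom_id_assoc]
    rw [← MonoidalCategory.whiskerLeft_comp_assoc A (α_ A X Y).inv, Iso.inv_hom_id,
      MonoidalCategory.whiskerLeft_id, Category.id_comp, ← reassoc_of% pass_naturality, hp]
  have h4 : m • (f₂ ▷ Y ≫ ((α_ A (A ⊗ X) Y).hom ≫ (i ⊗ₘ j)) ≫ e₂)
      = m • (((α_ A (A ⊗ X) Y).hom ≫ (i ⊗ₘ j)) ≫ e₂) := by
    rw [← Linear.smul_comp, ← MonoidalLinear.smul_whiskerRight, h,
      MonoidalPreadditive.add_whiskerRight, MonoidalLinear.smul_whiskerRight,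
      Preadditive.add_comp, Linear.smul_comp, comp_whiskerRight, comp_whiskerRight, hmb, add_smul,
      one_smul]
    simp only [Category.assoc] at h1 h2 ⊢
    rw [h1, h2, h1]
  simpa [smul_smul, hm] using congrArg (m⁻¹ • ·) h4

variable {A B : C} (P : BinaryBicone A B)

/-- The inclusion of `A^{⊗ k} ⊗ B^{⊗ l}` in a tensor power of a sum of `A` and `B`. -/
def inclPow (l : ℕ) : (k : ℕ) → (tensorPow A k ⊗ tensorPow B l ⟶ tensorPow P.pt (l + k))
  | 0 => (λ_ _).hom ≫ tensorPowMap P.inr l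
  | k + 1 => (α_ _ _ _).hom ≫ (P.inl ⊗ₘ inclPow l k)

/-- The projection to `A^{⊗ k} ⊗ B^{⊗ l}` from a tensor power of a sum of `A` and `B`. -/
def projPow (l : ℕ) : (k : ℕ) → (tensorPow P.pt (l + k) ⟶ tensorPow A k ⊗ tensorPow B l)
  | 0 => tensorPowMap P.snd l ≫ (λ_ _).inv
  | k + 1 => (P.fst ⊗ₘ projPow l k) ≫ (α_ _ _ _).inv

/-- The projector of a tensor power of a sum of `A` and `B` onto the summand with `k` factors `A`
followed by factors `B`. -/
def shuffleProj : (n k : ℕ) → (tensorPow P.pt n ⟶ tensorPow P.pt n)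
  | 0, _ => 𝟙 _
  | n + 1, 0 => (P.snd ≫ P.inr) ⊗ₘ shuffleProj n 0
  | n + 1, k + 1 => (P.fst ≫ P.inl) ⊗ₘ shuffleProj n k

lemma shuffleProj_zero_right (n : ℕ) :
    shuffleProj P n 0 = tensorPowMap (P.snd ≫ P.inr) n := by
  induction n with
  | zero => rfl
  | succ n ih => exact congrArg (fun f => (P.snd ≫ P.inr) ⊗ₘ f) ih

lemma comp_leftUnitor_inv_comp {X Y Z : C} (f : X ⟶ Y) (g : Y ⟶ Z) :
    (f ≫ (λ_ Y).inv) ≫ (λ_ Y).hom ≫ g = f ≫ g := by simp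

lemma comp_associator_inv_comp {A' X Y Z M M' T : C} (p : M ⟶ A') (i : A' ⟶ M')
    (f : T ⟶ X ⊗ Y) (g : X ⊗ Y ⟶ Z) :
    ((p ⊗ₘ f) ≫ (α_ A' X Y).inv) ≫ (α_ A' X Y).hom ≫ (i ⊗ₘ g) = (p ≫ i) ⊗ₘ (f ≫ g) := by simp

lemma projPow_inclPow (l k : ℕ) : projPow P l k ≫ inclPow P l k = shuffleProj P (l + k) k := by
  induction k with
  | zero =>
    exact (comp_leftUnitor_inv_comp _ _).trans
      ((tensorPowMap_comp _ _ _).symm.trans (shuffleProj_zero_right P l).symm)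
  | succ k ih =>
    exact (comp_associator_inv_comp _ _ _ _).trans (congrArg (fun f => (P.fst ≫ P.inl) ⊗ₘ f) ih)

lemma inclPow_zero_comp_proj (l : ℕ) : inclPow P l 0 ≫ proj K 1 P.pt l
    = (λ_ _).hom ≫ proj K 1 B l ≫ tensorPowMap P.inr l := by
  rw [← tensorPowMap_proj]
  exact Category.assoc _ _ _

lemma inclPow_zero_comp_fst (l : ℕ) :
    inclPow P (l + 1) 0 ≫ proj K 1 P.pt (l + 1) ≫ P.fst ▷ tensorPow P.pt l = 0 := by
  have h : tensorPowMap P.inr (l + 1) ≫ P.fst ▷ tensorPow P.pt l = 0 := by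
    refine (congrArg (· ≫ P.fst ▷ tensorPow P.pt l) (MonoidalCategory.tensorHom_def'
      P.inr (tensorPowMap P.inr l))).trans ?_
    simp only [Category.assoc]
    rw [← comp_whiskerRight, P.inr_fst, MonoidalPreadditive.zero_whiskerRight, comp_zero]
    rfl
  have h1 := congrArg (fun f => f ≫ P.fst ▷ tensorPow P.pt l)
    (inclPow_zero_comp_proj K P (l + 1))
  refine (Category.assoc _ _ _).symm.trans (h1.trans ?_)
  refine (Category.assoc _ _ _).trans ?_
  refine (congrArg _ ((Category.assoc _ _ _).trans ((congrArg _ h).trans comp_zero))).trans comp_zero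

lemma proj_whiskerRight_inclPow_proj (k l : ℕ) :
    proj K 1 A k ▷ tensorPow B l ≫ inclPow P l k ≫ proj K 1 P.pt (l + k)
      = inclPow P l k ≫ proj K 1 P.pt (l + k) := by
  induction k with
  | zero => rw [proj_zero, id_whiskerRight, Category.id_comp]
  | succ k ih =>
    cases k with
    | zero => rw [proj_one, id_whiskerRight, Category.id_comp]
    | succ k =>
      have h1 := proj_succ_succ K 1 A k
      have h2 := pass_comp_proj K 1 P.pt (l + k)
      rw [Units.val_one, Int.cast_one, one_mul] at h1
      rw [Units.val_one, Int.cast_one, one_smul] at h2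
      exact absorb_step (j := inclPow P l (k + 1)) rfl
        (Nat.cast_ne_zero.2 (Nat.succ_ne_zero (k + 1))) (by push_cast; ring) h1
        (whiskerLeft_proj_comp K 1 P.pt (l + k + 1)) h2 ih

variable {K} in
lemma derivation_zero {A M X Y T : C} {i : A ⟶ M} {p : M ⟶ A} (hip : i ≫ p = 𝟙 A)
    (j : X ⊗ Y ⟶ M ⊗ T) {e : M ⊗ T ⟶ M ⊗ T} {e₂ : M ⊗ (M ⊗ T) ⟶ M ⊗ (M ⊗ T)} {m b : K}
    (h : m • e₂ = M ◁ e + b • (M ◁ e ≫ pass M M T ≫ M ◁ e)) (hj : j ≫ e ≫ p ▷ T = 0) :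
    m • (((α_ A X Y).hom ≫ (i ⊗ₘ j)) ≫ e₂ ≫ p ▷ (M ⊗ T)) = (α_ A X Y).hom ≫ A ◁ (j ≫ e) := by
  rw [Category.assoc, ← Linear.comp_smul, restrict_comp_projection hip j h, hj, smul_zero,
    MonoidalPreadditive.whiskerLeft_zero, zero_comp, add_zero]

lemma inclPow_succ_comp_fst {A M X Y T : C} {i : A ⟶ M} {p : M ⟶ A} (hip : i ≫ p = 𝟙 A)
    (j : X ⊗ Y ⟶ T) : ((α_ A X Y).hom ≫ (i ⊗ₘ j)) ≫ p ▷ T = (α_ A X Y).hom ≫ A ◁ j := by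
  rw [Category.assoc, ← tensorHom_id, MonoidalCategory.tensorHom_comp_tensorHom, hip,
    Category.comp_id, id_tensorHom]

/-- Projecting the first factor of a symmetrized tensor to `A` acts like a derivative: it removes
one of the k + 1 factors `A`. -/
lemma inclPow_derivation (k l : ℕ) :
    ((l + k + 1 : ℕ) : K) • (inclPow P l (k + 1) ≫ proj K 1 P.pt (l + k + 1) ≫
      P.fst ▷ tensorPow P.pt (l + k)) = ((k + 1 : ℕ) : K) • (proj K 1 A (k + 1) ▷ tensorPow B l ≫
        (α_ _ _ _).hom ≫ A ◁ (inclPow P l k ≫ proj K 1 P.pt (l + k))) := by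
  induction k with
  | zero =>
    have h0 : (proj K 1 A (0 + 1) ▷ tensorPow B l ≫ (α_ _ _ _).hom ≫
        A ◁ (inclPow P l 0 ≫ proj K 1 P.pt (l + 0)))
        = (α_ _ _ _).hom ≫ A ◁ (inclPow P l 0 ≫ proj K 1 P.pt (l + 0)) := by
      rw [proj_one, id_whiskerRight]
      exact Category.id_comp _
    have hone {X Y : C} (f : X ⟶ Y) : ((0 + 1 : ℕ) : K) • f = f := by simp
    rw [h0]
    refine Eq.trans ?_ (hone _).symm
    cases l with
    | zero =>
      refine (hone _).trans ?_
      rw [proj_one, proj_zero]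
      refine Eq.trans ?_ (congrArg (fun f => _ ≫ A ◁ f) (Category.comp_id _).symm)
      exact (congrArg (inclPow P 0 1 ≫ ·) (Category.id_comp _)).trans
        (inclPow_succ_comp_fst P.inl_fst (inclPow P 0 0))
    | succ l =>
      have h1 := proj_succ_succ K 1 P.pt l
      rw [Units.val_one, Int.cast_one, one_mul] at h1
      exact derivation_zero P.inl_fst (inclPow P (l + 1) 0) h1 (inclPow_zero_comp_fst K P l)
  | succ k ih =>
    have h1 := proj_succ_succ K 1 P.pt (l + k)
    have h2 := proj_succ_succ K 1 A k
    rw [Units.val_one, Int.cast_one, one_mul] at h1 h2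
    refine (congrArg _ (Category.assoc _ _ _)).trans ?_
    exact derivation_step P.inl_fst (inclPow P l k) (inclPow P l (k + 1)) rfl h1 h2
      (whiskerLeft_proj_comp K 1 P.pt (l + k)) (proj_whiskerRight_inclPow_proj K P (k + 1) l) ih

lemma comp_proj_succ {A' M X Y Z T : C} (j : Z ⟶ M ⊗ T) (e : M ⊗ T ⟶ M ⊗ T) (p : M ⟶ A')
    (q : T ⟶ X ⊗ Y) : j ≫ e ≫ ((p ⊗ₘ q) ≫ (α_ A' X Y).inv)
      = (j ≫ e ≫ p ▷ T) ≫ A' ◁ q ≫ (α_ A' X Y).inv := by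
  simp only [Category.assoc, MonoidalCategory.tensorHom_def]

lemma comp_proj_succ' {X Y T : C} (a : X ⊗ Y ⟶ T) (e : T ⟶ T) (f : X ⟶ X) (g : Y ⟶ Y)
    (f₂ : A ⊗ X ⟶ A ⊗ X) (hf : f₂ ≫ A ◁ f = f₂) (q : T ⟶ X ⊗ Y) {r : K}
    (h : r • (a ≫ e ≫ q) = f ⊗ₘ g) :
    r • ((f₂ ▷ Y ≫ (α_ A X Y).hom ≫ A ◁ (a ≫ e)) ≫ A ◁ q ≫ (α_ A X Y).inv) = f₂ ⊗ₘ g := by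
  have h1 : r • ((f₂ ▷ Y ≫ (α_ A X Y).hom ≫ A ◁ (a ≫ e)) ≫ A ◁ q ≫ (α_ A X Y).inv)
      = f₂ ▷ Y ≫ (α_ A X Y).hom ≫ A ◁ (r • (a ≫ e ≫ q)) ≫ (α_ A X Y).inv := by
    simp only [Category.assoc, MonoidalCategory.whiskerLeft_comp, MonoidalLinear.whiskerLeft_smul,
      Linear.comp_smul, Linear.smul_comp]
  rw [h1, h, ← id_tensorHom, ← associator_naturality_assoc, Iso.hom_inv_id, Category.comp_id,
    id_tensorHom, ← tensorHom_id, MonoidalCategory.tensorHom_comp_tensorHom, hf, Category.id_comp]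

lemma leftUnitor_conj {Y Z : C} {t : Y ⟶ Z} {q : Z ⟶ 𝟙_ C ⊗ Y} (h : t ≫ q = (λ_ Y).inv)
    (e : Y ⟶ Y) : ((λ_ Y).hom ≫ e ≫ t) ≫ q = 𝟙 (𝟙_ C) ⊗ₘ e := by
  rw [Category.assoc, Category.assoc, h, id_tensorHom, id_whiskerLeft]

/-- Only the share 1 / C(l + k, k) of the permutations, those preserving the two blocks, survives
inclusion and projection. The induction peels off the factors `A` by the derivation rule. -/
lemma choose_smul_inclPow_proj_projPow (k l : ℕ) :
    (((l + k).choose k : ℕ) : K) • (inclPow P l k ≫ proj K 1 P.pt (l + k) ≫ projPow P l k)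
      = proj₂ K 1 1 A B k l := by
  induction k with
  | zero =>
    have h1 := congrArg (fun f => f ≫ projPow P l 0) (inclPow_zero_comp_proj K P l)
    have h2 : tensorPowMap P.inr l ≫ projPow P l 0 = (λ_ _).inv := by
      refine (Category.assoc _ _ _).symm.trans ?_
      rw [← tensorPowMap_comp, P.inr_snd, tensorPowMap_id]
      exact Category.id_comp _
    rw [Nat.choose_zero_right, Nat.cast_one, one_smul, proj₂, proj_zero]
    exact (Category.assoc _ _ _).symm.trans (h1.trans (leftUnitor_conj h2 _))
  | succ k ih =>
    have hcomm {X Y : C} (a b : K) (f : X ⟶ Y) : a • b • f = b • a • f := by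
      rw [smul_smul, mul_comm, ← smul_smul]
    have hk : ((k + 1 : ℕ) : K) ≠ 0 := Nat.cast_ne_zero.2 (Nat.succ_ne_zero k)
    -- The factor l + k + 1 comes from the derivation rule and k + 1 is cancelled at the end; this
    -- is the corresponding recursion for binomial coefficients.
    have hc : ((k + 1 : ℕ) : K) * (((l + (k + 1)).choose (k + 1) : ℕ) : K)
        = (((l + k).choose k : ℕ) : K) * ((l + k + 1 : ℕ) : K) := by
      have := Nat.add_one_mul_choose_eq (l + k) k
      rw [← Nat.cast_mul, ← Nat.cast_mul, mul_comm (k + 1), mul_comm _ (l + k + 1)]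
      exact congrArg _ this.symm
    have h1 : ((l + k + 1 : ℕ) : K) • (inclPow P l (k + 1) ≫ proj K 1 P.pt (l + (k + 1)) ≫
        projPow P l (k + 1)) = ((k + 1 : ℕ) : K) • ((proj K 1 A (k + 1) ▷ tensorPow B l ≫
        (α_ _ _ _).hom ≫ A ◁ (inclPow P l k ≫ proj K 1 P.pt (l + k))) ≫
          A ◁ projPow P l k ≫ (α_ _ _ _).inv) := by
      refine (congrArg _ (comp_proj_succ (inclPow P l (k + 1)) (proj K 1 P.pt (l + k + 1)) P.fst
        (projPow P l k))).trans ?_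
      refine (Linear.smul_comp _ _ _ _ _ _).symm.trans ?_
      refine (congrArg (fun f => f ≫ A ◁ projPow P l k ≫ (α_ _ _ _).inv)
        (inclPow_derivation K P k l)).trans ?_
      exact Linear.smul_comp _ _ _ _ _ _
    have h2 := comp_proj_succ' K (inclPow P l k) (proj K 1 P.pt (l + k)) (proj K 1 A k)
      (proj K 1 B l) (proj K 1 A (k + 1)) (proj_comp_whiskerLeft K 1 A k) (projPow P l k) ih
    refine (smul_right_injective _ hk ?_).trans h2
    change _ • _ = _ • _
    rw [smul_smul, hc, ← smul_smul]
    exact (congrArg _ h1).trans (hcomm _ _ _)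

end SymmetricPowersOfSums

end KimuraZeta

namespace KimuraZeta

/-! ### Decomposition of the symmetric powers of a sum. -/

section SymmetricPowersOfSums

lemma sandwich_tensorHom {C : Type u} [Category.{v} C] [MonoidalCategory C] {M T : C}
    {e' : T ⟶ T} {e : M ⊗ T ⟶ M ⊗ T} (h : e ≫ M ◁ e' = e)
    (h' : M ◁ e' ≫ e = e) (f : M ⟶ M) (g : T ⟶ T) :
    e ≫ (f ⊗ₘ (e' ≫ g ≫ e')) ≫ e = e ≫ (f ⊗ₘ g) ≫ e := by
  have : f ⊗ₘ (e' ≫ g ≫ e') = M ◁ e' ≫ (f ⊗ₘ g) ≫ M ◁ e' := by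
    rw [← id_tensorHom, MonoidalCategory.tensorHom_comp_tensorHom,
      MonoidalCategory.tensorHom_comp_tensorHom, Category.id_comp, Category.comp_id]
  rw [this]
  simp only [Category.assoc]
  rw [h', reassoc_of% h]

lemma sandwich_exchange {C : Type u} [Category.{v} C] [MonoidalCategory C] [SymmetricCategory C]
    {M T : C} {e : M ⊗ (M ⊗ T) ⟶ M ⊗ (M ⊗ T)} (h : e ≫ pass M M T = e)
    (h' : pass M M T ≫ e = e) (f g : M ⟶ M) (r : T ⟶ T) :
    e ≫ (f ⊗ₘ (g ⊗ₘ r)) ≫ e = e ≫ (g ⊗ₘ (f ⊗ₘ r)) ≫ e := by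
  calc e ≫ (f ⊗ₘ (g ⊗ₘ r)) ≫ e = e ≫ (f ⊗ₘ (g ⊗ₘ r)) ≫ pass M M T ≫ e := by rw [h']
    _ = e ≫ (g ⊗ₘ (f ⊗ₘ r)) ≫ e := by rw [reassoc_of% pass_naturality, reassoc_of% h]

variable (K : Type w) [Field K] [CharZero K] {C : Type u} [Category.{v} C] [Preadditive C]
  [Linear K C] [MonoidalCategory C] [SymmetricCategory C] [MonoidalPreadditive C]
  [MonoidalLinear K C] {A B : C} (P : BinaryBicone A B)

/-- The component of the symmetrization with `k` factors `A`, up to a binomial coefficient. -/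
def symShuffle (n k : ℕ) : tensorPow P.pt n ⟶ tensorPow P.pt n :=
  proj K 1 P.pt n ≫ shuffleProj P n k ≫ proj K 1 P.pt n

lemma symShuffle_succ_succ (n k : ℕ) : symShuffle K P (n + 1) (k + 1)
    = proj K 1 P.pt (n + 1) ≫ ((P.fst ≫ P.inl) ⊗ₘ symShuffle K P n k) ≫ proj K 1 P.pt (n + 1) :=
  (sandwich_tensorHom (proj_comp_whiskerLeft K 1 P.pt n) (whiskerLeft_proj_comp K 1 P.pt n) _
    (shuffleProj P n k)).symm

/-- Between symmetrizers the order of the factors does not matter, so a factor `B` may be put first.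
The bound is needed: for `k > n` the map `shuffleProj P n k` consists of factors `A` only. -/
lemma symShuffle_succ (n k : ℕ) (h : k ≤ n) : symShuffle K P (n + 1) k
    = proj K 1 P.pt (n + 1) ≫ ((P.snd ≫ P.inr) ⊗ₘ symShuffle K P n k) ≫ proj K 1 P.pt (n + 1) := by
  induction n generalizing k with
  | zero =>
    obtain rfl : k = 0 := by omega
    exact (sandwich_tensorHom (proj_comp_whiskerLeft K 1 P.pt 0) (whiskerLeft_proj_comp K 1 P.pt 0)
      _ (shuffleProj P 0 0)).symm
  | succ n ih =>
    cases k with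
    | zero =>
      exact (sandwich_tensorHom (proj_comp_whiskerLeft K 1 P.pt (n + 1))
        (whiskerLeft_proj_comp K 1 P.pt (n + 1)) _ (shuffleProj P (n + 1) 0)).symm
    | succ k =>
      have h1 := pass_comp_proj K 1 P.pt n
      have h2 := proj_comp_pass K 1 P.pt n
      rw [Units.val_one, Int.cast_one, one_smul] at h1 h2
      rw [symShuffle_succ_succ, ih k (by omega)]
      refine (sandwich_tensorHom (proj_comp_whiskerLeft K 1 P.pt (n + 1))
        (whiskerLeft_proj_comp K 1 P.pt (n + 1)) _ _).trans ?_
      refine (sandwich_exchange h2 h1 _ _ _).trans ?_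
      rw [symShuffle_succ_succ]
      exact (sandwich_tensorHom (proj_comp_whiskerLeft K 1 P.pt (n + 1))
        (whiskerLeft_proj_comp K 1 P.pt (n + 1)) _ _).symm

lemma tensorHom_sum_choose {ι : Type*} {M T : C} (f : M ⟶ M) (e : M ⊗ T ⟶ M ⊗ T) (t : Finset ι)
    (c : ι → ℕ) (g : ι → (T ⟶ T)) :
    e ≫ (f ⊗ₘ ∑ i ∈ t, c i • g i) ≫ e = ∑ i ∈ t, c i • (e ≫ (f ⊗ₘ g i) ≫ e) := by
  let φ : (T ⟶ T) →+ (M ⊗ T ⟶ M ⊗ T) := AddMonoidHom.mk' (fun x => e ≫ (f ⊗ₘ x) ≫ e)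
    fun x y => by
      rw [MonoidalPreadditive.tensor_add, Preadditive.add_comp, Preadditive.comp_add]
  change φ _ = ∑ i ∈ t, c i • φ (g i)
  rw [map_sum]
  exact Finset.sum_congr rfl fun i _ => map_nsmul φ _ _

lemma sandwich_add {M T : C} (f g : M ⟶ M) (x : T ⟶ T) (e : M ⊗ T ⟶ M ⊗ T) :
    e ≫ ((f + g) ⊗ₘ x) ≫ e = e ≫ (f ⊗ₘ x) ≫ e + e ≫ (g ⊗ₘ x) ≫ e := by
  rw [MonoidalPreadditive.add_tensor, Preadditive.add_comp, Preadditive.comp_add]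

/-- The binomial theorem: the identity of the sum is the sum of its two projections, the first
factor is split accordingly, and Pascal's rule collects the terms. -/
lemma sum_symShuffle (hP : P.fst ≫ P.inl + P.snd ≫ P.inr = 𝟙 P.pt) (n : ℕ) :
    ∑ k ∈ Finset.range (n + 1), n.choose k • symShuffle K P n k = proj K 1 P.pt n := by
  induction n with
  | zero =>
    simp only [zero_add, Finset.range_one, Finset.sum_singleton, Nat.choose_self, one_smul,
      symShuffle, proj_zero, Category.id_comp, Category.comp_id]
    rfl
  | succ n ih =>
    have h1 : proj K 1 P.pt (n + 1) = proj K 1 P.pt (n + 1) ≫ ((P.fst ≫ P.inl + P.snd ≫ P.inr) ⊗ₘ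
        proj K 1 P.pt n) ≫ proj K 1 P.pt (n + 1) := by
      rw [hP, id_tensorHom]
      refine ((congrArg (_ ≫ ·) (whiskerLeft_proj_comp K 1 P.pt n)).trans
        (proj_comp_self K 1 P.pt (n + 1))).symm
    have h2 := Finset.sum_choose_succ_nsmul (fun i _ => symShuffle K P (n + 1) i) n
    rw [h2]
    refine Eq.trans ?_ h1.symm
    refine Eq.trans ?_ (sandwich_add _ _ _ _).symm
    rw [← ih]
    refine (add_comm _ _).trans (congrArg₂ (· + ·) ?_ ?_)
    · refine Eq.trans ?_ (tensorHom_sum_choose _ _ _ _ _).symm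
      exact Finset.sum_congr rfl fun k _ => congrArg _ (symShuffle_succ_succ K P n k)
    · refine Eq.trans ?_ (tensorHom_sum_choose _ _ _ _ _).symm
      refine Finset.sum_congr rfl fun k hk => congrArg _ (symShuffle_succ K P n k ?_)
      exact Nat.lt_succ_iff.1 (Finset.mem_range.1 hk)

lemma tensorPowMap_shuffleProj {g : P.pt ⟶ P.pt} {r : K}
    (ha : g ≫ P.fst ≫ P.inl = r • (P.fst ≫ P.inl)) (hb : g ≫ P.snd ≫ P.inr = P.snd ≫ P.inr)
    (n k : ℕ) (h : k ≤ n) :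
    tensorPowMap g n ≫ shuffleProj P n k = r ^ k • shuffleProj P n k := by
  induction n generalizing k with
  | zero =>
    obtain rfl : k = 0 := by omega
    rw [pow_zero, one_smul]; exact Category.id_comp _
  | succ n ih =>
    cases k with
    | zero =>
      rw [pow_zero, one_smul]
      refine (MonoidalCategory.tensorHom_comp_tensorHom _ _ _ _).trans ?_
      rw [hb, ih 0 (Nat.zero_le _), pow_zero, one_smul]
      rfl
    | succ k =>
      refine (MonoidalCategory.tensorHom_comp_tensorHom _ _ _ _).trans ?_
      rw [ha, ih k (by omega), smul_tensorHom_smul, pow_succ']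
      rfl

lemma shuffleProj_tensorPowMap {g : P.pt ⟶ P.pt} {r : K}
    (ha : (P.fst ≫ P.inl) ≫ g = r • (P.fst ≫ P.inl)) (hb : (P.snd ≫ P.inr) ≫ g = P.snd ≫ P.inr)
    (n k : ℕ) (h : k ≤ n) :
    shuffleProj P n k ≫ tensorPowMap g n = r ^ k • shuffleProj P n k := by
  induction n generalizing k with
  | zero =>
    obtain rfl : k = 0 := by omega
    rw [pow_zero, one_smul]; exact Category.id_comp _
  | succ n ih =>
    cases k with
    | zero =>
      rw [pow_zero, one_smul]
      refine (MonoidalCategory.tensorHom_comp_tensorHom _ _ _ _).trans ?_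
      rw [hb, ih 0 (Nat.zero_le _), pow_zero, one_smul]
      rfl
    | succ k =>
      refine (MonoidalCategory.tensorHom_comp_tensorHom _ _ _ _).trans ?_
      rw [ha, ih k (by omega), smul_tensorHom_smul, pow_succ']
      rfl

/-- Let `g` be 2 on `A` and 1 on `B`. Its tensor power commutes with the symmetrizer and acts by 2ᵏ
and 2ˡ on the two sides, and these differ in characteristic 0. -/
lemma shuffleProj_proj_shuffleProj {n k l : ℕ} (hk : k ≤ n) (hl : l ≤ n) (hkl : k ≠ l) :
    shuffleProj P n k ≫ proj K 1 P.pt n ≫ shuffleProj P n l = 0 := by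
  let g : P.pt ⟶ P.pt := (2 : K) • (P.fst ≫ P.inl) + P.snd ≫ P.inr
  have h1 := shuffleProj_tensorPowMap K P (g := g) (r := 2) (by simp [g]) (by simp [g]) n k hk
  have h2 := tensorPowMap_shuffleProj K P (g := g) (r := 2) (by simp [g]) (by simp [g]) n l hl
  have h3 : ((2 : K) ^ k) • (shuffleProj P n k ≫ proj K 1 P.pt n ≫ shuffleProj P n l)
      = ((2 : K) ^ l) • (shuffleProj P n k ≫ proj K 1 P.pt n ≫ shuffleProj P n l) := by
    rw [← Linear.smul_comp, ← h1, Category.assoc, reassoc_of% tensorPowMap_proj, h2,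
      Linear.comp_smul, Linear.comp_smul]
  have h4 : (2 : K) ^ k - 2 ^ l ≠ 0 := by
    rw [sub_ne_zero]
    exact_mod_cast fun h => hkl (Nat.pow_right_injective le_rfl h)
  have h5 : ((2 : K) ^ k - 2 ^ l) • (shuffleProj P n k ≫ proj K 1 P.pt n ≫ shuffleProj P n l) = 0 := by
    rw [sub_smul, h3, sub_self]
  exact (smul_eq_zero_iff_right h4).1 h5

lemma symShuffle_comp_symShuffle {n k l : ℕ} (hk : k ≤ n) (hl : l ≤ n) (hkl : k ≠ l) :
    symShuffle K P n k ≫ symShuffle K P n l = 0 := by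
  simp only [symShuffle, Category.assoc]
  rw [reassoc_of% (proj_comp_self K 1 P.pt n),
    reassoc_of% (shuffleProj_proj_shuffleProj K P hk hl hkl), zero_comp, comp_zero]

/-- Multiply by the symmetrizer, written as the sum of all components: by orthogonality only the
component itself remains. -/
lemma choose_smul_symShuffle_idem (hP : P.fst ≫ P.inl + P.snd ≫ P.inr = 𝟙 P.pt) {n k : ℕ}
    (hk : k ≤ n) : (n.choose k • symShuffle K P n k) ≫ (n.choose k • symShuffle K P n k)
      = n.choose k • symShuffle K P n k := by
  have h1 : (n.choose k • symShuffle K P n k) ≫ proj K 1 P.pt n = n.choose k • symShuffle K P n k := by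
    rw [Preadditive.nsmul_comp, symShuffle, Category.assoc, Category.assoc, proj_comp_self]
  conv_rhs => rw [← h1, ← sum_symShuffle K P hP n, Preadditive.comp_sum]
  rw [Finset.sum_eq_single_of_mem k (Finset.mem_range.2 (Nat.lt_succ_iff.2 hk))]
  intro l hl hlk
  rw [Preadditive.nsmul_comp, Preadditive.comp_nsmul, symShuffle_comp_symShuffle K P hk
    (Nat.lt_succ_iff.1 (Finset.mem_range.1 hl)) hlk.symm, smul_zero, smul_zero]

variable [HasBinaryBiproducts C] [IsIdempotentComplete C]

lemma idemCls_symShuffle (hP : P.fst ≫ P.inl + P.snd ≫ P.inr = 𝟙 P.pt) (l k : ℕ) :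
    idemCls ((l + k).choose k • symShuffle K P (l + k) k)
      = K0.cls (symPow K k A) * K0.cls (symPow K l B) := by
  have h1 := choose_smul_symShuffle_idem K P hP (Nat.le_add_left k l)
  have h2 := choose_smul_inclPow_proj_projPow K P k l
  have h3 := proj₂_comp_self K 1 1 A B k l
  have h4 := projPow_inclPow P l k
  rw [← idemCls_proj_one, ← idemCls_proj_one, ← idemCls_tensor (proj_comp_self K 1 A k)
    (proj_comp_self K 1 B l)]
  have hn {X Y : C} (n : ℕ) (f : X ⟶ Y) : n • f = (n : K) • f := (Nat.cast_smul_eq_nsmul K n f).symm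
  symm
  refine idemCls_congr (u := proj₂ K 1 1 A B k l ≫ inclPow P l k ≫ proj K 1 P.pt (l + k))
    (v := (((l + k).choose k : ℕ) : K) • (proj K 1 P.pt (l + k) ≫ projPow P l k ≫ proj₂ K 1 1 A B k l))
    h3 h1 ?_ ?_
  · have : (proj₂ K 1 1 A B k l ≫ inclPow P l k ≫ proj K 1 P.pt (l + k)) ≫
        ((((l + k).choose k : ℕ) : K) • (proj K 1 P.pt (l + k) ≫ projPow P l k ≫ proj₂ K 1 1 A B k l))
        = proj₂ K 1 1 A B k l ≫ ((((l + k).choose k : ℕ) : K) • (inclPow P l k ≫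
          proj K 1 P.pt (l + k) ≫ projPow P l k)) ≫ proj₂ K 1 1 A B k l := by
      simp only [Linear.comp_smul, Linear.smul_comp, Category.assoc]
      rw [reassoc_of% (proj_comp_self K 1 P.pt (l + k))]
    rw [this, h2, h3, h3]
    rfl
  · rw [← h1, hn]
    simp only [Linear.comp_smul, Linear.smul_comp, Category.assoc]
    rw [reassoc_of% h3, ← h2]
    simp only [Linear.comp_smul, Linear.smul_comp, Category.assoc, symShuffle, ← h4]
    rw [reassoc_of% (proj_comp_self K 1 P.pt (l + k))]

theorem cls_symPow_of_bicone (hP : P.fst ≫ P.inl + P.snd ≫ P.inr = 𝟙 P.pt) (n : ℕ) :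
    K0.cls (symPow K n P.pt) = ∑ ij ∈ Finset.HasAntidiagonal.antidiagonal n,
      K0.cls (symPow K ij.1 A) * K0.cls (symPow K ij.2 B) := by
  rw [Finset.Nat.sum_antidiagonal_eq_sum_range_succ
    (fun i j => K0.cls (symPow K i A) * K0.cls (symPow K j B)), ← idemCls_proj_one,
    ← sum_symShuffle K P hP n, (idemCls_sum _ _ ?_ ?_).1]
  · refine Finset.sum_congr rfl fun k hk => ?_
    obtain ⟨l, rfl⟩ := Nat.exists_eq_add_of_le' (Nat.lt_succ_iff.1 (Finset.mem_range.1 hk))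
    rw [idemCls_symShuffle K P hP, Nat.add_sub_cancel]
  · exact fun k hk => choose_smul_symShuffle_idem K P hP (Nat.lt_succ_iff.1 (Finset.mem_range.1 hk))
  · intro k hk l hl hkl
    rw [Preadditive.nsmul_comp, Preadditive.comp_nsmul, symShuffle_comp_symShuffle K P
      (Nat.lt_succ_iff.1 (Finset.mem_range.1 hk)) (Nat.lt_succ_iff.1 (Finset.mem_range.1 hl)) hkl,
      smul_zero, smul_zero]

end SymmetricPowersOfSums

end KimuraZeta

namespace KimuraZeta

/-! ### Invertible objects and their duals. -/

section Invertible

variable {C : Type u} [Category.{v} C] [MonoidalCategory C] [SymmetricCategory C]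

/-- Tensoring with an invertible object is an equivalence. -/
def tensorLeftEquivalence {L T : C} (e : L ⊗ T ≅ 𝟙_ C) : C ≌ C :=
  CategoryTheory.Equivalence.mk (tensorLeft T) (tensorLeft L)
    ((leftUnitorNatIso C).symm ≪≫ (tensoringLeft C).mapIso e.symm ≪≫ tensorLeftTensor L T)
    ((tensorLeftTensor T L).symm ≪≫ (tensoringLeft C).mapIso (β_ T L ≪≫ e) ≪≫ leftUnitorNatIso C)

/-- Tensoring with `T` and tensoring with the dual are both left adjoint to tensoring with `L`,
hence isomorphic; evaluate at the unit. -/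
lemma nonempty_tensor_rightDual_iso_unit {L : C} [HasRightDual L] (h : IsInvertible L) :
    Nonempty (L ⊗ Lᘁ ≅ 𝟙_ C) := by
  obtain ⟨T, ⟨e⟩⟩ := h
  have i : tensorLeft Lᘁ ≅ tensorLeft T :=
    (tensorLeftAdjunction L Lᘁ).leftAdjointUniq (tensorLeftEquivalence e).toAdjunction
  exact ⟨whiskerLeftIso L ((ρ_ _).symm ≪≫ i.app (𝟙_ C) ≪≫ ρ_ _) ≪≫ e⟩

end Invertible

/-! ### Additivity of the Euler characteristic; duals of sums. -/

section Trace

variable {C : Type u} [Category.{v} C] [MonoidalCategory C] [SymmetricCategory C]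

/-- Cyclicity of the trace: `i` is carried around the loop as its adjoint mate. -/
lemma coevaluation_comp_retract {A M : C} [HasRightDual A] [HasRightDual M] (i : A ⟶ M)
    (p : M ⟶ A) : η_ M Mᘁ ≫ (p ≫ i) ▷ Mᘁ ≫ (β_ M Mᘁ).hom ≫ ε_ M Mᘁ
      = η_ A Aᘁ ≫ (i ≫ p) ▷ Aᘁ ≫ (β_ A Aᘁ).hom ≫ ε_ A Aᘁ := by
  have h1 : i ▷ Mᘁ ≫ (β_ M Mᘁ).hom ≫ ε_ M Mᘁ = A ◁ iᘁ ≫ (β_ A Aᘁ).hom ≫ ε_ A Aᘁ := by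
    rw [BraidedCategory.braiding_naturality_left_assoc,
      BraidedCategory.braiding_naturality_right_assoc, rightAdjointMate_comp_evaluation]
  rw [comp_whiskerRight, Category.assoc, h1, ← whisker_exchange_assoc,
    reassoc_of% (coevaluation_comp_rightAdjointMate i), comp_whiskerRight, Category.assoc]

variable [Preadditive C] [MonoidalPreadditive C]

lemma eulerChar_of_bicone {A B : C} (P : BinaryBicone A B) [HasRightDual A] [HasRightDual B]
    [HasRightDual P.pt] (hP : P.fst ≫ P.inl + P.snd ≫ P.inr = 𝟙 P.pt) :
    eulerChar P.pt = eulerChar A + eulerChar B := by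
  have h := coevaluation_comp_retract P.inl P.fst
  have h' := coevaluation_comp_retract P.inr P.snd
  rw [P.inl_fst, id_whiskerRight, Category.id_comp] at h
  rw [P.inr_snd, id_whiskerRight, Category.id_comp] at h'
  rw [eulerChar, eulerChar, eulerChar, ← h, ← h', ← Preadditive.comp_add, ← Preadditive.add_comp,
    ← MonoidalPreadditive.add_whiskerRight, hP, id_whiskerRight, Category.id_comp]

lemma rightAdjointMate_add {X Y : C} [HasRightDual X] [HasRightDual Y] (f g : X ⟶ Y) :
    (f + g)ᘁ = fᘁ + gᘁ := by
  simp [rightAdjointMate]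

lemma rightAdjointMate_zero {X Y : C} [HasRightDual X] [HasRightDual Y] :
    (0 : X ⟶ Y)ᘁ = 0 := by
  simp [rightAdjointMate]

/-- The dual of a binary bicone. -/
def dualBicone {A B : C} (P : BinaryBicone A B) [HasRightDual A] [HasRightDual B]
    [HasRightDual P.pt] : BinaryBicone Aᘁ Bᘁ where
  pt := P.ptᘁ
  fst := P.inlᘁ
  snd := P.inrᘁ
  inl := P.fstᘁ
  inr := P.sndᘁ
  inl_fst := by rw [← comp_rightAdjointMate, P.inl_fst, rightAdjointMate_id]
  inl_snd := by rw [← comp_rightAdjointMate, P.inr_fst, rightAdjointMate_zero]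
  inr_fst := by rw [← comp_rightAdjointMate, P.inl_snd, rightAdjointMate_zero]
  inr_snd := by rw [← comp_rightAdjointMate, P.inr_snd, rightAdjointMate_id]

lemma dualBicone_total {A B : C} (P : BinaryBicone A B) [HasRightDual A] [HasRightDual B]
    [HasRightDual P.pt] (hP : P.fst ≫ P.inl + P.snd ≫ P.inr = 𝟙 P.pt) :
    (dualBicone P).fst ≫ (dualBicone P).inl + (dualBicone P).snd ≫ (dualBicone P).inr
      = 𝟙 (dualBicone P).pt := by
  change P.inlᘁ ≫ P.fstᘁ + P.inrᘁ ≫ P.sndᘁ = 𝟙 P.ptᘁ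
  rw [← comp_rightAdjointMate, ← comp_rightAdjointMate, ← rightAdjointMate_add, hP,
    rightAdjointMate_id]

end Trace

/-! ### Integrality of the Euler characteristic and invertibility of the top power. -/

section Dimension

variable (K : Type w) [Field K] [CharZero K] {C : Type u} [Category.{v} C] [Preadditive C]
  [Linear K C] [MonoidalCategory C] [SymmetricCategory C] [MonoidalPreadditive C]
  [MonoidalLinear K C] {s : ℤˣ} {A : C}

lemma proj_eq_zero_of_le {a b : ℕ} (h : proj K s A a = 0) (hab : a ≤ b) : proj K s A b = 0 := by
  induction b, hab using Nat.le_induction with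
  | base => exact h
  | succ b _ ih =>
    rw [← whiskerLeft_proj_comp, ih]
    exact (congrArg (· ≫ proj K s A (b + 1)) (MonoidalPreadditive.whiskerLeft_zero)).trans zero_comp

variable {K} in
/-- If a power of `A` vanishes, then the Euler characteristic of `A` is an integer, which
determines the powers that vanish. -/
lemma exists_dimension [RigidCategory C]
    (hK : Function.Bijective (algebraMap K (End (𝟙_ C)))) {N : ℕ} (hN : proj K s A N = 0) :
    ∃ p : ℕ, eulerChar A = (-((s : ℤ) : K) * p) • 𝟙 (𝟙_ C) ∧ proj K s A (p + 1) = 0 := by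
  classical
  obtain ⟨x, hx⟩ := hK.surjective (eulerChar A)
  rw [Algebra.algebraMap_eq_smul_one] at hx
  have hne : (𝟙 (𝟙_ C)) ≠ 0 := fun h0 => one_ne_zero (hK.injective
    ((map_one (algebraMap K (End (𝟙_ C)))).trans (h0.trans (map_zero _).symm)))
  have hex : ∃ N, proj K s A N = 0 := ⟨N, hN⟩
  -- The first vanishing power is not the one of degree 0, whose projector is the identity of the
  -- unit object.
  obtain ⟨p, hp⟩ : ∃ p, Nat.find hex = p + 1 := by
    refine Nat.exists_eq_succ_of_ne_zero fun h0 => hne ?_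
    have h1 := Nat.find_spec hex
    rw [h0, proj_zero] at h1
    exact h1
  have h1 : proj K s A (p + 1) = 0 := hp ▸ Nat.find_spec hex
  have h2 : proj K s A p ≠ 0 := Nat.find_min hex (by omega)
  have h3 := smul_proj_eq_zero (D := Aᘁ) K hx.symm h1
  refine ⟨p, ?_, h1⟩
  have h4 : x = -((s : ℤ) : K) * p := by
    by_contra h4
    refine h2 ((smul_eq_zero_iff_right fun h5 => h4 ?_).1 h3)
    rw [neg_mul]
    exact eq_neg_of_add_eq_zero_left h5
  rw [← h4, ← hx]
  rfl

lemma eq_natCast_smul_id (n : ℕ) : ((n : K) • 𝟙 (𝟙_ C) : 𝟙_ C ⟶ 𝟙_ C) = (n : End (𝟙_ C)) := by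
  rw [Nat.cast_smul_eq_nsmul]
  exact nsmul_one (A := End (𝟙_ C)) n

variable [HasBinaryBiproducts C] [IsIdempotentComplete C] {D : C} [ExactPairing A D]

variable {K} in
lemma idemCls_proj_dual_mul {p i : ℕ} (hi : i ≤ p)
    (hx : η_ A D ≫ (β_ A D).hom ≫ ε_ A D = (-((s : ℤ) : K) * p) • 𝟙 (𝟙_ C))
    (h : proj K s A (p + 1) = 0) :
    idemCls (proj K s D i) * idemCls (proj K s A p) = idemCls (proj K s A (p - i)) := by
  obtain ⟨k, rfl⟩ := Nat.exists_eq_add_of_le' hi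
  obtain ⟨u, w, huw, hwu⟩ := exists_equiv_proj₂ K D i k hx h
  have h1 := idemCls_congr (proj₂_comp_self K s s D A 0 k) (proj₂_comp_self K s s D A i (k + i))
    huw hwu
  rw [proj₂, proj₂, idemCls_tensor (proj_comp_self K s D 0) (proj_comp_self K s A k),
    idemCls_tensor (proj_comp_self K s D i) (proj_comp_self K s A (k + i)), proj_zero,
    idemCls_id] at h1
  rw [Nat.add_sub_cancel, ← h1]
  exact (congrArg (· * _) K0.cls_unit).trans (one_mul _)

variable {K} in
lemma idemCls_proj_dual_eq_zero {p i : ℕ} (hi : p < i)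
    (hx : η_ A D ≫ (β_ A D).hom ≫ ε_ A D = (-((s : ℤ) : K) * p) • 𝟙 (𝟙_ C))
    (h : proj K s A (p + 1) = 0) :
    idemCls (proj K s D i) * idemCls (proj K s A p) = 0 := by
  obtain ⟨a, rfl⟩ := Nat.exists_eq_add_of_lt hi
  rw [← idemCls_tensor (proj_comp_self K s D _) (proj_comp_self K s A p)]
  have h1 := proj₂_eq_zero K D a p hx h
  rw [show p + a + 1 = a + 1 + p by omega]
  exact (congrArg idemCls h1).trans (idemCls_zero _)

-- The string from (0, 0) to (p, p) identifies the unit with the product of the top powers of `D`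
-- and `A`.
variable {K} (D) in
lemma isInvertible_of_splitting {p : ℕ}
    (hx : η_ A D ≫ (β_ A D).hom ≫ ε_ A D = (-((s : ℤ) : K) * p) • 𝟙 (𝟙_ C))
    (h : proj K s A (p + 1) = 0) {L : C} {i : L ⟶ tensorPow A p} {q : tensorPow A p ⟶ L}
    (hi : i ≫ q = 𝟙 L) (hq : q ≫ i = proj K s A p) : IsInvertible L := by
  obtain ⟨L', i', q', hi', hq'⟩ := exists_splitting (proj_comp_self K s D p)
  obtain ⟨u, w, huw, hwu⟩ : ∃ (u : tensorPow D 0 ⊗ tensorPow A 0 ⟶ tensorPow D p ⊗ tensorPow A p)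
      (w : tensorPow D p ⊗ tensorPow A p ⟶ tensorPow D 0 ⊗ tensorPow A 0),
      u ≫ w = proj₂ K s s D A 0 0 ∧ w ≫ u = proj₂ K s s D A p p := by
    have h1 := exists_equiv_proj₂ K D p 0 (by rwa [zero_add]) (by rwa [zero_add])
    rwa [zero_add] at h1
  rw [proj₂, proj_zero, proj_zero, id_tensorHom_id] at huw
  obtain ⟨e⟩ := iso_of_splittings (Category.id_comp (𝟙 _)) (Category.id_comp (𝟙 _))
    (i' := i' ⊗ₘ i) (p' := q' ⊗ₘ q) (g := proj₂ K s s D A p p)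
    (by rw [MonoidalCategory.tensorHom_comp_tensorHom, hi, hi', id_tensorHom_id])
    (by rw [MonoidalCategory.tensorHom_comp_tensorHom, hq, hq', proj₂]) huw hwu
  exact ⟨L', ⟨β_ L L' ≪≫ e.symm ≪≫ λ_ (𝟙_ C)⟩⟩

end Dimension

end KimuraZeta

namespace KimuraZeta

/-! ### Reversal of polynomials and rational functions. -/

section FunctionalEquation

variable {R : Type u} [CommRing R]

/-- The polynomial `∑_{i ≤ p} f(i) Tⁱ`, as a Laurent polynomial. -/
def laurentSum (f : ℕ → R) (p : ℕ) : R[T;T⁻¹] :=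
  ∑ i ∈ Finset.range (p + 1), LaurentPolynomial.C (f i) * LaurentPolynomial.T (i : ℤ)

lemma toLaurentSeries_laurentSum {f : ℕ → R} {p : ℕ} (h : ∀ i, p < i → f i = 0) :
    toLaurentSeries R (laurentSum f p) = (PowerSeries.mk f : LaurentSeries R) := by
  have h1 : PowerSeries.mk f
      = ∑ i ∈ Finset.range (p + 1), PowerSeries.C (f i) * PowerSeries.X ^ i := by
    ext n
    rw [PowerSeries.coeff_mk, map_sum]
    simp only [PowerSeries.coeff_C_mul, PowerSeries.coeff_X_pow, mul_ite, mul_one, mul_zero,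
      Finset.sum_ite_eq, Finset.mem_range]
    split_ifs with hn
    · rfl
    · exact h n (by omega)
  rw [h1, laurentSum, map_sum, map_sum]
  refine Finset.sum_congr rfl fun i _ => ?_
  rw [toLaurentSeries_C_mul_T, map_mul, HahnSeries.ofPowerSeries_C, HahnSeries.ofPowerSeries_X_pow,
    HahnSeries.C_apply, HahnSeries.single_mul_single, zero_add, mul_one]

lemma isUnit_toLaurentSeries_laurentSum {f : ℕ → R} (p : ℕ) (h0 : IsUnit (f 0)) :
    IsUnit (toLaurentSeries R (laurentSum f p)) := by
  -- `f` is not assumed to vanish beyond `p`, so it is truncated before passing to a power series.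
  let g : ℕ → R := fun i => if i ≤ p then f i else 0
  have h1 : laurentSum f p = laurentSum g p :=
    Finset.sum_congr rfl fun i hi => by
      simp only [g, if_pos (Nat.lt_succ_iff.1 (Finset.mem_range.1 hi))]
  rw [h1, toLaurentSeries_laurentSum fun i hi => if_neg (by omega)]
  refine IsUnit.map (HahnSeries.ofPowerSeries ℤ R) ?_
  rw [PowerSeries.isUnit_iff_constantCoeff, ← PowerSeries.coeff_zero_eq_constantCoeff_apply,
    PowerSeries.coeff_mk]
  simpa [g] using h0

lemma invert_laurentSum (f : ℕ → R) (p : ℕ) : LaurentPolynomial.invert (laurentSum f p)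
    = LaurentPolynomial.T (-(p : ℤ)) * laurentSum (fun i => f (p - i)) p := by
  rw [laurentSum, laurentSum, map_sum, Finset.mul_sum,
    ← Finset.sum_range_reflect _ (p + 1)]
  refine Finset.sum_congr rfl fun i hi => ?_
  have hi' : i ≤ p := Nat.lt_succ_iff.1 (Finset.mem_range.1 hi)
  rw [show p + 1 - 1 - i = p - i by omega, map_mul,
    LaurentPolynomial.invert_C, LaurentPolynomial.invert_T, mul_left_comm,
    ← LaurentPolynomial.T_add]
  congr 2
  push_cast [hi']
  ring

/-- The lowest coefficient governs invertibility in T, the highest one in T⁻¹. -/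
lemma laurentSum_mem_denominators {f : ℕ → R} {p : ℕ} (h0 : IsUnit (f 0)) (hp : IsUnit (f p)) :
    laurentSum f p ∈ denominators R := by
  refine ⟨isUnit_toLaurentSeries_laurentSum p h0, ?_⟩
  change IsUnit (toLaurentSeries R (LaurentPolynomial.invert (laurentSum f p)))
  rw [invert_laurentSum, map_mul]
  refine IsUnit.mul ((LaurentPolynomial.isUnit_T _).map _) ?_
  exact isUnit_toLaurentSeries_laurentSum p (by simpa using hp)

lemma laurentSum_C_mul (r : R) (f : ℕ → R) (p : ℕ) :
    laurentSum (fun i => r * f i) p = LaurentPolynomial.C r * laurentSum f p := by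
  rw [laurentSum, laurentSum, Finset.mul_sum]
  exact Finset.sum_congr rfl fun i _ => by rw [map_mul, mul_assoc]

lemma laurentSum_congr {f g : ℕ → R} {p : ℕ} (h : ∀ i ≤ p, f i = g i) :
    laurentSum f p = laurentSum g p :=
  Finset.sum_congr rfl fun i hi => by rw [h i (Nat.lt_succ_iff.1 (Finset.mem_range.1 hi))]

/-- If the numerator and the denominator of two rational functions are polynomials whose
coefficients agree in reverse order up to units, then these functions satisfy a functional
equation. -/
theorem exists_functional_equation {z z' : PowerSeries R} {a a' b b' : ℕ → R} {p m : ℕ} {u v : R}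
    (hz : z * PowerSeries.mk a = PowerSeries.mk b)
    (hz' : z' * PowerSeries.mk a' = PowerSeries.mk b') (ha0 : a 0 = 1) (ha0' : a' 0 = 1)
    (ha : ∀ i, p < i → a i = 0) (ha' : ∀ i, p < i → a' i = 0)
    (hb : ∀ i, m < i → b i = 0) (hb' : ∀ i, m < i → b' i = 0)
    (haa : ∀ i ≤ p, a' (p - i) * u = a i) (hbb : ∀ i ≤ m, b' (m - i) = v * b i) :
    ∃ Z Z' : RationalFunction R, Z.expand = (z : LaurentSeries R) ∧
      Z'.expand = (z' : LaurentSeries R) ∧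
      Z'.invert = RationalFunction.monomial (u * v) ((p : ℤ) - m) * Z := by
  -- The two extreme cases give `u = a p` and `a' p * u = 1`, so `u` and the end coefficients of
  -- both denominators are units.
  have h1 := haa p le_rfl
  rw [Nat.sub_self, ha0', one_mul] at h1
  have h2 := haa 0 (Nat.zero_le p)
  rw [Nat.sub_zero, ha0] at h2
  let q := laurentSum a p
  let q' := laurentSum a' p
  let n := laurentSum b m
  let n' := laurentSum b' m
  have hq : q ∈ denominators R := laurentSum_mem_denominators (ha0 ▸ isUnit_one)
    (h1 ▸ IsUnit.of_mul_eq_one_right _ h2)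
  have hq' : q' ∈ denominators R := laurentSum_mem_denominators (ha0' ▸ isUnit_one)
    (IsUnit.of_mul_eq_one _ h2)
  refine ⟨IsLocalization.mk' _ n ⟨q, hq⟩, IsLocalization.mk' _ n' ⟨q', hq'⟩, ?_, ?_, ?_⟩
  · refine (IsLocalization.lift_mk'_spec _ _ _ _).2 ?_
    change toLaurentSeries R n = toLaurentSeries R q * _
    rw [toLaurentSeries_laurentSum hb, toLaurentSeries_laurentSum ha, ← map_mul, mul_comm, hz]
  · refine (IsLocalization.lift_mk'_spec _ _ _ _).2 ?_
    change toLaurentSeries R n' = toLaurentSeries R q' * _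
    rw [toLaurentSeries_laurentSum hb', toLaurentSeries_laurentSum ha', ← map_mul, mul_comm, hz']
  · have h3 : LaurentPolynomial.invert n' = LaurentPolynomial.T (-(m : ℤ)) * (LaurentPolynomial.C v * n) := by
      rw [invert_laurentSum, laurentSum_congr hbb, laurentSum_C_mul]
    have h4 : LaurentPolynomial.C u * LaurentPolynomial.invert q' = LaurentPolynomial.T (-(p : ℤ)) * q := by
      rw [invert_laurentSum, mul_left_comm, ← laurentSum_C_mul,
        laurentSum_congr fun i hi => (mul_comm u _).trans (haa i hi)]
    rw [RationalFunction.invert, IsLocalization.map_mk', IsLocalization.mk'_eq_iff_eq_mul]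
    change algebraMap _ _ (LaurentPolynomial.invert n') = _ * algebraMap _ _ (LaurentPolynomial.invert q')
    rw [RationalFunction.monomial, mul_right_comm, ← map_mul]
    have h5 : LaurentPolynomial.C (u * v) * LaurentPolynomial.T ((p : ℤ) - m) *
        LaurentPolynomial.invert q' = LaurentPolynomial.C v * LaurentPolynomial.T (-(m : ℤ)) * q := by
      rw [map_mul, sub_eq_add_neg, LaurentPolynomial.T_add]
      have h6 : LaurentPolynomial.T (R := R) (p : ℤ) * LaurentPolynomial.T (-(p : ℤ)) = 1 := by
        rw [← LaurentPolynomial.T_add, add_neg_cancel, LaurentPolynomial.T_zero]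
      linear_combination (LaurentPolynomial.C v * LaurentPolynomial.T (p : ℤ) * LaurentPolynomial.T (-(m : ℤ))) * h4
        + (LaurentPolynomial.C v * LaurentPolynomial.T (-(m : ℤ)) * q) * h6
    rw [h5, map_mul, mul_assoc, IsLocalization.mk'_spec'_mk, ← map_mul, h3]
    congr 1
    ring

end FunctionalEquation

end KimuraZeta

namespace KimuraZeta

/-! ### Zeta functions as quotients of polynomials. -/

section Zeta

variable (K : Type w) [Field K] [CharZero K] {C : Type u} [Category.{v} C] [Preadditive C]
  [Linear K C] [IsIdempotentComplete C] [MonoidalCategory C] [SymmetricCategory C]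

lemma exists_splitting_symPow (n : ℕ) (M : C) :
    ∃ (i : symPow K n M ⟶ tensorPow M n) (q : tensorPow M n ⟶ symPow K n M),
      i ≫ q = 𝟙 _ ∧ q ≫ i = proj K 1 M n := by
  rw [proj, signChar_one]
  exact (IsIdempotentComplete.idempotents_split _ _ (permProj_idem K M n 1)).choose_spec

lemma exists_splitting_extPow (n : ℕ) (M : C) :
    ∃ (i : extPow K n M ⟶ tensorPow M n) (q : tensorPow M n ⟶ extPow K n M),
      i ≫ q = 𝟙 _ ∧ q ≫ i = proj K (-1) M n := by
  rw [proj, signChar_neg_one]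
  exact (IsIdempotentComplete.idempotents_split _ _
    (permProj_idem K M n Equiv.Perm.sign)).choose_spec

variable [MonoidalPreadditive C] [MonoidalLinear K C] [HasBinaryBiproducts C]

variable {K} in
lemma exists_dimension_of_isPositive [RigidCategory C]
    (hK : Function.Bijective (algebraMap K (End (𝟙_ C)))) {A : C} (h : IsPositive K A) :
    ∃ p : ℕ, eulerChar A = (-(((-1 : ℤˣ) : ℤ) : K) * p) • 𝟙 (𝟙_ C) ∧
      proj K (-1) A (p + 1) = 0 ∧ IsInvertible (extPow K p A) := by
  obtain ⟨N, -, hN⟩ := h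
  obtain ⟨i, q, -, hq⟩ := exists_splitting_extPow K N A
  obtain ⟨p, hp, hp0⟩ := exists_dimension hK (s := -1) (A := A) (N := N)
    (by rw [← hq, hN.eq_of_tgt q 0, zero_comp])
  obtain ⟨i', q', hi', hq'⟩ := exists_splitting_extPow K p A
  exact ⟨p, hp, hp0, isInvertible_of_splitting Aᘁ hp hp0 hi' hq'⟩

variable {K} in
lemma exists_dimension_of_isNegative [RigidCategory C]
    (hK : Function.Bijective (algebraMap K (End (𝟙_ C)))) {A : C} (h : IsNegative K A) :
    ∃ m : ℕ, eulerChar A = (-(((1 : ℤˣ) : ℤ) : K) * m) • 𝟙 (𝟙_ C) ∧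
      proj K 1 A (m + 1) = 0 ∧ IsInvertible (symPow K m A) := by
  obtain ⟨N, -, hN⟩ := h
  obtain ⟨i, q, -, hq⟩ := exists_splitting_symPow K N A
  obtain ⟨m, hm, hm0⟩ := exists_dimension hK (s := 1) (A := A) (N := N)
    (by rw [← hq, hN.eq_of_tgt q 0, zero_comp])
  obtain ⟨i', q', hi', hq'⟩ := exists_splitting_symPow K m A
  exact ⟨m, hm, hm0, isInvertible_of_splitting Aᘁ hm hm0 hi' hq'⟩

/-- The biproduct structure on an object isomorphic to `A ⊞ B`. -/
def biconeOfIso {A B M : C} (e : M ≅ A ⊞ B) : BinaryBicone A B where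
  pt := M
  fst := e.hom ≫ biprod.fst
  snd := e.hom ≫ biprod.snd
  inl := biprod.inl ≫ e.inv
  inr := biprod.inr ≫ e.inv

lemma biconeOfIso_total {A B M : C} (e : M ≅ A ⊞ B) :
    (biconeOfIso e).fst ≫ (biconeOfIso e).inl + (biconeOfIso e).snd ≫ (biconeOfIso e).inr
      = 𝟙 (biconeOfIso e).pt := by
  have h : e.hom ≫ (biprod.fst ≫ biprod.inl + biprod.snd ≫ biprod.inr) ≫ e.inv = 𝟙 M := by
    rw [biprod.total, Category.id_comp, e.hom_inv_id]
  rw [Preadditive.add_comp, Preadditive.comp_add] at h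
  simp only [Category.assoc] at h
  change (e.hom ≫ biprod.fst) ≫ biprod.inl ≫ e.inv + (e.hom ≫ biprod.snd) ≫ biprod.inr ≫ e.inv = 𝟙 M
  simpa only [Category.assoc] using h

/-- The coefficients `(-1)ⁱ [Λⁱ(A)]` of the inverse of the zeta function. -/
def altExt (A : C) (i : ℕ) : K0 C := (-1) ^ i * K0.cls (extPow K i A)

lemma cls_symPow_zero (A : C) : K0.cls (symPow K 0 A) = 1 := by
  rw [← idemCls_proj_one, proj_zero, idemCls_id]
  exact K0.cls_unit

lemma altExt_zero (A : C) : altExt K A 0 = 1 := by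
  rw [altExt, pow_zero, one_mul, ← idemCls_proj_neg_one, proj_zero, idemCls_id]
  exact K0.cls_unit

lemma zeta_mul_altExt (A : C) : zeta K A * PowerSeries.mk (altExt K A) = 1 := by
  ext n
  rw [mul_comm, PowerSeries.coeff_mul, PowerSeries.coeff_one]
  simp only [zeta, PowerSeries.coeff_mk]
  cases n with
  | zero =>
    rw [Finset.Nat.antidiagonal_zero, Finset.sum_singleton, altExt_zero, cls_symPow_zero, one_mul,
      if_pos rfl]
  | succ n =>
    rw [if_neg (Nat.succ_ne_zero n), ← sum_koszul_cls K A n]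
    exact Finset.sum_congr rfl fun ij _ => mul_assoc _ _ _

lemma zeta_of_bicone {A B : C} (P : BinaryBicone A B)
    (hP : P.fst ≫ P.inl + P.snd ≫ P.inr = 𝟙 P.pt) : zeta K P.pt = zeta K A * zeta K B := by
  ext n
  rw [PowerSeries.coeff_mul]
  simp only [zeta, PowerSeries.coeff_mk]
  exact cls_symPow_of_bicone K P hP n

lemma zeta_mul_altExt_of_bicone {A B : C} (P : BinaryBicone A B)
    (hP : P.fst ≫ P.inl + P.snd ≫ P.inr = 𝟙 P.pt) :
    zeta K P.pt * PowerSeries.mk (altExt K A) = PowerSeries.mk fun n => K0.cls (symPow K n B) := by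
  rw [zeta_of_bicone K P hP, mul_right_comm, zeta_mul_altExt, one_mul]
  rfl

lemma altExt_eq_zero {A : C} {p i : ℕ} (h : proj K (-1) A (p + 1) = 0) (hi : p < i) :
    altExt K A i = 0 := by
  rw [altExt, ← idemCls_proj_neg_one, proj_eq_zero_of_le K h hi, idemCls_zero, mul_zero]

lemma cls_symPow_eq_zero {A : C} {m i : ℕ} (h : proj K 1 A (m + 1) = 0) (hi : m < i) :
    K0.cls (symPow K i A) = 0 := by
  rw [← idemCls_proj_one, proj_eq_zero_of_le K h hi, idemCls_zero]

/-! ### Coefficients for the dual object. -/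

section Dual

variable {K} {A D : C} [ExactPairing A D]

lemma isUnit_idemCls_proj {s : ℤˣ} {p : ℕ}
    (hx : η_ A D ≫ (β_ A D).hom ≫ ε_ A D = (-((s : ℤ) : K) * p) • 𝟙 (𝟙_ C))
    (h : proj K s A (p + 1) = 0) : IsUnit (idemCls (proj K s A p)) := by
  have h1 := idemCls_proj_dual_mul le_rfl hx h
  rw [Nat.sub_self, proj_zero, idemCls_id] at h1
  exact IsUnit.of_mul_eq_one_right _ (h1.trans K0.cls_unit)

/-- The product with the top power of `A` vanishes, and the class of that power is a unit. -/
lemma altExt_dual_eq_zero {p i : ℕ}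
    (hx : η_ A D ≫ (β_ A D).hom ≫ ε_ A D = (-(((-1 : ℤˣ) : ℤ) : K) * p) • 𝟙 (𝟙_ C))
    (h : proj K (-1) A (p + 1) = 0) (hi : p < i) : altExt K D i = 0 := by
  have h1 := idemCls_proj_dual_eq_zero hi hx h
  rw [altExt, ← idemCls_proj_neg_one, (isUnit_idemCls_proj hx h).mul_left_eq_zero.1 h1, mul_zero]

lemma cls_symPow_dual_eq_zero {m i : ℕ}
    (hx : η_ A D ≫ (β_ A D).hom ≫ ε_ A D = (-(((1 : ℤˣ) : ℤ) : K) * m) • 𝟙 (𝟙_ C))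
    (h : proj K 1 A (m + 1) = 0) (hi : m < i) : K0.cls (symPow K i D) = 0 := by
  have h1 := idemCls_proj_dual_eq_zero hi hx h
  rw [← idemCls_proj_one, (isUnit_idemCls_proj hx h).mul_left_eq_zero.1 h1]

/-- The pairing with the top exterior power, with signs: (-1)^(p - i) (-1)^p = (-1)^i. -/
lemma altExt_dual_mul {p i : ℕ}
    (hx : η_ A D ≫ (β_ A D).hom ≫ ε_ A D = (-(((-1 : ℤˣ) : ℤ) : K) * p) • 𝟙 (𝟙_ C))
    (h : proj K (-1) A (p + 1) = 0) (hi : i ≤ p) :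
    altExt K D (p - i) * ((-1) ^ p * K0.cls (extPow K p A)) = altExt K A i := by
  have h1 := idemCls_proj_dual_mul (Nat.sub_le p i) hx h
  rw [Nat.sub_sub_self hi, idemCls_proj_neg_one, idemCls_proj_neg_one, idemCls_proj_neg_one] at h1
  rw [altExt, altExt, ← h1]
  obtain ⟨k, rfl⟩ := Nat.exists_eq_add_of_le hi
  have h2 : ((-1) ^ k * (-1) ^ k : K0 C) = 1 := by rw [← mul_pow]; simp
  rw [Nat.add_sub_cancel_left, pow_add]
  linear_combination ((-1) ^ i * K0.cls (extPow K k D) * K0.cls (extPow K (i + k) A)) * h2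

lemma cls_symPow_dual {m j : ℕ} {v : K0 C}
    (hx : η_ A D ≫ (β_ A D).hom ≫ ε_ A D = (-(((1 : ℤˣ) : ℤ) : K) * m) • 𝟙 (𝟙_ C))
    (h : proj K 1 A (m + 1) = 0) (hv : K0.cls (symPow K m A) * v = 1) (hj : j ≤ m) :
    K0.cls (symPow K (m - j) D) = v * K0.cls (symPow K j A) := by
  have h1 := idemCls_proj_dual_mul (Nat.sub_le m j) hx h
  rw [Nat.sub_sub_self hj, idemCls_proj_one, idemCls_proj_one, idemCls_proj_one] at h1
  rw [← h1]
  linear_combination (-K0.cls (symPow K (m - j) D)) * hv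

end Dual

end Zeta

end KimuraZeta

end

/-! ### The functional equation. -/

theorem theorem1 {K : Type w} [Field K] [CharZero K]
    {C : Type u} [Category.{v} C] [Preadditive C] [Linear K C] [HasBinaryBiproducts C]
    [IsIdempotentComplete C] [MonoidalCategory C] [SymmetricCategory C] [MonoidalPreadditive C]
    [MonoidalLinear K C] [RigidCategory C]
    (hK : Function.Bijective (algebraMap K (End (𝟙_ C))))
    (M Mpos Mneg : C) (hpos : IsPositive K Mpos) (hneg : IsNegative K Mneg)
    (e : M ≅ Mpos ⊞ Mneg) :
    ∃ (p m : ℕ) (c : ℤ),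
      eulerChar Mpos = (p : End (𝟙_ C)) ∧ eulerChar Mneg = -(m : End (𝟙_ C)) ∧
      eulerChar M = (c : End (𝟙_ C)) ∧
      IsInvertible (extPow K p Mpos) ∧
      Nonempty (symPow K m Mneg ⊗ (symPow K m Mneg)ᘁ ≅ 𝟙_ C) ∧
      ∃ Z Zdual : RationalFunction (K0 C),
        Z.expand = (zeta K M : LaurentSeries (K0 C)) ∧
        Zdual.expand = (zeta K Mᘁ : LaurentSeries (K0 C)) ∧
        Zdual.invert = (-1) ^ p *
          RationalFunction.monomial (K0.cls (detObj K Mpos Mneg p m)) c * Z := by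
  obtain ⟨p, hp, hp0, hpi⟩ := exists_dimension_of_isPositive hK hpos
  obtain ⟨m, hm, hm0, hmi⟩ := exists_dimension_of_isNegative hK hneg
  have hP := biconeOfIso_total e
  obtain ⟨i⟩ := nonempty_tensor_rightDual_iso_unit hmi
  have hM := eulerChar_of_bicone (biconeOfIso e) hP
  have hp' := hp.trans ((congrArg (· • _) (by simp)).trans (eq_natCast_smul_id K p))
  have hm' : eulerChar Mneg = -(m : End (𝟙_ C)) := by
    rw [← eq_natCast_smul_id K m, hm]
    simp
  refine ⟨p, m, p - m, hp', hm', ?_, hpi, ⟨i⟩, ?_⟩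
  · refine hM.trans ?_
    rw [hp', hm', sub_eq_add_neg, Int.cast_add, Int.cast_neg, Int.cast_natCast, Int.cast_natCast]
  have hv : K0.cls (symPow K m Mneg) * K0.cls (symPow K m Mneg)ᘁ = 1 :=
    (K0.cls_tensor _ _).symm.trans ((K0.cls_congr i).trans K0.cls_unit)
  -- The units comparing the reversed coefficients are (-1)^p [Λᵖ(M⁺)] for the denominators and the
  -- class of the dual of Sᵐ(M⁻) for the numerators; their product is (-1)^p [det(M)].
  obtain ⟨Z, Z', hZ, hZ', h⟩ := exists_functional_equation
    (zeta_mul_altExt_of_bicone K (biconeOfIso e) hP)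
    (zeta_mul_altExt_of_bicone K (dualBicone (biconeOfIso e)) (dualBicone_total _ hP))
    (altExt_zero K Mpos) (altExt_zero K Mposᘁ) (fun _ => altExt_eq_zero K hp0)
    (fun _ => altExt_dual_eq_zero hp hp0) (fun _ => cls_symPow_eq_zero K hm0)
    (fun _ => cls_symPow_dual_eq_zero hm hm0) (fun _ => altExt_dual_mul hp hp0)
    (fun _ => cls_symPow_dual hm hm0 hv)
  refine ⟨Z, Z', hZ, hZ', h.trans (congrArg (· * Z) ?_)⟩
  rw [RationalFunction.monomial, RationalFunction.monomial, detObj, K0.cls_tensor, mul_assoc,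
    map_mul LaurentPolynomial.C, map_pow, map_neg, map_one, mul_assoc, map_mul, map_pow, map_neg,
    map_one]
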